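/- Let $K$ be a field of characteristic zero and $N\ge 1$ an integer; put $\mathcal D=\{(x,y)\in\mathbb Z_{\ge0}^2: x+y\le N\}$ and $A_2=\{(0,0),(1,-1),(1,0),(0,1),(-1,1),(-1,0),(0,-1)\}$; $\lambda,\chi\in\mathcal D$ are adjacent if $\lambda-\chi\in A_2$. **Parameter arrays.** A parameter array of diameter $d\geq 0$ is the array $\Phi=(\theta_i,\theta_i^\star,\ 0\le i\le d;\ \varphi_i,\phi_i,\ 1\le i\le d)$ of a Leonard system: there are endomorphisms $A,A^\star$ of a $(d+1)$-dimensional space, with mutually distinct eigenvalues $\theta_0,\dots,\theta_d$ and $\theta^\star_0,\dots,\theta_d^\star$ respectively, such that $A^\star$ is irreducible tridiagonal in a basis where $A=\mathrm{diag}(\theta_0,\dots,\theta_d)$, $A$ is irreducible tridiagonal in a basis where $A^\star=\mathrm{diag}(\theta^\star_0,\dots,\theta^\star_d)$, and there are bases $(w_i)$, $(w_i')$ with $Aw_i=\theta_iw_i+w_{i+1}$, $A^\star w_i=\theta_i^\star w_i+\varphi_iw_{i-1}$ and $Aw'_i=\theta_{d-i}w'_i+w'_{i+1}$, $A^\star w'_i=\theta_i^\star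 w'_i+\phi_iw'_{i-1}$ (vectors with index outside $0,\dots,d$ are zero). We then say that $\Phi$ is the parameter array of $(A,A^\star)$. Put $\Phi^\star=(\theta^\star_i,\theta_i;\varphi_j,\phi_{d-j+1})$, $$a_i(\Phi)=\theta_i+\frac{\varphi_i}{\theta_i^\star-\theta_{i-1}^\star}+\frac{\varphi_{i+1}}{\theta_i^\star-\theta_{i+1}^\star},\quad b_i(\Phi)=\varphi_{i+1}\frac{\prod_{h=0}^{i-1}(\theta_i^\star-\theta_h^\star)}{\prod_{h=0}^{i}(\theta_{i+1}^\star-\theta_h^\star)},\quad c_i(\Phi)=\phi_i\frac{\prod_{h=0}^{d-i-1}(\theta_i^\star-\theta_{d-h}^\star)}{\prod_{h=0}^{d-i}(\theta_{i-1}^\star-\theta_{d-h}^\star)},$$ where $0\le i\le d$ for $a_i$ (the terms with $\varphi_0$, $\varphi_{d+1}$ being absent), $0\le i\le d-1$ for $b_i$, $1\le i\le d$ for $c_i$, and $b_{-1}=b_d=c_0=c_{d+1}=0$. Let $u_i(z)=\sum_{k=0}^i\prod_{h=0}^{k-1}\frac{(z-\theta_h)(\theta_i^\star-\theta_h^\star)}{\varphi_{h+1}}$,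 $$k_i(\Phi)=\prod_{h=1}^i\frac{\varphi_h}{\phi_h}\,\frac{\prod_{h=1}^d(\theta_0^\star-\theta_h^\star)}{\prod_{h\ne i}(\theta_i^\star-\theta_h^\star)},\qquad p_{xi}(\Phi)=k_i(\Phi)u_i(\theta_x),\qquad \nu(\Phi)=\prod_{h=1}^d\frac{(\theta_0-\theta_h)(\theta_0^\star-\theta_h^\star)}{\phi_h},$$ with $p_{xi}(\Phi)=0$ unless $0\le x,i\le d$. **Factorized $A_2$-Leonard pairs.** An $A_2$-Leonard pair on a $K$-vector space $V$ is a pair $(H,H^\star)$ of two-dimensional subspaces of $\mathrm{End}(V)$, each consisting of commuting diagonalizable elements, such that: (iii) there is a bijection $\lambda\mapsto V_\lambda$ from $\mathcal D$ to the common eigenspaces of $H$ with $H^\star V_\lambda\subseteq\sum_{\chi\text{ adj }\lambda}V_\chi$; (iv) there is a bijection $\lambda\mapsto V^\star_\lambda$ from $\mathcal D$ to the common eigenspaces of $H^\star$ with $HV^\star_\lambda\subseteq\sum_{\chi\text{ adj }\lambda}V^\star_\chi$; no subspace other than $0$ and $V$ is invariant under $H$ and $H^\star$; all $V_\lambda,V_\lambda^\star$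 are one-dimensional; and there is a non-degenerate symmetric bilinear form on $V$ with $\langle V_\lambda,V_\chi\rangle=\langle V^\star_\lambda,V^\star_\chi\rangle=0$ for $\lambda\ne\chi$. It is factorized, with basis $(X,Y;X^\star,Y^\star)$, if $X,Y$ is a basis of $H$, $X^\star,Y^\star$ is a basis of $H^\star$, $X$ acts on each $V_{(x,y)}$ as a scalar depending only on $x$ and $Y^\star$ acts on each $V^\star_{(i,j)}$ as a scalar depending only on $j$, these scalars being distinct for distinct $x$, respectively distinct $j$; $[X,Y^\star]=0$; each common eigenspace of $X$ and $Y^\star$ is one-dimensional; and, for $(i,j),(i+1,j)\in\mathcal D$ and $(x,y),(x,y+1)\in\mathcal D$, the numbers $\langle V^\star_{(i+1,j)},XV^\star_{(i,j)}\rangle$, $\langle V^\star_{(i,j)},XV^\star_{(i+1,j)}\rangle$, $\langle V_{(x,y+1)},Y^\star V_{(x,y)}\rangle$, $\langle V_{(x,y)},Y^\star V_{(x,y+1)}\rangle$ are non-zero. **Compatibility.** For $0\le j,x\le N$ let $$\Phi_j=(t_x,t_x^\star(j),\ 0\le x\le N-j;\ f_x(j),g_x(j),\ 1\le x\le N-j),\qquad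 \Psi_x=(\theta_j(x),\theta_j^\star,\ 0\le j\le N-x;\ \varphi_j(x),\phi_j(x),\ 1\le j\le N-x)$$ be parameter arrays of diameters $N-j$ and $N-x$. They are compatible if the following three requirements hold. (1) There are $C^{\epsilon,\epsilon'}_{i,j}\in K$ such that, for all $(i,j)\in\mathcal D$, $$c_{j+1}(\Psi_x)p_{xi}(\Phi_j)=\sum_{\epsilon=-1,0}C^{\epsilon,+}_{i,j}p_{x,i+\epsilon}(\Phi_{j+1})\quad(0\le x\le N-j-1),$$ $$a_j(\Psi_x)p_{xi}(\Phi_j)=\sum_{\epsilon=0,\pm1}C^{\epsilon,0}_{i,j}p_{x,i+\epsilon}(\Phi_j)\quad(0\le x\le N-j),$$ $$b_{j-1}(\Psi_x)p_{xi}(\Phi_j)=\sum_{\epsilon=0,1}C^{\epsilon,-}_{i,j}p_{x,i+\epsilon}(\Phi_{j-1})\quad(j\ge1,\ 0\le x\le N-j+1).$$ (2) There are $D^{\epsilon,\epsilon'}_{x,y}\in K$ such that, for all $(x,y)\in\mathcal D$, $$c_{x+1}(\Phi_j^\star)p_{jy}(\Psi_x^\star)=\frac{\nu(\Psi_x)}{\nu(\Psi_{x+1})}\sum_{\epsilon'=-1,0}D^{+,\epsilon'}_{x,y}p_{j,y+\epsilon'}(\Psi^\star_{x+1})\quad(0\le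 j\le N-x-1),$$ $$a_x(\Phi_j^\star)p_{jy}(\Psi_x^\star)=\sum_{\epsilon'=0,\pm1}D^{0,\epsilon'}_{x,y}p_{j,y+\epsilon'}(\Psi^\star_x)\quad(0\le j\le N-x),$$ $$b_{x-1}(\Phi_j^\star)p_{jy}(\Psi_x^\star)=\frac{\nu(\Psi_x)}{\nu(\Psi_{x-1})}\sum_{\epsilon'=0,1}D^{-,\epsilon'}_{x,y}p_{j,y+\epsilon'}(\Psi^\star_{x-1})\quad(x\ge1,\ 0\le j\le N-x+1).$$ (3) There are functions $F,G:\mathcal D\to K$, $F$ vanishing nowhere, such that, for all $(x,y),(i,j)\in\mathcal D$ with $x+j\le N$, $$\frac{k_i(\Phi_j)}{k_x(\Phi_j^\star)}\,\frac{k_j(\Psi_x)}{k_y(\Psi_x^\star)}\,F(x,y)=\frac{G(i,j)}{\nu(\Psi_x)\nu(\Phi_j)}.$$ **Theorem.** Let $(\Phi_j)$, $(\Psi_x)$ be compatible. Then the coefficients $C^{\epsilon,\epsilon'}_{i,j}$ in (1) and $D^{\epsilon,\epsilon'}_{x,y}$ in (2) are uniquely determined for $(\epsilon,\epsilon')\in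 A_2$ (those whose target index $(i+\epsilon,j+\epsilon')$, respectively $(x+\epsilon,y+\epsilon')$, lies outside of $\mathcal D$ being irrelevant), and there is a factorized $A_2$-Leonard pair with basis $(X,Y;X^\star,Y^\star)$ on a $K$-vector space $V$ to which the arrays are associated: $\Phi_j$ is the parameter array of $(X,X^\star)$ restricted to the $\theta_j^\star$-eigenspace of $Y^\star$, and $\Psi_x$ is that of $(Y,Y^\star)$ restricted to the $t_x$-eigenspace of $X$. There are vectors $V_{x,y}$ spanning the spaces $V_{(x,y)}$ of (iii) and $V^\star_{i,j}$ spanning the spaces $V^\star_{(i,j)}$ of (iv), each family being a basis of $V$, such that, with the convention that vectors with index outside of $\mathcal D$ are zero, $$XV_{x,y}=t_xV_{x,y},\quad YV_{x,y}=\theta_y(x)V_{x,y},\quad X^\star V_{x,y}=\sum_{(\epsilon,\epsilon')\in A_2}D^{\epsilon,\epsilon'}_{x,y}V_{x+\epsilon,y+\epsilon'},$$ $$Y^\star V_{x,y}=b_{y-1}(\Psi_x^\star)V_{x,y-1}+a_y(\Psi_x^\star)V_{x,y}+c_{y+1}(\Psi_x^\star)V_{x,y+1},$$ $$XV^\star_{i,j}=b_{i-1}(\Phi_j)V^\star_{i-1,j}+a_i(\Phi_j)V^\star_{i,j}+c_{i+1}(\Phi_j)V^\star_{i+1,j},\quad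 YV^\star_{i,j}=\sum_{(\epsilon,\epsilon')\in A_2}C^{\epsilon,\epsilon'}_{i,j}V^\star_{i+\epsilon,j+\epsilon'},$$ $$X^\star V^\star_{i,j}=t_i^\star(j)V^\star_{i,j},\quad Y^\star V^\star_{i,j}=\theta_j^\star V^\star_{i,j},\qquad V^\star_{i,j}=\sum_{x=0}^{N-j}\sum_{y=0}^{N-x}p_{xi}(\Phi_j)p_{yj}(\Psi_x)V_{x,y}.$$ -/

import Mathlib

universe u

/-! ### Parameter arrays of Leonard systems -/

/-- The data `(θ_i, θ*_i, i = 0, …, d; φ_i, ϕ_i, i = 1, …, d)`.  Only the values in these ranges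
are meaningful; `θs` is `θ*`, `varphi` is `φ` (first split sequence) and `phi` is `ϕ` (second split
sequence). -/
structure ParameterArray (K : Type*) where
  d : ℕ
  θ : ℕ → K
  θs : ℕ → K
  varphi : ℕ → K
  phi : ℕ → K

/-- Irreducible tridiagonal matrices. -/
def IsIrreducibleTridiagonal {K : Type*} [Field K] {n : ℕ} (M : Matrix (Fin n) (Fin n) K) : Prop :=
  (∀ i j : Fin n, ((i : ℕ) + 1 < j ∨ (j : ℕ) + 1 < i) → M i j = 0) ∧
  (∀ i j : Fin n, ((i : ℕ) + 1 = j ∨ (j : ℕ) + 1 = i) → M i j ≠ 0)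

/-- `(A, A*)` is a Leonard pair on `W` which, for the orderings of the eigenvalues given by
`θ_0, …, θ_d` and `θ*_0, …, θ*_d`, is a Leonard system with first split sequence `φ` and second
split sequence `ϕ`; that is, `P` is the parameter array of this Leonard system. -/
structure HasParameterArray {K : Type*} [Field K] {W : Type*} [AddCommGroup W] [Module K W]
    (P : ParameterArray K) (A As : Module.End K W) : Prop where
  /-- The eigenvalues of `A` are mutually distinct. -/
  θ_inj : ∀ i j : ℕ, i ≤ P.d → j ≤ P.d → P.θ i = P.θ j → i = j
  /-- The eigenvalues of `A*` are mutually distinct. -/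
  θs_inj : ∀ i j : ℕ, i ≤ P.d → j ≤ P.d → P.θs i = P.θs j → i = j
  /-- A basis in which `A` is diagonal and `A*` is irreducible tridiagonal. -/
  eigenbasis : ∃ v : Module.Basis (Fin (P.d + 1)) K W,
    (∀ i, A (v i) = P.θ i • v i) ∧ IsIrreducibleTridiagonal (LinearMap.toMatrix v v As)
  /-- A basis in which `A*` is diagonal and `A` is irreducible tridiagonal. -/
  dualEigenbasis : ∃ v : Module.Basis (Fin (P.d + 1)) K W,
    (∀ i, As (v i) = P.θs i • v i) ∧ IsIrreducibleTridiagonal (LinearMap.toMatrix v v A)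
  /-- The first split form:
  `A w_i = θ_i w_i + w_{i+1}` and `A* w_i = θ*_i w_i + φ_i w_{i-1}`. -/
  firstSplit : ∃ w : Module.Basis (Fin (P.d + 1)) K W,
    (∀ i j, LinearMap.toMatrix w w A i j =
      if i = j then P.θ j else if (i : ℕ) = j + 1 then 1 else 0) ∧
    (∀ i j, LinearMap.toMatrix w w As i j =
      if i = j then P.θs j else if (i : ℕ) + 1 = j then P.varphi j else 0)
  /-- The second split form:
  `A w_i = θ_{d-i} w_i + w_{i+1}` and `A* w_i = θ*_i w_i + ϕ_i w_{i-1}`. -/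
  secondSplit : ∃ w : Module.Basis (Fin (P.d + 1)) K W,
    (∀ i j, LinearMap.toMatrix w w A i j =
      if i = j then P.θ (P.d - j) else if (i : ℕ) = j + 1 then 1 else 0) ∧
    (∀ i j, LinearMap.toMatrix w w As i j =
      if i = j then P.θs j else if (i : ℕ) + 1 = j then P.phi j else 0)

namespace ParameterArray

variable {K : Type*} [Field K]

/-- `P` is the parameter array of some Leonard system (realised on the space `K^{d+1}`). -/
def IsParameterArray (P : ParameterArray K) : Prop :=
  ∃ A As : Module.End K (Fin (P.d + 1) → K), HasParameterArray P A As

/-- The dual array `Φ* = (θ*_i, θ_i; φ_j, ϕ_{d-j+1})`. -/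
def star (P : ParameterArray K) : ParameterArray K where
  d := P.d
  θ := P.θs
  θs := P.θ
  varphi := P.varphi
  phi := fun j => P.phi (P.d + 1 - j)

/-- The recurrence coefficients `a_i`, for `0 ≤ i ≤ d` (terms with `φ_0` or `φ_{d+1}` are absent),
and `0` for other `i`. -/
noncomputable def a (P : ParameterArray K) (i : ℤ) : K :=
  if 0 ≤ i ∧ i ≤ P.d then
    P.θ i.toNat
      + (if i = 0 then 0
          else P.varphi i.toNat / (P.θs i.toNat - P.θs (i.toNat - 1)))
      + (if i = P.d then 0
          else P.varphi (i.toNat + 1) / (P.θs i.toNat - P.θs (i.toNat + 1)))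
  else 0

/-- The recurrence coefficients `b_i`, for `0 ≤ i ≤ d - 1`, and `0` for other `i`
(in particular `b_{-1} = b_d = 0`). -/
noncomputable def b (P : ParameterArray K) (i : ℤ) : K :=
  if 0 ≤ i ∧ i < P.d then
    P.varphi (i.toNat + 1)
      * (∏ h ∈ Finset.range i.toNat, (P.θs i.toNat - P.θs h))
      / (∏ h ∈ Finset.range (i.toNat + 1), (P.θs (i.toNat + 1) - P.θs h))
  else 0

/-- The recurrence coefficients `c_i`, for `1 ≤ i ≤ d`, and `0` for other `i`
(in particular `c_0 = c_{d+1} = 0`). -/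
noncomputable def c (P : ParameterArray K) (i : ℤ) : K :=
  if 1 ≤ i ∧ i ≤ P.d then
    P.phi i.toNat
      * (∏ h ∈ Finset.range (P.d - i.toNat), (P.θs i.toNat - P.θs (P.d - h)))
      / (∏ h ∈ Finset.range (P.d - i.toNat + 1), (P.θs (i.toNat - 1) - P.θs (P.d - h)))
  else 0

/-- The polynomial `u_i(z)`. -/
noncomputable def u (P : ParameterArray K) (i : ℕ) (z : K) : K :=
  ∑ k ∈ Finset.range (i + 1),
    ∏ h ∈ Finset.range k, (z - P.θ h) * (P.θs i - P.θs h) / P.varphi (h + 1)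

/-- The normalisation `k_i`, `0 ≤ i ≤ d`. -/
noncomputable def k (P : ParameterArray K) (i : ℕ) : K :=
  (∏ h ∈ Finset.Icc 1 i, P.varphi h / P.phi h)
    * ((∏ h ∈ Finset.Icc 1 P.d, (P.θs 0 - P.θs h))
      / (∏ h ∈ (Finset.range (P.d + 1)).erase i, (P.θs i - P.θs h)))

/-- `p_{xi} = k_i u_i(θ_x)` for `0 ≤ x, i ≤ d`, and `0` for other `x, i`. -/
noncomputable def p (P : ParameterArray K) (x i : ℤ) : K :=
  if (0 ≤ x ∧ x ≤ P.d) ∧ (0 ≤ i ∧ i ≤ P.d) then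
    P.k i.toNat * P.u i.toNat (P.θ x.toNat)
  else 0

/-- The constant `ν`. -/
noncomputable def ν (P : ParameterArray K) : K :=
  ∏ h ∈ Finset.Icc 1 P.d, (P.θ 0 - P.θ h) * (P.θs 0 - P.θs h) / P.phi h

end ParameterArray

/-! ### The domain and the set `A_2` -/

/-- The domain `𝒟` of pairs of non-negative integers with sum at most `N`. -/
abbrev TriDom (N : ℕ) : Type := {q : ℕ × ℕ // q.1 + q.2 ≤ N}

/-- The set `A_2 ⊂ ℤ²`. -/
def A2 : Finset (ℤ × ℤ) := {(0, 0), (1, -1), (1, 0), (0, 1), (-1, 1), (-1, 0), (0, -1)}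

/-- `A_2`-adjacency in `𝒟`. -/
def A2Adj {N : ℕ} (l m : TriDom N) : Prop :=
  ((l.1.1 : ℤ) - m.1.1, (l.1.2 : ℤ) - m.1.2) ∈ A2

/-- The vectors of a family indexed by `𝒟`, with the convention that a vector whose index is
outside of `𝒟` is zero. -/
def vecAt {N : ℕ} {V : Type*} [Zero V] (v : TriDom N → V) (x y : ℤ) : V :=
  if h : 0 ≤ x ∧ 0 ≤ y ∧ x + y ≤ N then v ⟨(x.toNat, y.toNat), by grind⟩ else 0

/-! ### Factorized `A_2`-Leonard pairs -/

section LeonardPairs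

variable {K : Type*} [Field K] {V : Type*} [AddCommGroup V] [Module K V]

/-- `U` is a common eigenspace of the elements of `H`. -/
def IsCommonEigenspace (H : Submodule K (Module.End K V)) (U : Submodule K V) : Prop :=
  U ≠ ⊥ ∧ ∃ χ : Module.End K V → K, U = ⨅ T ∈ H, Module.End.eigenspace T (χ T)

/-- `T` is diagonalizable. -/
def IsDiagonalizableEnd (T : Module.End K V) : Prop :=
  ⨆ μ : K, Module.End.eigenspace T μ = ⊤

/-- `(H, H*)` is an `A_2`-Leonard pair on `𝒟`, with labelled common eigenspaces
`E λ = V_λ` and `Es λ = V*_λ` and with bilinear form `B`. -/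
structure IsA2LeonardPair (N : ℕ) (H Hs : Submodule K (Module.End K V))
    (E Es : TriDom N → Submodule K V) (B : LinearMap.BilinForm K V) : Prop where
  finrank_H : Module.finrank K H = 2
  diag_H : ∀ T ∈ H, IsDiagonalizableEnd T
  comm_H : ∀ S ∈ H, ∀ T ∈ H, Commute S T
  finrank_Hs : Module.finrank K Hs = 2
  diag_Hs : ∀ T ∈ Hs, IsDiagonalizableEnd T
  comm_Hs : ∀ S ∈ Hs, ∀ T ∈ Hs, Commute S T
  /-- `E` is a bijection from `𝒟` to the common eigenspaces of `H`. -/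
  bij_E : Function.Injective E ∧ Set.range E = {U | IsCommonEigenspace H U}
  adj_E : ∀ T ∈ Hs, ∀ l : TriDom N,
    (E l).map T ≤ ⨆ (m : TriDom N) (_ : A2Adj m l), E m
  /-- `Es` is a bijection from `𝒟` to the common eigenspaces of `H*`. -/
  bij_Es : Function.Injective Es ∧ Set.range Es = {U | IsCommonEigenspace Hs U}
  adj_Es : ∀ T ∈ H, ∀ l : TriDom N,
    (Es l).map T ≤ ⨆ (m : TriDom N) (_ : A2Adj m l), Es m
  irreducible : ∀ W : Submodule K V, (∀ T ∈ H, W.map T ≤ W) → (∀ T ∈ Hs, W.map T ≤ W) →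
    W = ⊥ ∨ W = ⊤
  finrank_E : ∀ l, Module.finrank K (E l) = 1
  finrank_Es : ∀ l, Module.finrank K (Es l) = 1
  symm : B.IsSymm
  nondeg : B.Nondegenerate
  orth_E : ∀ l m, l ≠ m → ∀ v ∈ E l, ∀ w ∈ E m, B v w = 0
  orth_Es : ∀ l m, l ≠ m → ∀ v ∈ Es l, ∀ w ∈ Es m, B v w = 0

/-- `(X, Y; X*, Y*)` is a basis of a factorized `A_2`-Leonard pair
`(H, H*) = (span {X, Y}, span {X*, Y*})` on `𝒟`, with labelled common eigenspaces `E λ = V_λ`,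
`Es λ = V*_λ` and bilinear form `B`.  (As `H` and `H*` are two-dimensional, `X, Y` and `X*, Y*` are
indeed bases.) -/
structure IsFactorizedA2LeonardPair (N : ℕ) (X Y Xs Ys : Module.End K V)
    (E Es : TriDom N → Submodule K V) (B : LinearMap.BilinForm K V) : Prop where
  isA2LeonardPair :
    IsA2LeonardPair N (Submodule.span K {X, Y}) (Submodule.span K {Xs, Ys}) E Es B
  eigenvalues_X : ∃ t : ℕ → K, (∀ x x' : ℕ, x ≤ N → x' ≤ N → t x = t x' → x = x') ∧
    ∀ l : TriDom N, ∀ v ∈ E l, X v = t l.1.1 • v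
  eigenvalues_Ys : ∃ θs : ℕ → K, (∀ j j' : ℕ, j ≤ N → j' ≤ N → θs j = θs j' → j = j') ∧
    ∀ l : TriDom N, ∀ v ∈ Es l, Ys v = θs l.1.2 • v
  comm_X_Ys : Commute X Ys
  /-- Each common eigenspace of `X` and `Y*` has dimension one. -/
  common_X_Ys : ∀ μ η : K, Module.End.eigenspace X μ ⊓ Module.End.eigenspace Ys η ≠ ⊥ →
    Module.finrank K ↥(Module.End.eigenspace X μ ⊓ Module.End.eigenspace Ys η) = 1
  /-- For neighbours `l = (i, j)` and `m = (i + 1, j)`. -/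
  irred_X : ∀ l m : TriDom N, m.1.1 = l.1.1 + 1 → m.1.2 = l.1.2 →
    (∃ v ∈ Es m, ∃ w ∈ Es l, B v (X w) ≠ 0) ∧ (∃ v ∈ Es l, ∃ w ∈ Es m, B v (X w) ≠ 0)
  /-- For neighbours `l = (x, y)` and `m = (x, y + 1)`. -/
  irred_Ys : ∀ l m : TriDom N, m.1.1 = l.1.1 → m.1.2 = l.1.2 + 1 →
    (∃ v ∈ E m, ∃ w ∈ E l, B v (Ys w) ≠ 0) ∧ (∃ v ∈ E l, ∃ w ∈ E m, B v (Ys w) ≠ 0)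

/-- The parameter arrays `Φ_j`, `Ψ_x` are associated to the basis `(X, Y; X*, Y*)`: for `j ≤ N`,
`Φ_j` is the parameter array of `(X, X*)` restricted to the eigenspace of `Y*` for `θ*_j`, and for
`x ≤ N`, `Ψ_x` is the parameter array of `(Y, Y*)` restricted to the eigenspace of `X` for `t_x`. -/
def AreAssociatedArrays (N : ℕ) (t θs : ℕ → K) (Φ Ψ : ℕ → ParameterArray K)
    (X Y Xs Ys : Module.End K V) : Prop :=
  (∀ j : ℕ, j ≤ N →
    ∃ (hX : ∀ v ∈ Module.End.eigenspace Ys (θs j), X v ∈ Module.End.eigenspace Ys (θs j))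
      (hXs : ∀ v ∈ Module.End.eigenspace Ys (θs j), Xs v ∈ Module.End.eigenspace Ys (θs j)),
      HasParameterArray (Φ j) (X.restrict hX) (Xs.restrict hXs)) ∧
  (∀ x : ℕ, x ≤ N →
    ∃ (hY : ∀ v ∈ Module.End.eigenspace X (t x), Y v ∈ Module.End.eigenspace X (t x))
      (hYs : ∀ v ∈ Module.End.eigenspace X (t x), Ys v ∈ Module.End.eigenspace X (t x)),
      HasParameterArray (Ψ x) (Y.restrict hY) (Ys.restrict hYs))

end LeonardPairs

/-! ### Compatibility of parameter arrays -/

section Compatibility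

variable {K : Type*} [Field K]

/-- The constraints on the coefficients `C^{ε,ε'}_{i,j} = C ε ε' i j`.  They are imposed for
`(i, j) ∈ 𝒟` and for all `x` for which the polynomials on the right-hand side are defined. -/
structure SatisfiesCons1 (N : ℕ) (Φ Ψ : ℕ → ParameterArray K) (C : ℤ → ℤ → ℕ → ℕ → K) :
    Prop where
  plus : ∀ i j x : ℕ, i + j ≤ N → x + (j + 1) ≤ N →
    (Ψ x).c (j + 1) * (Φ j).p x i =
      ∑ ε ∈ ({-1, 0} : Finset ℤ), C ε 1 i j * (Φ (j + 1)).p x (i + ε)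
  zero : ∀ i j x : ℕ, i + j ≤ N → x + j ≤ N →
    (Ψ x).a j * (Φ j).p x i =
      ∑ ε ∈ ({-1, 0, 1} : Finset ℤ), C ε 0 i j * (Φ j).p x (i + ε)
  minus : ∀ i j x : ℕ, i + j ≤ N → 1 ≤ j → x + (j - 1) ≤ N →
    (Ψ x).b (j - 1) * (Φ j).p x i =
      ∑ ε ∈ ({0, 1} : Finset ℤ), C ε (-1) i j * (Φ (j - 1)).p x (i + ε)

/-- The constraints on the coefficients `D^{ε,ε'}_{x,y} = D ε ε' x y`.  They are imposed for
`(x, y) ∈ 𝒟` and for all `j` for which the polynomials on the right-hand side are defined. -/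
structure SatisfiesCons2 (N : ℕ) (Φ Ψ : ℕ → ParameterArray K) (D : ℤ → ℤ → ℕ → ℕ → K) :
    Prop where
  plus : ∀ x y j : ℕ, x + y ≤ N → (x + 1) + j ≤ N →
    (Φ j).star.c (x + 1) * (Ψ x).star.p j y =
      (Ψ x).ν / (Ψ (x + 1)).ν *
        ∑ ε' ∈ ({-1, 0} : Finset ℤ), D 1 ε' x y * (Ψ (x + 1)).star.p j (y + ε')
  zero : ∀ x y j : ℕ, x + y ≤ N → x + j ≤ N →
    (Φ j).star.a x * (Ψ x).star.p j y =
      ∑ ε' ∈ ({-1, 0, 1} : Finset ℤ), D 0 ε' x y * (Ψ x).star.p j (y + ε')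
  minus : ∀ x y j : ℕ, x + y ≤ N → 1 ≤ x → (x - 1) + j ≤ N →
    (Φ j).star.b (x - 1) * (Ψ x).star.p j y =
      (Ψ x).ν / (Ψ (x - 1)).ν *
        ∑ ε' ∈ ({0, 1} : Finset ℤ), D (-1) ε' x y * (Ψ (x - 1)).star.p j (y + ε')

/-- The condition relating a non-vanishing function `F` on `𝒟` and a function `G` on `𝒟`,
imposed for all `(x, y), (i, j) ∈ 𝒟` for which both sides are defined. -/
def SatisfiesFG (N : ℕ) (Φ Ψ : ℕ → ParameterArray K) (F G : ℕ → ℕ → K) : Prop :=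
  (∀ x y : ℕ, x + y ≤ N → F x y ≠ 0) ∧
  ∀ x y i j : ℕ, x + y ≤ N → i + j ≤ N → x + j ≤ N →
    (Φ j).k i / (Φ j).star.k x * ((Ψ x).k j / (Ψ x).star.k y) * F x y =
      G i j / ((Ψ x).ν * (Φ j).ν)

/-- Compatibility of the families `Φ_j` and `Ψ_x`. -/
def AreCompatible (N : ℕ) (Φ Ψ : ℕ → ParameterArray K) : Prop :=
  (∃ C, SatisfiesCons1 N Φ Ψ C) ∧ (∃ D, SatisfiesCons2 N Φ Ψ D) ∧
    ∃ F G, SatisfiesFG N Φ Ψ F G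

/-- Two families of coefficients agree wherever they are meaningful: at `(i, j) ∈ 𝒟` and
`(ε, ε') ∈ A_2` with `(i + ε, j + ε') ∈ 𝒟`. -/
def CoeffsAgree (N : ℕ) (C C' : ℤ → ℤ → ℕ → ℕ → K) : Prop :=
  ∀ i j : ℕ, i + j ≤ N → ∀ e ∈ A2,
    0 ≤ (i : ℤ) + e.1 → 0 ≤ (j : ℤ) + e.2 → ((i : ℤ) + e.1) + ((j : ℤ) + e.2) ≤ N →
    C e.1 e.2 i j = C' e.1 e.2 i j

end Compatibility

/-! A Leonard system is first reduced to scalar identities. In a split basis the eigenvectors have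
coordinates that satisfy a two-term relation, so they are multiples of the nodal products of the
dual eigenvalues. Applying the other operator to them turns the tridiagonal action into a recurrence
in which a_i and b_i are forced (`SplitForm.exists_recurrence`). The second split form, read with
the dual eigenvalues reversed, forces c_i (`SplitForm.isRegular`). This works for an array and for
its dual (`HasParameterArray.isBiregular`). The identities c_i + a_i + b_i = θ_0 and k_i b_i =
k_{i+1} c_{i+1} then give the three-term recurrence for u_i, its orthogonality, and the sum of the
k_i as ν. Consequently the matrices p(Φ) and p(Φ*) are inverse to each other up to the factor ν.

The pair is built from three bases indexed by the triangle. Take any basis v_{x,y}; put w_{x,j} =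
Σ_y p_{yj}(Ψ_x) v_{x,y} for each fixed x, and vs_{i,j} = Σ_x p_{xi}(Φ_j) w_{x,j} for each fixed j.
Let X, Y be diagonal on v and X*, Y* diagonal on vs, with the prescribed eigenvalues. Since X is
scalar on each set {v_{x,y}} with x fixed, and Y* on each {vs_{i,j}} with j fixed, both are diagonal
on w, hence commute. On w, Y is tridiagonal in j with the coefficients of Ψ_x, and X* is tridiagonal
in x with those of Φ_j*. So Y*, restricted to fixed x, and X, restricted to fixed j, act on v and vs
as a single Leonard system prescribes.

What remains is Y on vs and X* on v. Expanding in w produces products such as c_{j+1}(Ψ_x)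
p_{xi}(Φ_j), and requirements (1) and (2) are exactly what re-expands them in at most seven
neighbours (`IsTriangularModel.Y_vs`, `IsTriangularModel.Xs_v`). Requirement (3) makes the form that
is diagonal on v with norms F also diagonal on vs (`IsTriangularFamily.bilin_vs`). Irreducibility is
seen on w, where the nonzero b and c connect all points of the triangle
(`IsTriangularModel.eq_bot_or_eq_top`). Uniqueness of the coefficients is the invertibility of the
matrices p (`ParameterArray.eq_zero_of_sum_mul_eq_zero`). -/

/-! ### Scalar theory of parameter arrays -/

namespace ParameterArray

open Finset

variable {K : Type*} [Field K]

/-- The array in which the ordering of the dual eigenvalues is reversed. -/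
def revDual (P : ParameterArray K) : ParameterArray K where
  d := P.d
  θ := P.θ
  θs := fun i => P.θs (P.d - i)
  varphi := fun j => P.phi (P.d + 1 - j)
  phi := fun j => P.varphi (P.d + 1 - j)

/-- The nodal products `∏_{h<k} (θ*_i - θ*_h)`. -/
def nodal (P : ParameterArray K) (i k : ℕ) : K := ∏ h ∈ range k, (P.θs i - P.θs h)

theorem nodal_zero (P : ParameterArray K) (i : ℕ) : P.nodal i 0 = 1 := by simp [nodal]

theorem nodal_succ (P : ParameterArray K) (i k : ℕ) :
    P.nodal i (k + 1) = P.nodal i k * (P.θs i - P.θs k) := by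
  simp [nodal, prod_range_succ]

theorem nodal_eq_zero (P : ParameterArray K) {i k : ℕ} (h : i < k) : P.nodal i k = 0 :=
  prod_eq_zero (mem_range.2 h) (sub_self _)

theorem nodal_ne_zero {P : ParameterArray K}
    (hθs : ∀ i j : ℕ, i ≤ P.d → j ≤ P.d → P.θs i = P.θs j → i = j)
    {i k : ℕ} (hk : k ≤ i) (hi : i ≤ P.d) : P.nodal i k ≠ 0 := by
  refine prod_ne_zero_iff.2 fun h hh => sub_ne_zero.2 fun e => ?_
  have := hθs i h hi (by grind) e
  grind

theorem a_natCast (P : ParameterArray K) {i : ℕ} (hi : i ≤ P.d) :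
    P.a i = P.θ i + (if i = 0 then 0 else P.varphi i / (P.θs i - P.θs (i - 1)))
      + (if i = P.d then 0 else P.varphi (i + 1) / (P.θs i - P.θs (i + 1))) := by
  simp [a, hi]

theorem b_natCast (P : ParameterArray K) {i : ℕ} (hi : i < P.d) :
    P.b i = P.varphi (i + 1) * P.nodal i i / P.nodal (i + 1) (i + 1) := by
  simp [b, hi, nodal]

theorem b_diam (P : ParameterArray K) : P.b P.d = 0 := by simp [b]

theorem c_zero (P : ParameterArray K) : P.c 0 = 0 := by simp [c]

theorem c_diam_succ (P : ParameterArray K) : P.c (P.d + 1) = 0 := by simp [c]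

/-- `σ i k` are the coefficients of eigenvectors `v_i` of an upper bidiagonal operator `A*`, with
respect to a basis in which another operator `A` is lower bidiagonal, and
`A v_i = γ_i v_{i-1} + α_i v_i + β_i v_{i+1}`. -/
structure SplitForm (P : ParameterArray K) (ψ χ α β γ : ℕ → K) (σ : ℕ → ℕ → K) : Prop where
  varphi_eq : ∀ k, 1 ≤ k → k ≤ P.d → P.varphi k = ψ k * χ k
  θs_inj : ∀ i j : ℕ, i ≤ P.d → j ≤ P.d → P.θs i = P.θs j → i = j
  out_left : ∀ i k, P.d < i → σ i k = 0
  out_right : ∀ i k, P.d < k → σ i k = 0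
  upper : ∀ i k, i ≤ P.d → k ≤ P.d → P.θs k * σ i k + χ (k + 1) * σ i (k + 1) = P.θs i * σ i k
  lower_zero : ∀ i, i ≤ P.d →
    P.θ 0 * σ i 0 = γ i * σ (i - 1) 0 + α i * σ i 0 + β i * σ (i + 1) 0
  lower_succ : ∀ i k, i ≤ P.d → k < P.d → P.θ (k + 1) * σ i (k + 1) + ψ (k + 1) * σ i k =
    γ i * σ (i - 1) (k + 1) + α i * σ i (k + 1) + β i * σ (i + 1) (k + 1)
  γ_zero : γ 0 = 0
  β_diam : β P.d = 0
  γ_ne : ∀ i, i < P.d → γ (i + 1) ≠ 0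
  β_ne : ∀ i, i < P.d → β i ≠ 0
  ne_zero : ∀ i, i ≤ P.d → ∃ k, σ i k ≠ 0

namespace SplitForm

variable {P : ParameterArray K} {ψ χ α β γ : ℕ → K} {σ : ℕ → ℕ → K}

theorem θs_sub_ne (h : SplitForm P ψ χ α β γ σ) {i j : ℕ} (hi : i ≤ P.d) (hj : j ≤ P.d)
    (hij : i ≠ j) : P.θs i - P.θs j ≠ 0 :=
  sub_ne_zero.2 fun e => hij (h.θs_inj i j hi hj e)

theorem coeff_succ (h : SplitForm P ψ χ α β γ σ) {i k : ℕ} (hi : i ≤ P.d) (hk : k ≤ P.d) :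
    χ (k + 1) * σ i (k + 1) = (P.θs i - P.θs k) * σ i k := by
  linear_combination h.upper i k hi hk

/-- The eigenvector relation reads χ_{k+1} σ_{i,k+1} = (θ*_i − θ*_k) σ_{ik}. Descending from the
last coordinate, the factor on the right is nonzero as long as k > i, so zeros propagate downwards
without knowing that χ is nonzero. -/
theorem coeff_eq_zero (h : SplitForm P ψ χ α β γ σ) {i : ℕ} (hi : i ≤ P.d) {k : ℕ} (hk : i < k) :
    σ i k = 0 := by
  by_cases hkd : P.d < k
  · exact h.out_right i k hkd
  · have key : ∀ n k, k + n = P.d + 1 → i < k → σ i k = 0 := by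
      intro n
      induction n with
      | zero => intro k hk _; exact h.out_right i k (by omega)
      | succ n ih =>
        intro k hk hik
        have h1 := h.coeff_succ hi (show k ≤ P.d by omega)
        rw [ih (k + 1) (by omega) (by omega), mul_zero] at h1
        exact (mul_eq_zero.1 h1.symm).resolve_left (h.θs_sub_ne hi (by omega) (by omega))
    exact key (P.d + 1 - k) k (by omega) hk

theorem coeff_below_eq_zero (h : SplitForm P ψ χ α β γ σ) {i m : ℕ} (hi : i ≤ P.d) (hm : m ≤ i)
    (hz : σ i m = 0) {k : ℕ} (hk : k ≤ m) : σ i k = 0 := by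
  have key : ∀ n k, k + n = m → σ i k = 0 := by
    intro n
    induction n with
    | zero => intro k hk; rw [show k = m by omega, hz]
    | succ n ih =>
      intro k hk
      have h1 := h.coeff_succ hi (show k ≤ P.d by omega)
      rw [ih (k + 1) (by omega), mul_zero] at h1
      exact (mul_eq_zero.1 h1.symm).resolve_left (h.θs_sub_ne hi (by omega) (by omega))
  exact key (m - k) k (by omega)

theorem coeff_diag_ne (h : SplitForm P ψ χ α β γ σ) {i : ℕ} (hi : i ≤ P.d) : σ i i ≠ 0 := by
  intro hz
  obtain ⟨k, hk⟩ := h.ne_zero i hi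
  rcases le_or_gt k i with hki | hki
  · exact hk (h.coeff_below_eq_zero hi le_rfl hz hki)
  · exact hk (h.coeff_eq_zero hi hki)

/-- In coordinate i + 1 of A v_i, triangularity leaves only ψ_{i+1} σ_{ii} on one side and β_i
σ_{i+1,i+1} on the other. -/
theorem ψ_ne (h : SplitForm P ψ χ α β γ σ) {i : ℕ} (hi : i < P.d) : ψ (i + 1) ≠ 0 := by
  intro hz
  have h1 := h.lower_succ i i hi.le hi
  rw [hz, h.coeff_eq_zero hi.le (Nat.lt_succ_self i),
    h.coeff_eq_zero (i := i - 1) (by omega) (show i - 1 < i + 1 by omega)] at h1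
  have h2 := mul_ne_zero (h.β_ne i hi) (h.coeff_diag_ne (i := i + 1) hi)
  apply h2
  linear_combination -h1

/-- If χ_{m+1} vanished, every eigenvector v_i with i > m would have zero coordinates up to m.
Coordinate m of A v_{m+1} would then reduce to γ_{m+1} σ_{mm}, which is nonzero, while the left side
is zero. -/
theorem χ_ne (h : SplitForm P ψ χ α β γ σ) {m : ℕ} (hm : m < P.d) : χ (m + 1) ≠ 0 := by
  intro hz
  have hv : ∀ i k, m < i → i ≤ P.d → k ≤ m → σ i k = 0 := by
    intro i k hmi hi hk
    have h1 := h.coeff_succ hi hm.le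
    rw [hz, zero_mul] at h1
    exact h.coeff_below_eq_zero hi hmi.le
      ((mul_eq_zero.1 h1.symm).resolve_left (h.θs_sub_ne hi hm.le (by omega))) hk
  have hv2 : σ (m + 1 + 1) m = 0 := by
    by_cases hd : m + 1 + 1 ≤ P.d
    · exact hv _ _ (by omega) hd le_rfl
    · exact h.out_left _ _ (by omega)
  have hne := mul_ne_zero (h.γ_ne m hm) (h.coeff_diag_ne hm.le)
  rcases m with _ | m
  · have h1 := h.lower_zero 1 hm
    rw [hv 1 0 (by omega) hm le_rfl, hv2] at h1
    apply hne
    simpa using h1.symm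
  · have h1 := h.lower_succ (m + 1 + 1) m hm (by omega)
    rw [hv (m + 1 + 1) (m + 1) (by omega) hm le_rfl, hv2,
      hv (m + 1 + 1) m (by omega) hm (by omega)] at h1
    apply hne
    simpa using h1.symm

theorem varphi_ne (h : SplitForm P ψ χ α β γ σ) {m : ℕ} (hm : m < P.d) : P.varphi (m + 1) ≠ 0 := by
  rw [h.varphi_eq _ (by omega) hm]
  exact mul_ne_zero (h.ψ_ne hm) (h.χ_ne hm)

/-- The eigenvector relation telescopes. The index i = d + 1 is allowed so that the neighbour
v_{i+1} can be treated uniformly at i = d. -/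
theorem coeff_mul_prod (h : SplitForm P ψ χ α β γ σ) {i : ℕ} (hi : i ≤ P.d + 1) {k : ℕ}
    (hk : k ≤ P.d) : σ i k * ∏ l ∈ range k, χ (l + 1) = σ i 0 * P.nodal i k := by
  by_cases hid : i = P.d + 1
  · simp [h.out_left i _ (by omega)]
  induction k with
  | zero => simp [nodal_zero]
  | succ k ih =>
    rw [prod_range_succ, nodal_succ]
    have h1 := h.coeff_succ (show i ≤ P.d by omega) (show k ≤ P.d by omega)
    linear_combination (∏ l ∈ range k, χ (l + 1)) * h1 + (P.θs i - P.θs k) * ih (by omega)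

theorem coeff_zero_ne (h : SplitForm P ψ χ α β γ σ) {i : ℕ} (hi : i ≤ P.d) : σ i 0 ≠ 0 := by
  intro hz
  have h1 := h.coeff_mul_prod (show i ≤ P.d + 1 by omega) hi
  rw [hz, zero_mul] at h1
  refine mul_ne_zero (h.coeff_diag_ne hi) (prod_ne_zero_iff.2 fun l hl => h.χ_ne ?_) h1
  grind

/-- Scale v_i so that its coordinate 0 is 1; its coordinates become nodal products divided by
products of χ. Coordinate 0 of A v_i gives the row sum θ_0, coordinate i + 1 gives b_i, and
coordinate i gives a_i. The remaining coefficient C is known here only through the row sum and the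
product with b; that it equals c needs the second split form. -/
theorem exists_recurrence (h : SplitForm P ψ χ α β γ σ) : ∃ C : ℕ → K,
    C 0 = 0 ∧ (∀ i, i < P.d → C (i + 1) ≠ 0) ∧ (∀ i, i ≤ P.d → α i = P.a i) ∧
    (∀ i, i ≤ P.d → C i + P.a i + P.b i = P.θ 0) ∧
    (∀ i, i < P.d → P.b i * C (i + 1) = β i * γ (i + 1)) ∧
    (∀ i k, i ≤ P.d → k < P.d →
      P.θ (k + 1) * P.nodal i (k + 1) + P.varphi (k + 1) * P.nodal i k =
        C i * P.nodal (i - 1) (k + 1) + P.a i * P.nodal i (k + 1)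
          + P.b i * P.nodal (i + 1) (k + 1)) := by
  set C : ℕ → K := fun i => γ i * σ (i - 1) 0 / σ i 0 with hC
  set D : ℕ → K := fun i => β i * σ (i + 1) 0 / σ i 0 with hD
  have hrow : ∀ i, i ≤ P.d → C i + α i + D i = P.θ 0 := by
    intro i hi
    have h0 := h.coeff_zero_ne hi
    have h1 := h.lower_zero i hi
    simp only [hC, hD]
    field_simp
    linear_combination -h1
  have hrec : ∀ i k, i ≤ P.d → k < P.d →
      P.θ (k + 1) * P.nodal i (k + 1) + P.varphi (k + 1) * P.nodal i k =
        C i * P.nodal (i - 1) (k + 1) + α i * P.nodal i (k + 1)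
          + D i * P.nodal (i + 1) (k + 1) := by
    intro i k hi hk
    have h0 := h.coeff_zero_ne hi
    have h1 := h.lower_succ i k hi hk
    have e1 := h.coeff_mul_prod (show i ≤ P.d + 1 by omega) (show k + 1 ≤ P.d by omega)
    have e2 := h.coeff_mul_prod (show i ≤ P.d + 1 by omega) (show k ≤ P.d by omega)
    have e3 := h.coeff_mul_prod (show i - 1 ≤ P.d + 1 by omega) (show k + 1 ≤ P.d by omega)
    have e4 := h.coeff_mul_prod (show i + 1 ≤ P.d + 1 by omega) (show k + 1 ≤ P.d by omega)
    rw [prod_range_succ] at e1 e3 e4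
    rw [h.varphi_eq _ (by omega) hk]
    simp only [hC, hD]
    field_simp
    linear_combination (∏ l ∈ range k, χ (l + 1)) * χ (k + 1) * h1 - P.θ (k + 1) * e1
      - ψ (k + 1) * χ (k + 1) * e2 + γ i * e3 + α i * e1 + β i * e4
  have hDb : ∀ i, i ≤ P.d → D i = P.b i := by
    intro i hi
    rcases hi.lt_or_eq with hi | rfl
    · have h1 := hrec i i hi.le hi
      rw [P.nodal_eq_zero (Nat.lt_succ_self i),
        P.nodal_eq_zero (show i - 1 < i + 1 by omega)] at h1
      rw [b_natCast _ hi, eq_div_iff (nodal_ne_zero h.θs_inj le_rfl hi)]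
      linear_combination -h1
    · simp [hD, h.β_diam, b_diam]
  have hαa : ∀ i, i ≤ P.d → α i = P.a i := by
    intro i hi
    have hb : ∀ x y : K, (if i = P.d then 0 else x / (P.θs i - P.θs (i + 1))) =
        -(if i = P.d then 0 else x / (P.θs (i + 1) - P.θs i)) := by
      intro x _
      split_ifs
      · simp
      · rw [← neg_sub, div_neg]
    have hDn : D i * P.nodal (i + 1) i = (if i = P.d then 0 else
        P.varphi (i + 1) / (P.θs (i + 1) - P.θs i)) * P.nodal i i := by
      rw [hDb i hi]
      split_ifs with hid
      · simp [hid, b_diam]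
      · have hlt : i < P.d := by omega
        have h1 := nodal_ne_zero h.θs_inj (show i ≤ i + 1 by omega) hlt
        have h2 := h.θs_sub_ne (show i + 1 ≤ P.d by omega) hi (by omega)
        rw [b_natCast _ hlt, nodal_succ]
        field_simp
    rw [a_natCast _ hi, hb _ 0]
    have hnn := nodal_ne_zero h.θs_inj le_rfl hi
    rcases i with _ | i
    · have h1 := hrow 0 hi
      have hC0 : C 0 = 0 := by simp [hC, h.γ_zero]
      rw [nodal_zero, nodal_zero] at hDn
      simp only [if_true]
      linear_combination h1 - hC0 - hDn
    · have h1 := hrec (i + 1) i hi (by omega)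
      rw [hDn, P.nodal_eq_zero (show i + 1 - 1 < i + 1 by omega)] at h1
      have h2 := h.θs_sub_ne hi (show i ≤ P.d by omega) (by omega)
      rw [if_neg (by omega), Nat.add_sub_cancel]
      rw [nodal_succ] at h1 hnn
      have h3 : P.nodal (i + 1) i ≠ 0 := left_ne_zero_of_mul hnn
      have h4 : P.varphi (i + 1) = P.varphi (i + 1) / (P.θs (i + 1) - P.θs i) *
          (P.θs (i + 1) - P.θs i) := by field_simp
      apply mul_right_cancel₀ hnn
      linear_combination -h1 + P.nodal (i + 1) i * h4
  refine ⟨C, by simp [hC, h.γ_zero], ?_, hαa, ?_, ?_, ?_⟩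
  · intro i hi
    exact div_ne_zero (mul_ne_zero (h.γ_ne i hi) (h.coeff_zero_ne (by simpa using hi.le)))
      (h.coeff_zero_ne hi)
  · intro i hi
    rw [← hDb i hi, ← hαa i hi, hrow i hi]
  · intro i hi
    have h1 := h.coeff_zero_ne hi.le
    have h2 := h.coeff_zero_ne (i := i + 1) hi
    rw [← hDb i hi.le]
    simp only [hC, hD, Nat.add_sub_cancel]
    field_simp
  · intro i k hi hk
    rw [hrec i k hi hk, hαa i hi, hDb i hi]

end SplitForm

theorem b_revDual (P : ParameterArray K) {i : ℕ} (hi : i < P.d) :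
    P.revDual.b ((P.d - (i + 1) : ℕ) : ℤ) = P.c ((i + 1 : ℕ) : ℤ) := by
  rw [b_natCast _ (show P.d - (i + 1) < P.revDual.d by simp only [revDual]; omega)]
  have h1 : P.d - (i + 1) + 1 = P.d - i := by omega
  have h2 : P.d + 1 - (P.d - i) = i + 1 := by omega
  have h3 : P.d - (P.d - (i + 1)) = i + 1 := by omega
  have h4 : P.d - (P.d - i) = i := by omega
  rw [c, if_pos (by constructor <;> (push_cast; omega))]
  simp only [nodal, revDual, h1, h2, h3, h4, Int.toNat_natCast, Nat.add_sub_cancel]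

/-- The properties of a parameter array used below, as identities between scalars. -/
structure IsRegular (P : ParameterArray K) : Prop where
  θs_inj : ∀ i j : ℕ, i ≤ P.d → j ≤ P.d → P.θs i = P.θs j → i = j
  varphi_ne : ∀ i, i < P.d → P.varphi (i + 1) ≠ 0
  phi_ne : ∀ i, i < P.d → P.phi (i + 1) ≠ 0
  row_sum : ∀ i : ℕ, i ≤ P.d → P.c i + P.a i + P.b i = P.θ 0
  recurrence : ∀ i k : ℕ, i ≤ P.d → k < P.d →
      P.θ (k + 1) * P.nodal i (k + 1) + P.varphi (k + 1) * P.nodal i k =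
        P.c i * P.nodal (i - 1) (k + 1) + P.a i * P.nodal i (k + 1)
          + P.b i * P.nodal (i + 1) (k + 1)

/-- Both split forms give rows summing to θ_0 with the same diagonal entries and the same products
of opposite off-diagonal entries. Starting from C_0 = 0, equal row sums give b_i = C'_{d-i}, and
equal products then give C_{i+1} = b'_{d-i-1}. Thus C is the reversed b of the reversed array, which
is c by `b_revDual`. -/
theorem SplitForm.isRegular {P : ParameterArray K} {ψ χ α β γ : ℕ → K} {σ : ℕ → ℕ → K}
    {ψ' χ' α' β' γ' : ℕ → K} {σ' : ℕ → ℕ → K}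
    (h : SplitForm P ψ χ α β γ σ) (h' : SplitForm P.revDual ψ' χ' α' β' γ' σ')
    (hα : ∀ i, i ≤ P.d → α' (P.d - i) = α i)
    (hβ : ∀ i, i < P.d → β' (P.d - (i + 1)) * γ' (P.d - i) = β i * γ (i + 1)) :
    P.IsRegular ∧ (∀ i : ℕ, i ≤ P.d → α i = P.a i) ∧
      (∀ i : ℕ, i < P.d → P.b i * P.c (i + 1) = β i * γ (i + 1)) := by
  obtain ⟨C, hC0, hC, ha, hrow, hprod, hrec⟩ := h.exists_recurrence
  obtain ⟨C', hC0', hC', ha', hrow', hprod', -⟩ := h'.exists_recurrence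
  change ∀ i, i < P.d → C' (i + 1) ≠ 0 at hC'
  change ∀ i, i ≤ P.d → C' i + P.revDual.a i + P.revDual.b i = P.θ 0 at hrow'
  change ∀ i, i < P.d → P.revDual.b i * C' (i + 1) = β' i * γ' (i + 1) at hprod'
  change ∀ i, i ≤ P.d → α' i = P.revDual.a i at ha'
  have step : ∀ i, i ≤ P.d → C i = P.revDual.b ((P.d - i : ℕ) : ℤ) →
      P.b i = C' (P.d - i) := by
    intro i hi e
    have h1 := hrow i hi
    have h2 := hrow' (P.d - i) (by omega)
    rw [← ha' (P.d - i) (by omega), hα i hi] at h2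
    rw [← ha i hi] at h1
    linear_combination h1 - h2 - e
  have hCb : ∀ i, i ≤ P.d → C i = P.revDual.b ((P.d - i : ℕ) : ℤ) := by
    intro i
    induction i with
    | zero => intro _; rw [hC0]; exact (b_diam P.revDual).symm
    | succ i ih =>
      intro hi
      have h1 := step i (by omega) (ih (by omega))
      have h2 := hprod' (P.d - (i + 1)) (by omega)
      rw [show P.d - (i + 1) + 1 = P.d - i by omega, hβ i hi, ← hprod i hi, h1] at h2
      have h3 : C' (P.d - i) ≠ 0 := by
        have := hC' (P.d - (i + 1)) (by omega)
        rwa [show P.d - (i + 1) + 1 = P.d - i by omega] at this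
      apply mul_left_cancel₀ h3
      linear_combination -h2
  have hCc : ∀ i : ℕ, i ≤ P.d → C i = P.c i := by
    intro i hi
    rcases i with _ | i
    · rw [hC0]; exact (c_zero P).symm
    · rw [hCb _ hi, b_revDual _ hi]
  refine ⟨⟨h.θs_inj, fun i hi => h.varphi_ne hi, fun i hi => ?_, fun i hi => ?_,
    fun i k hi hk => ?_⟩, ha, fun i hi => ?_⟩
  · have := h'.varphi_ne (m := P.d - (i + 1)) (show _ < P.d by omega)
    change P.phi (P.d + 1 - (P.d - (i + 1) + 1)) ≠ 0 at this
    rwa [show P.d + 1 - (P.d - (i + 1) + 1) = i + 1 by omega] at this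
  · rw [← hCc i hi, hrow i hi]
  · rw [← hCc i hi, hrec i k hi hk]
  · rw [← hprod i hi, hCc (i + 1) hi]
    push_cast
    rfl

end ParameterArray

/-! ### Recurrence, orthogonality and normalisation of the polynomials u_i -/

namespace ParameterArray

open Finset

variable {K : Type*} [Field K]

namespace IsRegular

variable {P : ParameterArray K}

theorem θs_sub_ne (h : P.IsRegular) {i j : ℕ} (hi : i ≤ P.d) (hj : j ≤ P.d)
    (hij : i ≠ j) : P.θs i - P.θs j ≠ 0 :=
  sub_ne_zero.2 fun e => hij (h.θs_inj i j hi hj e)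

theorem b_ne (h : P.IsRegular) {i : ℕ} (hi : i < P.d) : P.b i ≠ 0 := by
  rw [b_natCast _ hi]
  exact div_ne_zero (mul_ne_zero (h.varphi_ne i hi) (nodal_ne_zero h.θs_inj le_rfl hi.le))
    (nodal_ne_zero h.θs_inj le_rfl hi)

/-- The products `∏_{h>i} (θ*_j - θ*_h)`. -/
def _root_.ParameterArray.upperNodal (P : ParameterArray K) (j i : ℕ) : K :=
  ∏ h ∈ range (P.d - i), (P.θs j - P.θs (P.d - h))

theorem upperNodal_ne (h : P.IsRegular) {i j : ℕ} (hj : j ≤ i) (hi : i ≤ P.d) :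
    P.upperNodal j i ≠ 0 := by
  refine prod_ne_zero_iff.2 fun l hl => h.θs_sub_ne (by omega) (by omega) ?_
  have := mem_range.1 hl
  omega

theorem _root_.ParameterArray.c_natCast_succ (P : ParameterArray K) {i : ℕ} (hi : i < P.d) :
    P.c (i + 1) = P.phi (i + 1) * P.upperNodal (i + 1) (i + 1) / P.upperNodal i i := by
  have h1 : ((i : ℤ) + 1).toNat = i + 1 := by omega
  rw [c, if_pos (by omega)]
  simp only [h1, upperNodal, Nat.add_sub_cancel]
  rw [show P.d - (i + 1) + 1 = P.d - i by omega]

theorem c_ne (h : P.IsRegular) {i : ℕ} (hi : i < P.d) : P.c (i + 1) ≠ 0 := by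
  rw [c_natCast_succ _ hi]
  exact div_ne_zero (mul_ne_zero (h.phi_ne i hi) (h.upperNodal_ne le_rfl hi))
    (h.upperNodal_ne le_rfl hi.le)

theorem _root_.ParameterArray.prod_erase_eq (P : ParameterArray K) {i : ℕ} (hi : i ≤ P.d) :
    ∏ h ∈ (range (P.d + 1)).erase i, (P.θs i - P.θs h) = P.nodal i i * P.upperNodal i i := by
  have h1 : (range (P.d + 1)).erase i = range i ∪ Ioc i P.d := by ext; grind
  have h2 : Disjoint (range i) (Ioc i P.d) := by
    rw [disjoint_left]; grind
  rw [h1, prod_union h2]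
  congr 1
  refine prod_bij' (fun h _ => P.d - h) (fun h _ => P.d - h) ?_ ?_ ?_ ?_ ?_ <;> grind

theorem k_zero (h : P.IsRegular) : P.k 0 = 1 := by
  have h1 : (range (P.d + 1)).erase 0 = Icc 1 P.d := by ext; grind
  rw [k, h1, Icc_eq_empty (by omega), prod_empty, one_mul, div_self]
  refine prod_ne_zero_iff.2 fun l hl => h.θs_sub_ne (by omega) (by grind) (by grind)

/-- Detailed balance: k is the weight that symmetrises the tridiagonal matrix with entries c, a, b.
-/
theorem k_succ (h : P.IsRegular) {i : ℕ} (hi : i < P.d) :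
    P.k (i + 1) * P.c (i + 1) = P.k i * P.b i := by
  have e1 := nodal_ne_zero h.θs_inj (le_refl i) hi.le
  have e2 := nodal_ne_zero h.θs_inj (le_refl (i + 1)) hi
  have e3 := h.upperNodal_ne (le_refl i) hi.le
  have e4 := h.upperNodal_ne (le_refl (i + 1)) hi
  have e5 := h.phi_ne i hi
  rw [k, k, prod_erase_eq _ hi.le, prod_erase_eq _ (show i + 1 ≤ P.d from hi), b_natCast _ hi,
    c_natCast_succ _ hi, prod_Icc_succ_top (by omega)]
  field_simp

theorem k_ne (h : P.IsRegular) {i : ℕ} (hi : i ≤ P.d) : P.k i ≠ 0 := by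
  induction i with
  | zero => rw [h.k_zero]; exact one_ne_zero
  | succ i ih =>
    intro hz
    have h1 := h.k_succ hi
    rw [hz, zero_mul] at h1
    exact mul_ne_zero (ih (by omega)) (h.b_ne hi) h1.symm

/-- Discrete Green formula: by detailed balance the sum telescopes to a boundary term, which
disappears at n = d because b_d = 0. -/
theorem sum_k_mul_sub (h : P.IsRegular) (F G : ℕ → K) {n : ℕ} (hn : n ≤ P.d) :
    ∑ i ∈ range (n + 1), P.k i *
      ((P.c i * F (i - 1) + P.a i * F i + P.b i * F (i + 1)) * G i
        - F i * (P.c i * G (i - 1) + P.a i * G i + P.b i * G (i + 1)))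
      = P.k n * P.b n * (F (n + 1) * G n - F n * G (n + 1)) := by
  induction n with
  | zero => simp [c_zero]; ring
  | succ n ih =>
    rw [sum_range_succ, ih (by omega)]
    have h1 := h.k_succ (show n < P.d by omega)
    push_cast
    linear_combination -(F (n + 1) * G n - F n * G (n + 1)) * h1

theorem sum_k_selfAdjoint (h : P.IsRegular) (F G : ℕ → K) :
    ∑ i ∈ range (P.d + 1), P.k i *
      ((P.c i * F (i - 1) + P.a i * F i + P.b i * F (i + 1)) * G i)
      = ∑ i ∈ range (P.d + 1), P.k i *
      (F i * (P.c i * G (i - 1) + P.a i * G i + P.b i * G (i + 1))) := by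
  have h1 := h.sum_k_mul_sub F G le_rfl
  rw [b_diam, mul_zero, zero_mul] at h1
  rw [← sub_eq_zero, ← sum_sub_distrib, ← h1]
  exact sum_congr rfl fun i _ => by ring

theorem sum_k_tridiag (h : P.IsRegular) (F : ℕ → K) :
    ∑ i ∈ range (P.d + 1), P.k i * (P.c i * F (i - 1) + P.a i * F i + P.b i * F (i + 1))
      = P.θ 0 * ∑ i ∈ range (P.d + 1), P.k i * F i := by
  have h1 := h.sum_k_selfAdjoint F (fun _ => 1)
  simp only [mul_one] at h1
  rw [h1, mul_sum]
  refine sum_congr rfl fun i hi => ?_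
  rw [h.row_sum i (by grind)]
  ring

/-- The moments r_k = Σ_i k_i ∏_{h<k}(θ*_i − θ*_h) satisfy r_{k+1}(θ_0 − θ_{k+1}) = φ_{k+1} r_k, by
pairing the nodal recurrence with the constant function. The top moment r_d has the single term i =
d, so r_0 follows with no summation formula. -/
theorem sum_k (h : P.IsRegular) :
    ∑ i ∈ range (P.d + 1), P.k i = P.ν := by
  set r : ℕ → K := fun k => ∑ i ∈ range (P.d + 1), P.k i * P.nodal i k with hr
  have hstep : ∀ k, k < P.d → r (k + 1) * (P.θ 0 - P.θ (k + 1)) = P.varphi (k + 1) * r k := by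
    intro k hk
    have h1 := h.sum_k_tridiag (fun i => P.nodal i (k + 1))
    have h2 : ∑ i ∈ range (P.d + 1), P.k i * (P.c i * P.nodal (i - 1) (k + 1)
        + P.a i * P.nodal i (k + 1) + P.b i * P.nodal (i + 1) (k + 1))
        = P.θ (k + 1) * r (k + 1) + P.varphi (k + 1) * r k := by
      simp only [hr, mul_sum, ← sum_add_distrib]
      refine sum_congr rfl fun i hi => ?_
      rw [← h.recurrence i k (by grind) hk]
      ring
    rw [h2] at h1
    linear_combination -h1
  have hprod : ∀ k, k ≤ P.d → r k * ∏ l ∈ Icc 1 k, (P.θ 0 - P.θ l)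
      = (∏ l ∈ Icc 1 k, P.varphi l) * r 0 := by
    intro k
    induction k with
    | zero => simp
    | succ k ih =>
      intro hk
      rw [prod_Icc_succ_top (by omega), prod_Icc_succ_top (by omega)]
      linear_combination (∏ l ∈ Icc 1 k, (P.θ 0 - P.θ l)) * hstep k hk
        + P.varphi (k + 1) * ih (by omega)
  have hrd : r P.d = (∏ l ∈ Icc 1 P.d, P.varphi l / P.phi l)
      * ∏ l ∈ Icc 1 P.d, (P.θs 0 - P.θs l) := by
    have e1 := nodal_ne_zero h.θs_inj (le_refl P.d) le_rfl
    simp only [hr]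
    rw [sum_range_succ, sum_eq_zero fun i hi => by
      rw [P.nodal_eq_zero (mem_range.1 hi), mul_zero], zero_add, k, prod_erase_eq _ le_rfl,
      show P.upperNodal P.d P.d = 1 by simp [upperNodal]]
    field_simp
  have hr0 : r 0 = ∑ i ∈ range (P.d + 1), P.k i := by simp [hr, nodal_zero]
  have hφ : ∏ l ∈ Icc 1 P.d, P.varphi l ≠ 0 := prod_ne_zero_iff.2 fun l hl => by
    have := h.varphi_ne (l - 1) (by grind)
    rwa [Nat.sub_add_cancel (by grind)] at this
  have h1 := hprod P.d le_rfl
  rw [hrd, prod_div_distrib] at h1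
  rw [← hr0, ν, prod_div_distrib, prod_mul_distrib]
  apply mul_left_cancel₀ hφ
  rw [← h1]
  ring

end IsRegular

theorem u_eq_sum (P : ParameterArray K) {i : ℕ} (hi : i ≤ P.d) (z : K) :
    P.u i z = ∑ k ∈ range (P.d + 1),
      (∏ h ∈ range k, (z - P.θ h) / P.varphi (h + 1)) * P.nodal i k := by
  rw [u]
  trans ∑ k ∈ range (i + 1), (∏ h ∈ range k, (z - P.θ h) / P.varphi (h + 1)) * P.nodal i k
  · refine sum_congr rfl fun k _ => ?_
    rw [nodal, ← prod_mul_distrib]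
    exact prod_congr rfl fun h _ => by ring
  · refine sum_subset (by grind) fun k _ hk => ?_
    rw [P.nodal_eq_zero (by grind), mul_zero]

theorem u_zero (P : ParameterArray K) (z : K) : P.u 0 z = 1 := by simp [u]

/-- Askey–Wilson duality: each summand of u_i(θ_x) is symmetric under exchanging the eigenvalues at
x with the dual eigenvalues at i, once both sums are extended to k ≤ d. -/
theorem u_star (P : ParameterArray K) {x i : ℕ} (hx : x ≤ P.d) (hi : i ≤ P.d) :
    P.star.u x (P.θs i) = P.u i (P.θ x) := by
  rw [u_eq_sum _ hi, u_eq_sum P.star hx]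
  refine sum_congr rfl fun k _ => ?_
  simp only [nodal, star, ← prod_mul_distrib]
  exact prod_congr rfl fun h _ => by ring

/-- Weight the nodal recurrences by y_k = ∏_{h<k}(θ_x − θ_h)/φ_{h+1} and sum over k. The relation
φ_{k+1} y_{k+1} = (θ_x − θ_k) y_k converts multiplication by θ_x into the left side of those
recurrences. -/
theorem IsRegular.u_recurrence {P : ParameterArray K} (h : P.IsRegular) {x i : ℕ} (hx : x ≤ P.d)
    (hi : i ≤ P.d) : P.θ x * P.u i (P.θ x) =
      P.c i * P.u (i - 1) (P.θ x) + P.a i * P.u i (P.θ x) + P.b i * P.u (i + 1) (P.θ x) := by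
  set y : ℕ → K := fun k => ∏ h ∈ range k, (P.θ x - P.θ h) / P.varphi (h + 1) with hy
  have hb : P.b i * P.u (i + 1) (P.θ x) =
      P.b i * ∑ k ∈ range (P.d + 1), y k * P.nodal (i + 1) k := by
    rcases hi.lt_or_eq with hi | rfl
    · rw [u_eq_sum _ (show i + 1 ≤ P.d from hi)]
    · rw [b_diam, zero_mul, zero_mul]
  rw [hb, u_eq_sum _ hi, u_eq_sum _ (show i - 1 ≤ P.d by omega)]
  have hsucc : ∀ k, k < P.d → P.varphi (k + 1) * y (k + 1) = (P.θ x - P.θ k) * y k := by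
    intro k hk
    have := h.varphi_ne k hk
    simp only [hy, prod_range_succ]
    field_simp
  -- No term is lost at the upper end of the sum: either x = d, or y_d contains the factor θ_x −
  -- θ_x.
  have hlast : (P.θ x - P.θ P.d) * y P.d = 0 := by
    rcases hx.lt_or_eq with hx | rfl
    · simp only [hy]
      rw [prod_eq_zero (mem_range.2 hx) (by simp), mul_zero]
    · rw [sub_self, zero_mul]
  have h0 : P.θ x * ∑ k ∈ range (P.d + 1), y k * P.nodal i k =
      ∑ k ∈ range (P.d + 1), P.θ k * y k * P.nodal i k
        + ∑ k ∈ range P.d, P.varphi (k + 1) * y (k + 1) * P.nodal i k := by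
    rw [sum_range_succ, sum_range_succ, mul_add, mul_sum]
    have : ∑ k ∈ range P.d, P.θ x * (y k * P.nodal i k) =
        ∑ k ∈ range P.d, P.θ k * y k * P.nodal i k
        + ∑ k ∈ range P.d, P.varphi (k + 1) * y (k + 1) * P.nodal i k := by
      rw [← sum_add_distrib]
      refine sum_congr rfl fun k hk => ?_
      rw [hsucc k (mem_range.1 hk)]
      ring
    rw [this]
    linear_combination P.nodal i P.d * hlast
  rw [h0, sum_range_succ', sum_range_succ', sum_range_succ', sum_range_succ', mul_add, mul_add,
    mul_add, mul_sum, mul_sum, mul_sum]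
  simp only [nodal_zero]
  have h1 : ∑ k ∈ range P.d, P.θ (k + 1) * y (k + 1) * P.nodal i (k + 1)
      + ∑ k ∈ range P.d, P.varphi (k + 1) * y (k + 1) * P.nodal i k =
      ∑ k ∈ range P.d, P.c i * (y (k + 1) * P.nodal (i - 1) (k + 1))
      + ∑ k ∈ range P.d, P.a i * (y (k + 1) * P.nodal i (k + 1))
      + ∑ k ∈ range P.d, P.b i * (y (k + 1) * P.nodal (i + 1) (k + 1)) := by
    simp only [← sum_add_distrib]
    refine sum_congr rfl fun k hk => ?_
    linear_combination y (k + 1) * h.recurrence i k hi (mem_range.1 hk)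
  linear_combination h1 - y 0 * h.row_sum i hi

/-- A parameter array and its dual are both regular. -/
structure IsBiregular (P : ParameterArray K) : Prop where
  reg : P.IsRegular
  star : P.star.IsRegular

namespace IsBiregular

variable {P : ParameterArray K}

theorem θ_inj (h : P.IsBiregular) :
    ∀ i j : ℕ, i ≤ P.d → j ≤ P.d → P.θ i = P.θ j → i = j :=
  h.star.θs_inj

/-- These are eigenvectors, for distinct eigenvalues, of a matrix that is self-adjoint for the
weight k. -/
theorem sum_k_u_mul_u (h : P.IsBiregular) {x y : ℕ} (hx : x ≤ P.d) (hy : y ≤ P.d) (hxy : x ≠ y) :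
    ∑ i ∈ range (P.d + 1), P.k i * P.u i (P.θ x) * P.u i (P.θ y) = 0 := by
  have h1 := h.reg.sum_k_selfAdjoint (fun i => P.u i (P.θ x)) (fun i => P.u i (P.θ y))
  have e1 : ∑ i ∈ range (P.d + 1), P.k i * ((P.c i * P.u (i - 1) (P.θ x) + P.a i * P.u i (P.θ x)
      + P.b i * P.u (i + 1) (P.θ x)) * P.u i (P.θ y)) =
      P.θ x * ∑ i ∈ range (P.d + 1), P.k i * P.u i (P.θ x) * P.u i (P.θ y) := by
    rw [mul_sum]
    refine sum_congr rfl fun i hi => ?_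
    rw [← h.reg.u_recurrence hx (by grind)]
    ring
  have e2 : ∑ i ∈ range (P.d + 1), P.k i * (P.u i (P.θ x) * (P.c i * P.u (i - 1) (P.θ y)
      + P.a i * P.u i (P.θ y) + P.b i * P.u (i + 1) (P.θ y))) =
      P.θ y * ∑ i ∈ range (P.d + 1), P.k i * P.u i (P.θ x) * P.u i (P.θ y) := by
    rw [mul_sum]
    refine sum_congr rfl fun i hi => ?_
    rw [← h.reg.u_recurrence hy (by grind)]
    ring
  rw [e1, e2] at h1
  have h2 : P.θ x - P.θ y ≠ 0 := sub_ne_zero.2 fun e => hxy (h.θ_inj x y hx hy e)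
  apply mul_left_cancel₀ h2
  linear_combination h1

theorem sum_star_k_u_mul_u (h : P.IsBiregular) {i j : ℕ} (hi : i ≤ P.d) (hj : j ≤ P.d)
    (hij : i ≠ j) :
    ∑ x ∈ range (P.d + 1), P.star.k x * P.u i (P.θ x) * P.u j (P.θ x) = 0 := by
  have hrec : ∀ i x : ℕ, i ≤ P.d → x ≤ P.d → P.θs i * P.star.u x (P.θs i) =
      P.star.c x * P.star.u (x - 1) (P.θs i) + P.star.a x * P.star.u x (P.θs i)
        + P.star.b x * P.star.u (x + 1) (P.θs i) :=
    fun i x hi hx => h.star.u_recurrence hi hx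
  have h1 := h.star.sum_k_selfAdjoint (fun x => P.star.u x (P.θs i))
    (fun x => P.star.u x (P.θs j))
  have e0 : ∑ x ∈ range (P.d + 1), P.star.k x * P.u i (P.θ x) * P.u j (P.θ x) =
      ∑ x ∈ range (P.d + 1), P.star.k x * P.star.u x (P.θs i) * P.star.u x (P.θs j) := by
    refine sum_congr rfl fun x hx => ?_
    rw [u_star _ (by grind) hi, u_star _ (by grind) hj]
  have e1 : ∑ x ∈ range (P.d + 1), P.star.k x * ((P.star.c x * P.star.u (x - 1) (P.θs i)
      + P.star.a x * P.star.u x (P.θs i)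
      + P.star.b x * P.star.u (x + 1) (P.θs i)) * P.star.u x (P.θs j)) =
      P.θs i * ∑ x ∈ range (P.d + 1),
        P.star.k x * P.star.u x (P.θs i) * P.star.u x (P.θs j) := by
    rw [mul_sum]
    refine sum_congr rfl fun x hx => ?_
    rw [← hrec i x hi (by grind)]
    ring
  have e2 : ∑ x ∈ range (P.d + 1), P.star.k x * (P.star.u x (P.θs i) *
      (P.star.c x * P.star.u (x - 1) (P.θs j) + P.star.a x * P.star.u x (P.θs j)
      + P.star.b x * P.star.u (x + 1) (P.θs j))) =
      P.θs j * ∑ x ∈ range (P.d + 1),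
        P.star.k x * P.star.u x (P.θs i) * P.star.u x (P.θs j) := by
    rw [mul_sum]
    refine sum_congr rfl fun x hx => ?_
    rw [← hrec j x hj (by grind)]
    ring
  change ∑ x ∈ range (P.d + 1), _ = ∑ x ∈ range (P.d + 1), _ at h1
  rw [e1, e2] at h1
  rw [e0]
  apply mul_left_cancel₀ (h.reg.θs_sub_ne hi hj hij)
  linear_combination h1

/-- Evaluate Σ_{i,y} k_i k*_y u_i(θ_x) u_i(θ_y) u_j(θ_y) by summing over y first or over i first.
Orthogonality collapses each order to one term, which links the norms on the two sides of the
duality. -/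
theorem k_mul_sum_eq (h : P.IsBiregular) {x j : ℕ} (hx : x ≤ P.d) (hj : j ≤ P.d) :
    P.k j * P.u j (P.θ x) * ∑ y ∈ range (P.d + 1), P.star.k y * P.u j (P.θ y) * P.u j (P.θ y) =
    P.star.k x * P.u j (P.θ x) *
      ∑ i ∈ range (P.d + 1), P.k i * P.u i (P.θ x) * P.u i (P.θ x) := by
  have hL : ∑ i ∈ range (P.d + 1), P.k i * P.u i (P.θ x) *
      ∑ y ∈ range (P.d + 1), P.star.k y * P.u i (P.θ y) * P.u j (P.θ y) =
      P.k j * P.u j (P.θ x) *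
        ∑ y ∈ range (P.d + 1), P.star.k y * P.u j (P.θ y) * P.u j (P.θ y) :=
    sum_eq_single_of_mem j (by grind) fun i hi hij => by
      rw [h.sum_star_k_u_mul_u (by grind) hj hij, mul_zero]
  have hR : ∑ y ∈ range (P.d + 1), P.star.k y * P.u j (P.θ y) *
      ∑ i ∈ range (P.d + 1), P.k i * P.u i (P.θ x) * P.u i (P.θ y) =
      P.star.k x * P.u j (P.θ x) *
        ∑ i ∈ range (P.d + 1), P.k i * P.u i (P.θ x) * P.u i (P.θ x) :=
    sum_eq_single_of_mem x (by grind) fun y hy hxy => by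
      rw [h.sum_k_u_mul_u hx (by grind) hxy.symm, mul_zero]
  rw [← hL, ← hR]
  simp only [mul_sum]
  rw [sum_comm]
  exact sum_congr rfl fun _ _ => sum_congr rfl fun _ _ => by ring

theorem u_θ_zero (P : ParameterArray K) {i : ℕ} (hi : i ≤ P.d) : P.u i (P.θ 0) = 1 := by
  rw [← u_star P (Nat.zero_le _) hi, u_zero]

/-- Only one norm needs computing: at x = 0 it is the sum of the k_i, and `k_mul_sum_eq` with j = 0
carries it to every x. -/
theorem sum_k_u_sq (h : P.IsBiregular) {x : ℕ} (hx : x ≤ P.d) :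
    P.star.k x * ∑ i ∈ range (P.d + 1), P.k i * P.u i (P.θ x) * P.u i (P.θ x) = P.ν := by
  have h0 : ∑ i ∈ range (P.d + 1), P.k i * P.u i (P.θ 0) * P.u i (P.θ 0) = P.ν := by
    rw [← h.reg.sum_k]
    refine sum_congr rfl fun i hi => ?_
    rw [u_θ_zero P (by grind)]
    ring
  have h1 := h.k_mul_sum_eq hx (Nat.zero_le _)
  have h2 := h.k_mul_sum_eq (Nat.zero_le _) (Nat.zero_le _)
  rw [h0] at h2
  simp only [u_zero, mul_one, h.reg.k_zero, h.star.k_zero, one_mul] at h1 h2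
  rw [← h1, h2]

theorem sum_star_k_u_sq (h : P.IsBiregular) {j : ℕ} (hj : j ≤ P.d) :
    P.k j * ∑ y ∈ range (P.d + 1), P.star.k y * P.u j (P.θ y) * P.u j (P.θ y) = P.ν := by
  have h1 := h.k_mul_sum_eq (Nat.zero_le _) hj
  have h2 := h.sum_k_u_sq (Nat.zero_le _)
  rw [mul_assoc (P.star.k 0), mul_left_comm, h2, u_θ_zero P hj, mul_one, one_mul] at h1
  exact h1

theorem ν_ne (h : P.IsBiregular) : P.ν ≠ 0 := by
  refine prod_ne_zero_iff.2 fun l hl => ?_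
  have h1 := h.reg.phi_ne (l - 1) (by grind)
  rw [Nat.sub_add_cancel (by grind)] at h1
  exact div_ne_zero (mul_ne_zero (h.star.θs_sub_ne (Nat.zero_le _) (show l ≤ P.d by grind)
    (by grind)) (h.reg.θs_sub_ne (Nat.zero_le _) (by grind) (by grind))) h1

end IsBiregular

theorem p_natCast (P : ParameterArray K) {x i : ℕ} (hx : x ≤ P.d) (hi : i ≤ P.d) :
    P.p x i = P.k i * P.u i (P.θ x) := by
  simp [p, hx, hi]

theorem p_eq_zero_left (P : ParameterArray K) {x i : ℤ} (h : x < 0 ∨ P.d < x) : P.p x i = 0 := by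
  rw [p, if_neg (by omega)]

theorem p_eq_zero_right (P : ParameterArray K) {x i : ℤ} (h : i < 0 ∨ P.d < i) : P.p x i = 0 := by
  rw [p, if_neg (by omega)]

theorem star_k_mul_p (P : ParameterArray K) {x i : ℕ} (hx : x ≤ P.d) (hi : i ≤ P.d) :
    P.star.k x * P.p x i = P.k i * P.star.p i x := by
  rw [p_natCast _ hx hi, p_natCast P.star (show i ≤ P.star.d from hi) hx,
    show P.star.θ i = P.θs i from rfl, u_star _ hx hi]
  ring

/-- Multiplying the recurrence of u_i by k_i and using detailed balance transposes the matrix, so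
b_{i-1} and c_{i+1} replace c_i and b_i. -/
theorem IsRegular.p_recurrence {P : ParameterArray K} (h : P.IsRegular) {x i : ℕ} (hx : x ≤ P.d)
    (hi : i ≤ P.d) : P.θ x * P.p x i =
      P.b (i - 1) * P.p x (i - 1) + P.a i * P.p x i + P.c (i + 1) * P.p x (i + 1) := by
  have h1 := h.u_recurrence hx hi
  have hb : P.b (i - 1) * P.p x (i - 1) = P.k i * P.c i * P.u (i - 1) (P.θ x) := by
    rcases i with _ | i
    · simp [b, c]
    · have h2 := h.k_succ (show i < P.d by omega)
      push_cast
      rw [add_sub_cancel_right, p_natCast _ hx (by omega)]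
      linear_combination -P.u i (P.θ x) * h2
  have hc : P.c (i + 1) * P.p x (i + 1) = P.k i * P.b i * P.u (i + 1) (P.θ x) := by
    rcases hi.lt_or_eq with hi | rfl
    · have h2 := h.k_succ hi
      have h3 := p_natCast P hx (show i + 1 ≤ P.d from hi)
      push_cast at h3
      rw [h3]
      linear_combination P.u (i + 1) (P.θ x) * h2
    · rw [c_diam_succ, b_diam]; ring
  rw [hb, hc, p_natCast _ hx hi]
  linear_combination P.k i * h1

namespace IsBiregular

variable {P : ParameterArray K}

/-- Together with `sum_star_p_mul_p` this is the inversion p(Φ) p(Φ*) = ν on which all changes of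
basis rest. -/
theorem sum_p_mul_star_p (h : P.IsBiregular) {x y : ℕ} (hx : x ≤ P.d) (hy : y ≤ P.d) :
    ∑ i ∈ range (P.d + 1), P.p x i * P.star.p i y = if x = y then P.ν else 0 := by
  have e : ∑ i ∈ range (P.d + 1), P.p x i * P.star.p i y =
      P.star.k y * ∑ i ∈ range (P.d + 1), P.k i * P.u i (P.θ x) * P.u i (P.θ y) := by
    rw [mul_sum]
    refine sum_congr rfl fun i hi => ?_
    have hi' : i ≤ P.d := by grind
    rw [p_natCast _ hx hi', p_natCast P.star (show i ≤ P.star.d from hi') hy,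
      show P.star.θ i = P.θs i from rfl, u_star _ hy hi']
    ring
  rw [e]
  split_ifs with hxy
  · subst hxy; exact h.sum_k_u_sq hx
  · rw [h.sum_k_u_mul_u hx hy hxy, mul_zero]

theorem sum_star_p_mul_p (h : P.IsBiregular) {i j : ℕ} (hi : i ≤ P.d) (hj : j ≤ P.d) :
    ∑ x ∈ range (P.d + 1), P.star.p i x * P.p x j = if i = j then P.ν else 0 := by
  have e : ∑ x ∈ range (P.d + 1), P.star.p i x * P.p x j =
      P.k j * ∑ x ∈ range (P.d + 1), P.star.k x * P.u i (P.θ x) * P.u j (P.θ x) := by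
    rw [mul_sum]
    refine sum_congr rfl fun x hx => ?_
    have hx' : x ≤ P.d := by grind
    rw [p_natCast _ hx' hj, p_natCast P.star (show i ≤ P.star.d from hi) hx',
      show P.star.θ i = P.θs i from rfl, u_star _ hx' hi]
    ring
  rw [e]
  split_ifs with hij
  · subst hij; exact h.sum_star_k_u_sq hi
  · rw [h.sum_star_k_u_mul_u hi hj hij, mul_zero]

theorem sum_star_k_mul_p_mul_p (h : P.IsBiregular) {i j : ℕ} (hi : i ≤ P.d) (hj : j ≤ P.d) :
    ∑ x ∈ range (P.d + 1), P.star.k x * P.p x i * P.p x j = if i = j then P.k i * P.ν else 0 := by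
  have e : ∑ x ∈ range (P.d + 1), P.star.k x * P.p x i * P.p x j =
      P.k i * ∑ x ∈ range (P.d + 1), P.star.p i x * P.p x j := by
    rw [mul_sum]
    refine sum_congr rfl fun x hx => ?_
    rw [star_k_mul_p _ (by grind) hi]
    ring
  rw [e, h.sum_star_p_mul_p hi hj]
  split_ifs <;> simp

end IsBiregular

end ParameterArray

/-! ### Tridiagonal and bidiagonal matrices, and split forms from matrix identities -/

namespace ParameterArray

open Finset

variable {K : Type*} [Field K]

theorem sum_range_tridiag {M : Type*} [AddCommMonoid M] {n i : ℕ} (hi : i < n) (f : ℕ → M)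
    (hf : ∀ j, j + 1 < i ∨ i + 1 < j → f j = 0) :
    ∑ j ∈ range n, f j =
      (if 0 < i then f (i - 1) else 0) + f i + (if i + 1 < n then f (i + 1) else 0) := by
  have h1 : ∑ j ∈ range n, f j =
      ∑ j ∈ ((if 0 < i then {i - 1} else ∅) ∪ {i} ∪ (if i + 1 < n then {i + 1} else ∅) :
        Finset ℕ), f j := by
    symm
    apply sum_subset
    · intro j; grind
    · intro j _ h; apply hf; grind
  rw [h1, sum_union, sum_union]
  · congr 1
    · congr 1
      · split_ifs <;> simp
      · simp
    · split_ifs <;> simp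
  · rw [disjoint_left]; grind
  · rw [disjoint_left]; grind

theorem sum_fin_tridiag {M : Type*} [AddCommMonoid M] {n : ℕ} (i : Fin n) (f : Fin n → M)
    (hf : ∀ j : Fin n, (j : ℕ) + 1 < i ∨ (i : ℕ) + 1 < j → f j = 0) :
    ∑ j, f j = (if 0 < (i : ℕ) then f ⟨i - 1, by omega⟩ else 0) + f i
      + (if h : (i : ℕ) + 1 < n then f ⟨i + 1, h⟩ else 0) := by
  have h1 := sum_range_tridiag i.2 (fun j => if h : j < n then f ⟨j, h⟩ else 0) (by
    intro j hj
    split_ifs with h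
    · exact hf ⟨j, h⟩ hj
    · rfl)
  rw [← Fin.sum_univ_eq_sum_range (fun j => if h : j < n then f ⟨j, h⟩ else 0)] at h1
  simp only [Fin.is_lt, dif_pos, Fin.eta] at h1
  rw [h1, dif_pos (by omega)]
  congr 1
  split_ifs <;> rfl

/-- The entries of a matrix, with zeros outside. -/
def natEntry {n : ℕ} (M : Matrix (Fin n) (Fin n) K) (i j : ℕ) : K :=
  if h : i < n ∧ j < n then M ⟨i, h.1⟩ ⟨j, h.2⟩ else 0

theorem natEntry_of_lt {n : ℕ} (M : Matrix (Fin n) (Fin n) K) {i j : ℕ} (hi : i < n) (hj : j < n) :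
    natEntry M i j = M ⟨i, hi⟩ ⟨j, hj⟩ := by
  rw [natEntry, dif_pos ⟨hi, hj⟩]

theorem natEntry_left {n : ℕ} (M : Matrix (Fin n) (Fin n) K) {i j : ℕ} (hi : n ≤ i) :
    natEntry M i j = 0 := by
  rw [natEntry, dif_neg (by omega)]

theorem natEntry_right {n : ℕ} (M : Matrix (Fin n) (Fin n) K) {i j : ℕ} (hj : n ≤ j) :
    natEntry M i j = 0 := by
  rw [natEntry, dif_neg (by omega)]

theorem natEntry_mul {n : ℕ} (M N : Matrix (Fin n) (Fin n) K) {i j : ℕ} (hi : i < n) (hj : j < n) :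
    natEntry (M * N) i j = ∑ k ∈ range n, natEntry M i k * natEntry N k j := by
  rw [natEntry_of_lt _ hi hj, Matrix.mul_apply,
    ← Fin.sum_univ_eq_sum_range (fun k => natEntry M i k * natEntry N k j)]
  exact sum_congr rfl fun k _ => by rw [natEntry_of_lt _ hi k.2, natEntry_of_lt _ k.2 hj]

/-- The matrix with diagonal entries `θ_i` and entries `ψ_i` in position `(i - 1, i)`. -/
def upperBidiag (n : ℕ) (θ ψ : ℕ → K) : Matrix (Fin n) (Fin n) K :=
  fun i j => if i = j then θ j else if (i : ℕ) + 1 = j then ψ j else 0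

/-- The matrix with diagonal entries `θ_i` and entries `χ_i` in position `(i, i - 1)`. -/
def lowerBidiag (n : ℕ) (θ χ : ℕ → K) : Matrix (Fin n) (Fin n) K :=
  fun i j => if i = j then θ j else if (i : ℕ) = j + 1 then χ i else 0

theorem natEntry_mul_upperBidiag {n : ℕ} (R : Matrix (Fin n) (Fin n) K) (θ ψ : ℕ → K) {i k : ℕ}
    (hi : i < n) (hk : k < n) : natEntry (R * upperBidiag n θ ψ) i k =
      θ k * natEntry R i k + (if 0 < k then ψ k * natEntry R i (k - 1) else 0) := by
  rw [natEntry_mul _ _ hi hk, sum_range_tridiag hk _ fun j hj => by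
    unfold natEntry upperBidiag; grind]
  have h1 : natEntry (upperBidiag n θ ψ) k k = θ k := by
    rw [natEntry_of_lt _ hk hk]; simp [upperBidiag]
  have h2 : natEntry (upperBidiag n θ ψ) (k + 1) k = 0 := by
    unfold natEntry upperBidiag; grind
  have h3 : 0 < k → natEntry (upperBidiag n θ ψ) (k - 1) k = ψ k := by
    intro h0
    rw [natEntry_of_lt _ (by omega) hk]
    simp only [upperBidiag, Fin.mk.injEq]
    rw [if_neg (by omega), if_pos (by omega)]
  rw [h1, h2]
  split_ifs with h0 <;> simp_all <;> ring

theorem natEntry_mul_lowerBidiag {n : ℕ} (R : Matrix (Fin n) (Fin n) K) (θ χ : ℕ → K) {i k : ℕ}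
    (hi : i < n) (hk : k < n) : natEntry (R * lowerBidiag n θ χ) i k =
      θ k * natEntry R i k + χ (k + 1) * natEntry R i (k + 1) := by
  rw [natEntry_mul _ _ hi hk, sum_range_tridiag hk _ fun j hj => by
    unfold natEntry lowerBidiag; grind]
  have h1 : natEntry (lowerBidiag n θ χ) k k = θ k := by
    rw [natEntry_of_lt _ hk hk]; simp [lowerBidiag]
  have h2 : 0 < k → natEntry (lowerBidiag n θ χ) (k - 1) k = 0 := by
    unfold natEntry lowerBidiag; grind
  rw [h1]
  by_cases h0 : k + 1 < n
  · have h3 : natEntry (lowerBidiag n θ χ) (k + 1) k = χ (k + 1) := by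
      rw [natEntry_of_lt _ h0 hk]
      simp [lowerBidiag]
    rw [h3]
    split_ifs <;> simp_all <;> ring
  · rw [natEntry_right R (show n ≤ k + 1 by omega)]
    split_ifs <;> simp_all <;> ring

/-- The split form with coefficients given by matrices `R` and `T`. -/
abbrev MatrixSplitForm (P : ParameterArray K) (ψ χ : ℕ → K) {n : ℕ}
    (R T : Matrix (Fin n) (Fin n) K) : Prop :=
  SplitForm P ψ χ (fun i => natEntry T i i) (fun i => natEntry T i (i + 1))
    (fun i => if i = 0 then 0 else natEntry T i (i - 1)) (natEntry R)

/-- The two intertwining relations, read entry by entry, are the defining relations of a split form.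
Extension of the entries by zero takes care of the boundary. -/
theorem MatrixSplitForm.of_mul_eq (P : ParameterArray K) {ψ χ : ℕ → K} {n : ℕ}
    (hn : n = P.d + 1) {R R' T : Matrix (Fin n) (Fin n) K}
    (hφ : ∀ k, 1 ≤ k → k ≤ P.d → P.varphi k = ψ k * χ k)
    (hθs : ∀ i j : ℕ, i ≤ P.d → j ≤ P.d → P.θs i = P.θs j → i = j)
    (hR : R * R' = 1) (hT : IsIrreducibleTridiagonal T)
    (h1 : R * upperBidiag _ P.θ ψ = T * R)
    (h2 : R * lowerBidiag _ P.θs χ = Matrix.diagonal (fun i : Fin n => P.θs i) * R) :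
    MatrixSplitForm P ψ χ R T := by
  subst hn
  have hTR : ∀ i k, i ≤ P.d → k ≤ P.d → P.θ k * natEntry R i k
      + (if 0 < k then ψ k * natEntry R i (k - 1) else 0) =
      (if i = 0 then 0 else natEntry T i (i - 1)) * natEntry R (i - 1) k
        + natEntry T i i * natEntry R i k + natEntry T i (i + 1) * natEntry R (i + 1) k := by
    intro i k hi hk
    rw [← natEntry_mul_upperBidiag _ _ _ (Nat.lt_succ_of_le hi) (Nat.lt_succ_of_le hk), h1,
      natEntry_mul _ _ (Nat.lt_succ_of_le hi) (Nat.lt_succ_of_le hk),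
      sum_range_tridiag (Nat.lt_succ_of_le hi) _ fun j hj => by
        unfold natEntry
        split_ifs
        · rw [hT.1 _ _ (by simp only; omega), zero_mul]
        all_goals simp]
    congr 1
    · congr 1
      split_ifs <;> grind
    · split_ifs with h
      · rfl
      · rw [natEntry_right T (by omega), zero_mul]
  refine ⟨hφ, hθs, fun i k hi => natEntry_left _ hi, fun i k hk => natEntry_right _ hk, ?_, ?_, ?_,
    by simp, natEntry_right _ le_rfl, ?_, ?_, ?_⟩
  · intro i k hi hk
    rw [← natEntry_mul_lowerBidiag _ _ _ (Nat.lt_succ_of_le hi) (Nat.lt_succ_of_le hk), h2,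
      natEntry_of_lt _ (Nat.lt_succ_of_le hi) (Nat.lt_succ_of_le hk), Matrix.diagonal_mul,
      natEntry_of_lt _ (Nat.lt_succ_of_le hi) (Nat.lt_succ_of_le hk)]
  · intro i hi
    have := hTR i 0 hi (Nat.zero_le _)
    simpa using this
  · intro i k hi hk
    have := hTR i (k + 1) hi hk
    simpa using this
  · intro i hi
    rw [if_neg (by omega), natEntry_of_lt _ (by omega) (by omega)]
    exact hT.2 _ _ (by simp)
  · intro i hi
    rw [natEntry_of_lt _ (by omega) (by omega)]
    exact hT.2 _ _ (by simp)
  -- A matrix with a right inverse has no zero row.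
  · intro i hi
    by_contra! hz
    have h3 := natEntry_mul R R' (Nat.lt_succ_of_le hi) (Nat.lt_succ_of_le hi)
    rw [hR, sum_eq_zero fun k _ => by rw [hz, zero_mul],
      natEntry_of_lt _ (Nat.lt_succ_of_le hi) (Nat.lt_succ_of_le hi)] at h3
    simp at h3

theorem _root_.IsIrreducibleTridiagonal.transpose {n : ℕ} {T : Matrix (Fin n) (Fin n) K}
    (hT : IsIrreducibleTridiagonal T) : IsIrreducibleTridiagonal T.transpose :=
  ⟨fun i j h => hT.1 j i h.symm, fun i j h => hT.2 j i h.symm⟩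

theorem _root_.IsIrreducibleTridiagonal.rev {n : ℕ} {T : Matrix (Fin n) (Fin n) K}
    (hT : IsIrreducibleTridiagonal T) : IsIrreducibleTridiagonal (T.submatrix Fin.rev Fin.rev) :=
  ⟨fun i j h => hT.1 _ _ (by simp only [Fin.val_rev]; omega),
    fun i j h => hT.2 _ _ (by simp only [Fin.val_rev]; omega)⟩

theorem natEntry_rev {d : ℕ} (T : Matrix (Fin (d + 1)) (Fin (d + 1)) K) {i j : ℕ} (hi : i ≤ d)
    (hj : j ≤ d) : natEntry (T.submatrix Fin.rev Fin.rev) i j = natEntry T (d - i) (d - j) := by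
  rw [natEntry_of_lt _ (by omega) (by omega), natEntry_of_lt _ (by omega) (by omega)]
  rw [Matrix.submatrix_apply]
  congr 1 <;> (ext; simp only [Fin.val_rev]; omega)

theorem toMatrix_conj {ι ι' W : Type*} [Fintype ι] [DecidableEq ι] [Fintype ι'] [DecidableEq ι']
    [AddCommGroup W] [Module K W] (b : Module.Basis ι K W) (c : Module.Basis ι' K W)
    (f : Module.End K W) :
    LinearMap.toMatrix b b f * b.toMatrix c = b.toMatrix c * LinearMap.toMatrix c c f := by
  rw [linearMap_toMatrix_mul_basis_toMatrix, basis_toMatrix_mul_linearMap_toMatrix]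

theorem toMatrix_eq_diagonal {ι W : Type*} [Fintype ι] [DecidableEq ι]
    [AddCommGroup W] [Module K W] {b : Module.Basis ι K W} {f : Module.End K W} {μ : ι → K}
    (h : ∀ i, f (b i) = μ i • b i) : LinearMap.toMatrix b b f = Matrix.diagonal μ := by
  ext i j
  rw [LinearMap.toMatrix_apply, h, map_smul, Matrix.diagonal_apply]
  simp only [Module.Basis.repr_self, Finsupp.smul_single, smul_eq_mul, mul_one,
    Finsupp.single_apply]
  by_cases hij : i = j
  · subst hij; simp
  · simp [hij, Ne.symm hij]

end ParameterArray

/-! ### From Leonard systems to scalar identities -/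

namespace HasParameterArray

open Finset ParameterArray

variable {K : Type*} [Field K] {W : Type*} [AddCommGroup W] [Module K W]
  {P : ParameterArray K} {A As : Module.End K W}

theorem isRegular (h : HasParameterArray P A As) : P.IsRegular := by
  obtain ⟨v, hv, hT⟩ := h.dualEigenbasis
  obtain ⟨w, hw, hws⟩ := h.firstSplit
  obtain ⟨w', hw', hws'⟩ := h.secondSplit
  set T := LinearMap.toMatrix v v A with hTdef
  have hD := toMatrix_eq_diagonal hv
  -- Rows of R are the coordinates of the A*-eigenvectors in the first split basis. Transposition
  -- makes A act from the right by an upper bidiagonal matrix.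
  have s1 : MatrixSplitForm P 1 P.varphi (w.toMatrix v).transpose T.transpose := by
    refine MatrixSplitForm.of_mul_eq P (n := P.d + 1) rfl
      (R := (w.toMatrix v).transpose) (R' := (v.toMatrix w).transpose)
      (by simp) h.θs_inj ?_ hT.transpose ?_ ?_
    · rw [← Matrix.transpose_mul, Module.Basis.toMatrix_mul_toMatrix_flip, Matrix.transpose_one]
    · rw [← Matrix.transpose_mul, ← toMatrix_conj, Matrix.transpose_mul]
      congr 1
      ext i j
      rw [Matrix.transpose_apply, hw, upperBidiag]
      simp only [Pi.one_apply]
      grind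
    · rw [← Matrix.diagonal_transpose, ← Matrix.transpose_mul, ← hD, ← toMatrix_conj,
        Matrix.transpose_mul]
      congr 1
      ext i j
      rw [Matrix.transpose_apply, hws, lowerBidiag]
      grind
  -- Rows of R are now the dual basis functionals evaluated on the second split basis, with both
  -- orderings reversed. T is not transposed here, so β and γ trade places relative to `s1`; only
  -- diagonal entries and off-diagonal products are compared, and these agree.
  have s2 : MatrixSplitForm P.revDual 1 P.revDual.varphi
      ((v.toMatrix w').submatrix Fin.rev Fin.rev) (T.submatrix Fin.rev Fin.rev) := by
    refine MatrixSplitForm.of_mul_eq P.revDual (n := P.d + 1) rfl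
      (R := (v.toMatrix w').submatrix Fin.rev Fin.rev)
      (R' := (w'.toMatrix v).submatrix Fin.rev Fin.rev) (T := T.submatrix Fin.rev Fin.rev)
      (by simp) ?_ ?_ hT.rev ?_ ?_
    · intro i j hi hj e
      have := h.θs_inj _ _ (Nat.sub_le _ _) (Nat.sub_le _ _) e
      change i ≤ P.d at hi
      change j ≤ P.d at hj
      omega
    · have h1 := Matrix.submatrix_mul_equiv (v.toMatrix w') (w'.toMatrix v) Fin.rev Fin.revPerm
        Fin.rev
      rw [Module.Basis.toMatrix_mul_toMatrix_flip] at h1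
      refine h1.trans ?_
      exact Matrix.submatrix_one _ Fin.rev_injective
    · have h1 := Matrix.submatrix_mul_equiv (v.toMatrix w') (LinearMap.toMatrix w' w' A) Fin.rev
        Fin.revPerm Fin.rev
      have h2 := Matrix.submatrix_mul_equiv T (v.toMatrix w') Fin.rev Fin.revPerm Fin.rev
      rw [← toMatrix_conj, ← h2] at h1
      refine Eq.trans ?_ h1
      congr 1
      ext i j
      rw [Matrix.submatrix_apply, hw', upperBidiag]
      simp only [Fin.revPerm_apply, Fin.rev_inj, Fin.val_rev, Pi.one_apply, revDual]
      have := i.2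
      have := j.2
      rw [show P.d - (P.d + 1 - ((j : ℕ) + 1)) = j by omega]
      split_ifs <;> first | rfl | omega
    · have h1 := Matrix.submatrix_mul_equiv (v.toMatrix w') (LinearMap.toMatrix w' w' As) Fin.rev
        Fin.revPerm Fin.rev
      have h2 := Matrix.submatrix_mul_equiv (LinearMap.toMatrix v v As) (v.toMatrix w') Fin.rev
        Fin.revPerm Fin.rev
      rw [← toMatrix_conj, ← h2, hD] at h1
      refine Eq.trans ?_ (h1.trans ?_)
      · congr 1
        ext i j
        rw [Matrix.submatrix_apply, hws', lowerBidiag]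
        simp only [Fin.revPerm_apply, Fin.rev_inj, Fin.val_rev, revDual]
        have := i.2
        have := j.2
        rw [show P.d + 1 - ((j : ℕ) + 1) = P.d - j by omega]
        split_ifs <;> first | rfl | omega | (congr 1; omega)
      · congr 1
        ext i j
        rw [Matrix.submatrix_apply]
        simp only [Fin.revPerm_apply, Matrix.diagonal_apply, Fin.rev_inj, Fin.val_rev, revDual]
        rw [show P.d + 1 - ((i : ℕ) + 1) = P.d - i by omega]
  refine (s1.isRegular s2 ?_ ?_).1
  · intro i hi
    rw [natEntry_rev T (by omega) (by omega), show P.d - (P.d - i) = i by omega,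
      natEntry_of_lt _ (by omega) (by omega), natEntry_of_lt _ (by omega) (by omega)]
    rfl
  · intro i hi
    rw [if_neg (by omega), if_neg (by omega), natEntry_rev T (by omega) (by omega),
      natEntry_rev T (by omega) (by omega),
      show P.d - (P.d - (i + 1)) = i + 1 by omega,
      show P.d - (P.d - (i + 1) + 1) = i by omega,
      show P.d - (P.d - i) = i by omega, show P.d - (P.d - i - 1) = i + 1 by omega]
    simp only [natEntry_of_lt _ (show i < P.d + 1 by omega) (show i + 1 < P.d + 1 by omega),
      natEntry_of_lt _ (show i + 1 < P.d + 1 by omega) (show i < P.d + 1 by omega),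
      Nat.add_sub_cancel, Matrix.transpose_apply]

/-- The same argument with A and A* exchanged: the functionals dual to the A-eigenbasis, evaluated
on the two split bases, are split forms for the dual array, now with ψ = φ or ϕ and χ = 1. The
diagonal entries and off-diagonal products of A* are retained for normalising the eigenbasis later.
-/
theorem star_isRegular (h : HasParameterArray P A As) {v : Module.Basis (Fin (P.d + 1)) K W}
    (hv : ∀ i, A (v i) = P.θ i • v i)
    (hT : IsIrreducibleTridiagonal (LinearMap.toMatrix v v As)) :
    P.star.IsRegular ∧
      (∀ i : ℕ, i ≤ P.d → natEntry (LinearMap.toMatrix v v As) i i = P.star.a i) ∧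
      (∀ i : ℕ, i < P.d → P.star.b i * P.star.c (i + 1) =
        natEntry (LinearMap.toMatrix v v As) i (i + 1)
          * natEntry (LinearMap.toMatrix v v As) (i + 1) i) := by
  have hφ := h.isRegular.varphi_ne
  obtain ⟨w, hw, hws⟩ := h.firstSplit
  obtain ⟨w', hw', hws'⟩ := h.secondSplit
  set T := LinearMap.toMatrix v v As with hTdef
  have hD := toMatrix_eq_diagonal hv
  have s1 : MatrixSplitForm P.star P.varphi 1 (v.toMatrix w) T := by
    refine MatrixSplitForm.of_mul_eq P.star (n := P.d + 1) rfl
      (R := v.toMatrix w) (R' := w.toMatrix v) (T := T)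
      (by simp [ParameterArray.star]) h.θ_inj ?_ hT ?_ ?_
    · rw [Module.Basis.toMatrix_mul_toMatrix_flip]
    · refine Eq.trans ?_ (toMatrix_conj v w As).symm
      congr 1
      ext i j
      rw [hws]; rfl
    · refine Eq.trans ?_ ((toMatrix_conj v w A).symm.trans (by rw [hD]; rfl))
      congr 1
      ext i j
      rw [hw]; rfl
  have s2 : MatrixSplitForm P.star.revDual P.phi 1
      ((v.toMatrix w').submatrix Fin.rev id) (T.submatrix Fin.rev Fin.rev) := by
    refine MatrixSplitForm.of_mul_eq P.star.revDual (n := P.d + 1) rfl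
      (R := (v.toMatrix w').submatrix Fin.rev id)
      (R' := (w'.toMatrix v).submatrix id Fin.rev) (T := T.submatrix Fin.rev Fin.rev)
      ?_ ?_ ?_ hT.rev ?_ ?_
    · intro k h1 h2
      change k ≤ P.d at h2
      simp only [revDual, ParameterArray.star, Pi.one_apply, mul_one]
      rw [show P.d + 1 - (P.d + 1 - k) = k by omega]
    · intro i j hi hj e
      have := h.θ_inj _ _ (Nat.sub_le _ _) (Nat.sub_le _ _) e
      change i ≤ P.d at hi
      change j ≤ P.d at hj
      omega
    · have h1 := Matrix.submatrix_mul_equiv (v.toMatrix w') (w'.toMatrix v) Fin.rev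
        (Equiv.refl _) Fin.rev
      rw [Module.Basis.toMatrix_mul_toMatrix_flip] at h1
      refine h1.trans ?_
      exact Matrix.submatrix_one _ Fin.rev_injective
    · have h1 := Matrix.submatrix_mul_equiv (v.toMatrix w') (LinearMap.toMatrix w' w' As) Fin.rev
        (Equiv.refl _) id
      have h2 := Matrix.submatrix_mul_equiv T (v.toMatrix w') Fin.rev Fin.revPerm id
      rw [← toMatrix_conj, ← h2] at h1
      refine Eq.trans ?_ h1
      congr 1
      ext i j
      rw [Matrix.submatrix_apply]
      exact (hws' i j).symm
    · have h1 := Matrix.submatrix_mul_equiv (v.toMatrix w') (LinearMap.toMatrix w' w' A) Fin.rev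
        (Equiv.refl _) id
      have h2 := Matrix.submatrix_mul_equiv (LinearMap.toMatrix v v A) (v.toMatrix w') Fin.rev
        Fin.revPerm id
      rw [← toMatrix_conj, ← h2, hD] at h1
      refine Eq.trans ?_ (h1.trans ?_)
      · congr 1
        ext i j
        rw [Matrix.submatrix_apply]
        exact (hw' i j).symm
      · congr 1
        ext i j
        rw [Matrix.submatrix_apply]
        simp only [Fin.revPerm_apply, Matrix.diagonal_apply, Fin.rev_inj, Fin.val_rev, revDual,
          ParameterArray.star]
        rw [show P.d + 1 - ((i : ℕ) + 1) = P.d - i by omega]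
  have key := s1.isRegular s2 (fun i hi => ?_) (fun i hi => ?_)
  · refine ⟨key.1, key.2.1, fun i hi => ?_⟩
    have := key.2.2 i hi
    rw [if_neg (by omega)] at this
    exact this
  · change i ≤ P.d at hi
    change natEntry (T.submatrix Fin.rev Fin.rev) (P.d - i) (P.d - i) = natEntry T i i
    rw [natEntry_rev T (by omega) (by omega), show P.d - (P.d - i) = i by omega]
  · change i < P.d at hi
    change natEntry (T.submatrix Fin.rev Fin.rev) (P.d - (i + 1)) (P.d - (i + 1) + 1) *
      (if P.d - i = 0 then 0 else
        natEntry (T.submatrix Fin.rev Fin.rev) (P.d - i) (P.d - i - 1)) =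
      natEntry T i (i + 1) * (if i + 1 = 0 then 0 else natEntry T (i + 1) (i + 1 - 1))
    rw [if_neg (by omega), if_neg (by omega), natEntry_rev T (by omega) (by omega),
      natEntry_rev T (by omega) (by omega),
      show P.d - (P.d - (i + 1)) = i + 1 by omega,
      show P.d - (P.d - (i + 1) + 1) = i by omega,
      show P.d - (P.d - i) = i by omega, show P.d - (P.d - i - 1) = i + 1 by omega,
      Nat.add_sub_cancel]
    ring

theorem isBiregular (h : HasParameterArray P A As) : P.IsBiregular := by
  obtain ⟨v, hv, hT⟩ := h.eigenbasis
  exact ⟨h.isRegular, (h.star_isRegular hv hT).1⟩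

end HasParameterArray

/-! ### Normalised eigenbases and transport of Leonard systems -/

namespace HasParameterArray

open Finset ParameterArray

variable {K : Type*} [Field K] {W : Type*} [AddCommGroup W] [Module K W]
  {P : ParameterArray K} {A As : Module.End K W}

theorem of_equiv {W' : Type*} [AddCommGroup W'] [Module K W'] (h : HasParameterArray P A As)
    (e : W ≃ₗ[K] W') {A' As' : Module.End K W'} (hA : ∀ x, A' (e x) = e (A x))
    (hAs : ∀ x, As' (e x) = e (As x)) : HasParameterArray P A' As' := by
  have key : ∀ (b : Module.Basis (Fin (P.d + 1)) K W) {T : Module.End K W} {T' : Module.End K W'},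
      (∀ x, T' (e x) = e (T x)) →
      LinearMap.toMatrix (b.map e) (b.map e) T' = LinearMap.toMatrix b b T := by
    intro b T T' hT
    ext i j
    simp [LinearMap.toMatrix_apply, hT]
  refine ⟨h.θ_inj, h.θs_inj, ?_, ?_, ?_, ?_⟩
  · obtain ⟨v, hv, hT⟩ := h.eigenbasis
    refine ⟨v.map e, fun i => ?_, by rwa [key v hAs]⟩
    rw [Module.Basis.map_apply, hA, hv, map_smul]
  · obtain ⟨v, hv, hT⟩ := h.dualEigenbasis
    refine ⟨v.map e, fun i => ?_, by rwa [key v hA]⟩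
    rw [Module.Basis.map_apply, hAs, hv, map_smul]
  · obtain ⟨w, h1, h2⟩ := h.firstSplit
    exact ⟨w.map e, by rwa [key w hA], by rwa [key w hAs]⟩
  · obtain ⟨w, h1, h2⟩ := h.secondSplit
    exact ⟨w.map e, by rwa [key w hA], by rwa [key w hAs]⟩

/-- Rescaling eigenvectors changes the off-diagonal entries of A* but not their products. So one
side can be made equal to c(Φ*), and the other side is then b(Φ*) automatically. -/
theorem exists_eigenbasis (h : HasParameterArray P A As) :
    ∃ v : Module.Basis (Fin (P.d + 1)) K W, (∀ i, A (v i) = P.θ i • v i) ∧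
      ∀ i : Fin (P.d + 1), As (v i) =
        (if 0 < (i : ℕ) then P.star.b ((i : ℤ) - 1) • v ⟨i - 1, by omega⟩ else 0)
          + P.star.a i • v i
          + (if h : (i : ℕ) + 1 < P.d + 1 then P.star.c ((i : ℤ) + 1) • v ⟨i + 1, h⟩ else 0) := by
  obtain ⟨v, hv, hT⟩ := h.eigenbasis
  obtain ⟨hreg, ha, hbc⟩ := h.star_isRegular hv hT
  set T := LinearMap.toMatrix v v As with hTdef
  have hTne : ∀ i, i < P.d → natEntry T (i + 1) i ≠ 0 := fun i hi => by
    rw [natEntry_of_lt _ (by omega) (by omega)]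
    exact hT.2 _ _ (by simp)
  -- The scaling is dictated by requiring s_i T_{i+1,i} = c_{i+1}(Φ*) s_{i+1} with s_0 = 1.
  let s : ℕ → K := fun i => ∏ l ∈ range i, natEntry T (l + 1) l / P.star.c ((l : ℤ) + 1)
  have hs : ∀ i, i ≤ P.d → s i ≠ 0 := fun i hi => prod_ne_zero_iff.2 fun l hl =>
    div_ne_zero (hTne l (by grind)) (hreg.c_ne (show l < P.d by grind))
  have hsucc : ∀ i, i < P.d → s i * natEntry T (i + 1) i = P.star.c ((i : ℤ) + 1) * s (i + 1) := by
    intro i hi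
    have := hreg.c_ne hi
    simp only [s, prod_range_succ]
    field_simp
  have hpred : ∀ i, i < P.d → s (i + 1) * natEntry T i (i + 1) = P.star.b (i : ℤ) * s i := by
    intro i hi
    have h1 := hreg.c_ne hi
    apply mul_left_cancel₀ h1
    linear_combination -s i * hbc i hi - natEntry T i (i + 1) * hsucc i hi
  have hAsv : ∀ i : Fin (P.d + 1), As (v i) =
      (if 0 < (i : ℕ) then natEntry T (i - 1) i • v ⟨i - 1, by omega⟩ else 0)
        + natEntry T i i • v i
        + (if h : (i : ℕ) + 1 < P.d + 1 then natEntry T (i + 1) i • v ⟨i + 1, h⟩ else 0) := by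
    intro i
    have h1 : As (v i) = ∑ j, T j i • v j := by
      rw [← v.sum_repr (As (v i))]
      exact sum_congr rfl fun j _ => by rw [hTdef, LinearMap.toMatrix_apply]
    rw [h1, sum_fin_tridiag i _ fun j hj => by rw [hT.1 _ _ hj, zero_smul],
      natEntry_of_lt T (show (i : ℕ) - 1 < P.d + 1 by omega) i.2, natEntry_of_lt T i.2 i.2]
    congr 1
    split_ifs with h2
    · rw [natEntry_of_lt T h2 i.2]
    · rfl
  refine ⟨v.isUnitSMul (fun i => IsUnit.mk0 (s i) (hs i (by omega))), fun i => ?_, fun i => ?_⟩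
  · rw [Module.Basis.isUnitSMul_apply, map_smul, hv, smul_comm]
  · simp only [Module.Basis.isUnitSMul_apply]
    rw [map_smul, hAsv, smul_add, smul_add]
    congr 1
    · congr 1
      · split_ifs with h0
        · have h1 := hpred (i - 1) (by omega)
          rw [Nat.sub_add_cancel h0] at h1
          rw [smul_smul, smul_smul, h1]
          congr 3
          omega
        · simp
      · rw [ha i (by omega), smul_comm]
    · split_ifs with h0
      · rw [smul_smul, smul_smul, hsucc i (by omega)]
      · simp

end HasParameterArray

namespace ParameterArray

variable {K : Type*} [Field K] {P : ParameterArray K} {V : Type*} [AddCommGroup V] [Module K V]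

theorem IsParameterArray.isBiregular (hP : P.IsParameterArray) : P.IsBiregular := by
  obtain ⟨A, As, h⟩ := hP
  exact h.isBiregular

/-- In its normalised eigenbasis a Leonard system is determined by its array. Hence matching the
family m with that basis is an isomorphism onto U, and all four bases of the definition are
transported at once. -/
theorem IsParameterArray.hasParameterArray_restrict (hP : P.IsParameterArray) {U : Submodule K V}
    {m : ℤ → V} (hli : LinearIndependent K fun i : Fin (P.d + 1) => m (i : ℕ))
    (hspan : Submodule.span K (Set.range fun i : Fin (P.d + 1) => m (i : ℕ)) = U)
    (hneg : m (-1) = 0) (hdiam : m (P.d + 1) = 0) {A As : Module.End K V}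
    (hA : ∀ i : ℕ, i ≤ P.d → A (m i) = P.θ i • m i)
    (hAs : ∀ i : ℕ, i ≤ P.d → As (m i) = P.star.b (i - 1) • m (i - 1) + P.star.a i • m i
      + P.star.c (i + 1) • m (i + 1))
    (hAU : ∀ v ∈ U, A v ∈ U) (hAsU : ∀ v ∈ U, As v ∈ U) :
    HasParameterArray P (A.restrict hAU) (As.restrict hAsU) := by
  obtain ⟨A₀, As₀, h⟩ := hP
  obtain ⟨v, hv, hvs⟩ := h.exists_eigenbasis
  subst hspan
  let e := v.equiv (Module.Basis.span hli) (Equiv.refl _)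
  have he : ∀ i, ((e (v i) : _) : V) = m (i : ℕ) := fun i => by
    rw [Module.Basis.equiv_apply, Equiv.refl_apply, Module.Basis.span_apply]
  refine h.of_equiv e ?_ ?_
  · have : (A.restrict hAU) ∘ₗ e.toLinearMap = e.toLinearMap ∘ₗ A₀ := by
      refine v.ext fun i => Subtype.ext ?_
      simp only [LinearMap.comp_apply, LinearEquiv.coe_coe, LinearMap.coe_restrict_apply]
      rw [hv, map_smul, Submodule.coe_smul, he, hA i (by omega)]
    exact fun x => LinearMap.congr_fun this x
  · have : (As.restrict hAsU) ∘ₗ e.toLinearMap = e.toLinearMap ∘ₗ As₀ := by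
      refine v.ext fun i => Subtype.ext ?_
      simp only [LinearMap.comp_apply, LinearEquiv.coe_coe, LinearMap.coe_restrict_apply]
      rw [hvs, map_add, map_add, Submodule.coe_add, Submodule.coe_add, map_smul,
        Submodule.coe_smul, he, hAs i (by omega)]
      congr 1
      · congr 1
        split_ifs with h0
        · rw [map_smul, Submodule.coe_smul, he]
          congr 2
          simp only
          omega
        · rw [show ((i : ℕ) : ℤ) - 1 = -1 by omega, hneg]
          simp
      · split_ifs with h0
        · rw [map_smul, Submodule.coe_smul, he]
          congr 2
        · rw [show ((i : ℕ) : ℤ) + 1 = P.d + 1 by omega, hdiam]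
          simp
    exact fun x => LinearMap.congr_fun this x

end ParameterArray

/-! ### Jointly diagonalizable pairs of endomorphisms -/

section JointEigenbasis

open Module

variable {K : Type*} [Field K] {V : Type*} [AddCommGroup V] [Module K V]
  {ι : Type*} {b : Basis ι K V} {S T : End K V} {α β : ι → K}

theorem repr_apply_of_eigen (hS : ∀ i, S (b i) = α i • b i) (u : V) (i : ι) :
    b.repr (S u) i = α i * b.repr u i := by
  have : (b.coord i) ∘ₗ S = α i • b.coord i := by
    refine b.ext fun j => ?_
    simp only [LinearMap.comp_apply, hS, map_smul, LinearMap.smul_apply, Basis.coord_apply,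
      Basis.repr_self, smul_eq_mul]
    by_cases hij : j = i
    · rw [hij]
    · rw [Finsupp.single_eq_of_ne (Ne.symm hij), mul_zero, mul_zero]
  exact LinearMap.congr_fun this u

theorem isDiagonalizableEnd_of_eigen (hS : ∀ i, S (b i) = α i • b i) : IsDiagonalizableEnd S := by
  rw [IsDiagonalizableEnd, eq_top_iff, ← b.span_eq, Submodule.span_le]
  rintro _ ⟨i, rfl⟩
  exact Submodule.mem_iSup_of_mem (α i) (End.mem_eigenspace_iff.2 (hS i))

theorem eigen_of_mem_span_pair {R : End K V} (hR : R ∈ Submodule.span K {S, T})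
    (hS : ∀ i, S (b i) = α i • b i) (hT : ∀ i, T (b i) = β i • b i) :
    ∃ γ : ι → K, ∀ i, R (b i) = γ i • b i := by
  obtain ⟨x, y, rfl⟩ := Submodule.mem_span_pair.1 hR
  exact ⟨fun i => x * α i + y * β i, fun i => by
    simp [hS, hT, add_smul, mul_smul]⟩

theorem commute_of_eigen (hS : ∀ i, S (b i) = α i • b i) (hT : ∀ i, T (b i) = β i • b i) :
    Commute S T :=
  b.ext fun i => by
    simp only [End.mul_apply, hS, hT, map_smul]
    rw [smul_comm]

theorem repr_ne_zero_of_mem_eigenspace (hS : ∀ i, S (b i) = α i • b i) {μ : K} {u : V}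
    (hu : u ∈ End.eigenspace S μ) {i : ι} (hi : b.repr u i ≠ 0) : α i = μ := by
  have h1 := repr_apply_of_eigen hS u i
  rw [End.mem_eigenspace_iff.1 hu, map_smul] at h1
  exact mul_right_cancel₀ hi h1.symm

theorem exists_repr_ne_zero (b : Basis ι K V) {u : V} (hu : u ≠ 0) : ∃ i, b.repr u i ≠ 0 := by
  by_contra! h
  exact hu (b.repr.map_eq_zero_iff.1 (Finsupp.ext h))

theorem mem_span_singleton_of_repr {u : V} {i : ι} (h : ∀ j, j ≠ i → b.repr u j = 0) :
    u ∈ Submodule.span K {b i} := by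
  refine Submodule.mem_span_singleton.2 ⟨b.repr u i, b.repr.injective (Finsupp.ext fun j => ?_)⟩
  by_cases hj : j = i
  · subst hj; simp
  · simp [h j hj, Ne.symm hj]

theorem eigenspace_inf_eigenspace (hS : ∀ i, S (b i) = α i • b i) (hT : ∀ i, T (b i) = β i • b i)
    (hinj : ∀ i j, α i = α j → β i = β j → i = j) (i : ι) :
    End.eigenspace S (α i) ⊓ End.eigenspace T (β i) = Submodule.span K {b i} := by
  apply le_antisymm
  · rintro u ⟨h1, h2⟩
    refine mem_span_singleton_of_repr fun j hj => ?_
    by_contra hne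
    exact hj (hinj j i (repr_ne_zero_of_mem_eigenspace hS h1 hne)
      (repr_ne_zero_of_mem_eigenspace hT h2 hne))
  · rw [Submodule.span_singleton_le_iff_mem]
    exact ⟨End.mem_eigenspace_iff.2 (hS i), End.mem_eigenspace_iff.2 (hT i)⟩

theorem exists_joint_eigenvalue (hS : ∀ i, S (b i) = α i • b i) (hT : ∀ i, T (b i) = β i • b i)
    {μ η : K} (h : End.eigenspace S μ ⊓ End.eigenspace T η ≠ ⊥) : ∃ i, α i = μ ∧ β i = η := by
  obtain ⟨u, ⟨h1, h2⟩, hu⟩ := Submodule.exists_mem_ne_zero_of_ne_bot h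
  obtain ⟨i, hi⟩ := exists_repr_ne_zero b hu
  exact ⟨i, repr_ne_zero_of_mem_eigenspace hS h1 hi, repr_ne_zero_of_mem_eigenspace hT h2 hi⟩

theorem finrank_eigenspace_inf_eigenspace (hS : ∀ i, S (b i) = α i • b i)
    (hT : ∀ i, T (b i) = β i • b i) (hinj : ∀ i j, α i = α j → β i = β j → i = j) {μ η : K}
    (h : End.eigenspace S μ ⊓ End.eigenspace T η ≠ ⊥) :
    finrank K ↥(End.eigenspace S μ ⊓ End.eigenspace T η) = 1 := by
  obtain ⟨i, rfl, rfl⟩ := exists_joint_eigenvalue hS hT h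
  rw [eigenspace_inf_eigenspace hS hT hinj]
  exact finrank_span_singleton (b.ne_zero i)

theorem range_span_eq_commonEigenspaces (hS : ∀ i, S (b i) = α i • b i)
    (hT : ∀ i, T (b i) = β i • b i) (hinj : ∀ i j, α i = α j → β i = β j → i = j) :
    Set.range (fun i => Submodule.span K {b i}) =
      {U | IsCommonEigenspace (Submodule.span K {S, T}) U} := by
  have hSm : S ∈ Submodule.span K {S, T} := Submodule.subset_span (by simp)
  have hTm : T ∈ Submodule.span K {S, T} := Submodule.subset_span (by simp)
  have hle : ∀ χ : End K V → K, (⨅ R ∈ Submodule.span K {S, T}, End.eigenspace R (χ R)) ≤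
      End.eigenspace S (χ S) ⊓ End.eigenspace T (χ T) := fun χ =>
    le_inf (iInf₂_le S hSm) (iInf₂_le T hTm)
  ext U
  constructor
  · rintro ⟨i, rfl⟩
    -- The joint eigenvalue is read off as the i-th coordinate of R b_i, an expression that makes
    -- sense for every endomorphism R, as the definition requires.
    refine ⟨by simpa using b.ne_zero i, fun R => b.repr (R (b i)) i, le_antisymm ?_ ?_⟩
    · refine le_iInf₂ fun R hR => ?_
      rw [Submodule.span_singleton_le_iff_mem, End.mem_eigenspace_iff]
      obtain ⟨γ, hγ⟩ := eigen_of_mem_span_pair hR hS hT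
      simp [hγ]
    · refine (hle _).trans (le_of_eq ?_)
      change _ = Submodule.span K {b i}
      rw [← eigenspace_inf_eigenspace hS hT hinj i]
      simp [hS, hT]
  · rintro ⟨hU, χ, rfl⟩
    obtain ⟨u, hu, hu0⟩ := Submodule.exists_mem_ne_zero_of_ne_bot hU
    have h1 := hle χ hu
    obtain ⟨i, h2, h3⟩ := exists_joint_eigenvalue hS hT
      (Submodule.ne_bot_iff _ |>.2 ⟨u, h1, hu0⟩)
    have hle' := hle χ
    rw [← h2, ← h3, eigenspace_inf_eigenspace hS hT hinj] at hle'
    refine ⟨i, le_antisymm ?_ hle'⟩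
    obtain ⟨r, rfl⟩ := Submodule.mem_span_singleton.1 (hle' hu)
    have hr : r ≠ 0 := fun h => hu0 (by simp [h])
    rw [Submodule.span_singleton_le_iff_mem]
    exact (Submodule.smul_mem_iff _ hr).1 hu

/-- Remove the other coordinates of u one at a time: S − α_j or T − β_j kills coordinate j, and
since the joint eigenvalues separate i from j, one of the two leaves coordinate i nonzero. What
survives is a nonzero multiple of b_i in W. -/
theorem basis_mem_of_invariant [Finite ι] (hS : ∀ i, S (b i) = α i • b i)
    (hT : ∀ i, T (b i) = β i • b i) (hinj : ∀ i j, α i = α j → β i = β j → i = j)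
    {W : Submodule K V} (hWS : ∀ u ∈ W, S u ∈ W) (hWT : ∀ u ∈ W, T u ∈ W) {u : V} (hu : u ∈ W)
    {i : ι} (hi : b.repr u i ≠ 0) : b i ∈ W := by
  classical
  cases nonempty_fintype ι
  have key : ∀ s : Finset ι, i ∉ s →
      ∃ u ∈ W, b.repr u i ≠ 0 ∧ ∀ j ∈ s, b.repr u j = 0 := by
    intro s
    induction s using Finset.induction_on with
    | empty => exact fun _ => ⟨u, hu, hi, by simp⟩
    | insert j s _ ih =>
      intro hij
      obtain ⟨u', hu', hi', hs⟩ := ih (by grind)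
      have hji : i ≠ j := by grind
      by_cases hα : α i = α j
      · have hβ : β i - β j ≠ 0 := sub_ne_zero.2 fun e => hji (hinj i j hα e)
        have hr : ∀ k, b.repr (T u' - β j • u') k = (β k - β j) * b.repr u' k := fun k => by
          rw [map_sub, map_smul, Finsupp.sub_apply, Finsupp.smul_apply, repr_apply_of_eigen hT,
            smul_eq_mul, sub_mul]
        refine ⟨T u' - β j • u', W.sub_mem (hWT _ hu') (W.smul_mem _ hu'), ?_, fun k hk => ?_⟩
        · rw [hr]; exact mul_ne_zero hβ hi'
        · rw [hr]
          rcases Finset.mem_insert.1 hk with rfl | hk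
          · rw [sub_self, zero_mul]
          · rw [hs k hk, mul_zero]
      · have hr : ∀ k, b.repr (S u' - α j • u') k = (α k - α j) * b.repr u' k := fun k => by
          rw [map_sub, map_smul, Finsupp.sub_apply, Finsupp.smul_apply, repr_apply_of_eigen hS,
            smul_eq_mul, sub_mul]
        refine ⟨S u' - α j • u', W.sub_mem (hWS _ hu') (W.smul_mem _ hu'), ?_, fun k hk => ?_⟩
        · rw [hr]; exact mul_ne_zero (sub_ne_zero.2 hα) hi'
        · rw [hr]
          rcases Finset.mem_insert.1 hk with rfl | hk
          · rw [sub_self, zero_mul]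
          · rw [hs k hk, mul_zero]
  obtain ⟨u', hu', hi', hs⟩ := key (Finset.univ.erase i) (by simp)
  have h1 : u' ∈ Submodule.span K {b i} :=
    mem_span_singleton_of_repr fun j hj => hs j (by simp [hj])
  obtain ⟨r, rfl⟩ := Submodule.mem_span_singleton.1 h1
  have hr : r ≠ 0 := fun h => hi' (by simp [h])
  exact (Submodule.smul_mem_iff _ hr).1 hu'

/-- Test a linear relation on three eigenvectors: the pair i, j with the same α isolates the
coefficient of T, and then i, k isolates that of S. -/
theorem finrank_span_pair (hS : ∀ i, S (b i) = α i • b i) (hT : ∀ i, T (b i) = β i • b i)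
    {i j k : ι} (hij : α i = α j) (hij' : β i ≠ β j) (hik : α i ≠ α k) :
    finrank K (Submodule.span K {S, T}) = 2 := by
  have hli : LinearIndependent K ![S, T] := by
    rw [LinearIndependent.pair_iff]
    intro x y h
    have hev : ∀ l, x * α l + y * β l = 0 := fun l => by
      have h1 := LinearMap.congr_fun h (b l)
      simp only [LinearMap.add_apply, LinearMap.smul_apply, hS, hT, smul_smul, ← add_smul,
        LinearMap.zero_apply] at h1
      exact (smul_eq_zero.1 h1).resolve_right (b.ne_zero l)
    have hy : y = 0 := by
      have h1 : y * (β i - β j) = 0 := by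
        linear_combination hev i - hev j - x * hij
      exact (mul_eq_zero.1 h1).resolve_right (sub_ne_zero.2 hij')
    refine ⟨?_, hy⟩
    have h1 : x * (α i - α k) = 0 := by
      linear_combination hev i - hev k - (β i - β k) * hy
    exact (mul_eq_zero.1 h1).resolve_right (sub_ne_zero.2 hik)
  have h1 := finrank_span_eq_card hli
  rw [Matrix.range_cons, Matrix.range_cons, Matrix.range_empty, Set.union_empty,
    Set.singleton_union] at h1
  simpa using h1

theorem exists_diagonal_bilinForm [Finite ι] [DecidableEq ι] (b : Basis ι K V) (F : ι → K)
    (hF : ∀ i, F i ≠ 0) : ∃ B : LinearMap.BilinForm K V,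
      (∀ i j, B (b i) (b j) = if i = j then F i else 0) ∧ B.IsSymm ∧ B.Nondegenerate := by
  cases nonempty_fintype ι
  have hB : ∀ i j, Matrix.toBilin b (Matrix.diagonal F) (b i) (b j) = if i = j then F i else 0 := by
    intro i j
    have h1 := LinearMap.BilinForm.toMatrix_apply b (Matrix.toBilin b (Matrix.diagonal F)) i j
    rw [← h1, LinearMap.BilinForm.toMatrix_toBilin, Matrix.diagonal_apply]
  refine ⟨Matrix.toBilin b (Matrix.diagonal F), hB, ?_, ?_⟩
  · rw [LinearMap.BilinForm.isSymm_iff_basis b]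
    intro i j
    rw [hB, hB]
    by_cases hij : i = j
    · simp [hij]
    · simp [hij, Ne.symm hij]
  · apply LinearMap.BilinForm.nondegenerate_of_det_ne_zero _ b
    rw [LinearMap.BilinForm.toMatrix_toBilin, Matrix.det_diagonal]
    exact Finset.prod_ne_zero_iff.2 fun i _ => hF i

theorem eigenspace_eq_span_of_eigen (hS : ∀ i, S (b i) = α i • b i) (μ : K) :
    End.eigenspace S μ = Submodule.span K (b '' {i | α i = μ}) := by
  apply le_antisymm
  · intro u hu
    rw [b.mem_span_image]
    intro i hi
    exact repr_ne_zero_of_mem_eigenspace hS hu (by simpa using hi)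
  · rw [Submodule.span_le]
    rintro _ ⟨i, hi, rfl⟩
    exact End.mem_eigenspace_iff.2 (by rw [hS, hi])

theorem exists_basis_of_top_le_span [Finite ι] (b : Basis ι K V) {m : ι → V}
    (hm : ⊤ ≤ Submodule.span K (Set.range m)) : ∃ b' : Basis ι K V, ∀ i, b' i = m i := by
  cases nonempty_fintype ι
  exact ⟨basisOfTopLeSpanOfCardEqFinrank m hm (finrank_eq_card_basis b).symm, fun i => by
    rw [coe_basisOfTopLeSpanOfCardEqFinrank]⟩

end JointEigenbasis

/-! ### Change of basis for a single parameter array -/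

namespace ParameterArray

open Finset

variable {K : Type*} [Field K] {V : Type*} [AddCommGroup V] [Module K V]

/-- The family `∑_x p_{xi} m_x`. -/
noncomputable def transform (P : ParameterArray K) (m : ℤ → V) (i : ℤ) : V :=
  ∑ x ∈ range (P.d + 1), P.p x i • m x

theorem transform_eq_zero (P : ParameterArray K) (m : ℤ → V) {i : ℤ} (hi : i < 0 ∨ P.d < i) :
    P.transform m i = 0 :=
  sum_eq_zero fun x _ => by rw [p_eq_zero_right _ hi, zero_smul]

/-- The recurrence of p in i, applied coefficient by coefficient, makes an operator diagonal on m
tridiagonal on its transform. -/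
theorem IsRegular.apply_transform {P : ParameterArray K} (h : P.IsRegular) {m : ℤ → V}
    {A : Module.End K V} (hA : ∀ x : ℕ, x ≤ P.d → A (m x) = P.θ x • m x) {i : ℕ} (hi : i ≤ P.d) :
    A (P.transform m i) = P.b (i - 1) • P.transform m (i - 1) + P.a i • P.transform m i
      + P.c (i + 1) • P.transform m (i + 1) := by
  simp only [transform, map_sum, smul_sum, ← sum_add_distrib]
  refine sum_congr rfl fun x hx => ?_
  have hx' : x ≤ P.d := by grind
  rw [map_smul, hA x hx', smul_smul, mul_comm, h.p_recurrence hx' hi]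
  module

namespace IsBiregular

variable {P : ParameterArray K}

theorem star_transform_transform (h : P.IsBiregular) {m : ℤ → V}
    (hm : ∀ x : ℤ, x < 0 ∨ P.d < x → m x = 0) (x : ℤ) :
    P.star.transform (P.transform m) x = P.ν • m x := by
  by_cases hx : x < 0 ∨ P.d < x
  · rw [hm x hx, smul_zero, transform_eq_zero P.star _ hx]
  · obtain ⟨n, rfl⟩ : ∃ n : ℕ, x = n := ⟨x.toNat, by omega⟩
    have hn : n ≤ P.d := by omega
    have h1 : P.star.transform (P.transform m) n = ∑ y ∈ range (P.d + 1),
        (∑ i ∈ range (P.d + 1), P.p y i * P.star.p i n) • m y := by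
      simp only [transform, smul_sum, sum_smul]
      rw [sum_comm]
      refine sum_congr rfl fun i _ => sum_congr rfl fun y _ => ?_
      rw [smul_smul, mul_comm]
    rw [h1, sum_eq_single_of_mem n (by grind)]
    · rw [h.sum_p_mul_star_p hn hn, if_pos rfl]
    · intro y hy hyn
      rw [h.sum_p_mul_star_p (by grind) hn, if_neg hyn, zero_smul]

theorem eq_smul_star_transform (h : P.IsBiregular) {m : ℤ → V}
    (hm : ∀ x : ℤ, x < 0 ∨ P.d < x → m x = 0) (x : ℤ) :
    m x = P.ν⁻¹ • P.star.transform (P.transform m) x := by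
  rw [h.star_transform_transform hm, smul_smul, inv_mul_cancel₀ h.ν_ne, one_smul]

/-- Converse direction: by the inversion, m is up to ν the transform of its own transform under the
dual array, so `apply_transform` for Φ* applies. -/
theorem apply_of_transform (h : P.IsBiregular) {m : ℤ → V}
    (hm : ∀ x : ℤ, x < 0 ∨ P.d < x → m x = 0) {A : Module.End K V}
    (hA : ∀ i : ℕ, i ≤ P.d → A (P.transform m i) = P.θs i • P.transform m i) {x : ℕ}
    (hx : x ≤ P.d) :
    A (m x) = P.star.b (x - 1) • m (x - 1) + P.star.a x • m x
      + P.star.c (x + 1) • m (x + 1) := by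
  have h1 := h.star.apply_transform (m := P.transform m) hA hx
  simp only [h.star_transform_transform hm, map_smul] at h1
  refine smul_right_injective V h.ν_ne ?_
  change P.ν • _ = P.ν • _
  rw [h1]
  module

theorem apply_eq_smul_of_transform (h : P.IsBiregular) {m : ℤ → V}
    (hm : ∀ x : ℤ, x < 0 ∨ P.d < x → m x = 0) {A : Module.End K V} {μ : K}
    (hA : ∀ i : ℕ, i ≤ P.d → A (P.transform m i) = μ • P.transform m i) (x : ℤ) :
    A (m x) = μ • m x := by
  rw [h.eq_smul_star_transform hm x, map_smul, smul_comm]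
  congr 1
  rw [transform, map_sum, smul_sum]
  refine sum_congr rfl fun i hi => ?_
  rw [map_smul, hA i (by simp [ParameterArray.star] at hi; omega), smul_comm]

/-- Norms proportional to k* turn into norms proportional to k, with orthogonality preserved. This
is used along Ψ_x to pass from v to w and along Φ_j to pass from w to vs. -/
theorem bilin_transform (h : P.IsBiregular) {m : ℤ → V} {B : LinearMap.BilinForm K V} {κ : K}
    (hB : ∀ x y : ℕ, x ≤ P.d → y ≤ P.d →
      B (m x) (m y) = if x = y then κ * P.star.k x else 0) {i j : ℕ} (hi : i ≤ P.d)
    (hj : j ≤ P.d) : B (P.transform m i) (P.transform m j) =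
      if i = j then κ * (P.k i * P.ν) else 0 := by
  have h1 : B (P.transform m i) (P.transform m j) =
      κ * ∑ x ∈ range (P.d + 1), P.star.k x * P.p x i * P.p x j := by
    simp only [transform, map_sum, LinearMap.sum_apply, map_smul, LinearMap.smul_apply,
      smul_eq_mul, mul_sum]
    refine sum_congr rfl fun x hx => ?_
    rw [sum_eq_single_of_mem x hx]
    · rw [hB x x (by grind) (by grind), if_pos rfl]
      ring
    · intro y hy hyx
      rw [hB _ _ (by grind) (by grind)]
      simp [hyx]
  rw [h1, h.sum_star_k_mul_p_mul_p hi hj]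
  split_ifs <;> simp

end IsBiregular

theorem bilin_transform_eq_zero {P Q : ParameterArray K} {m m' : ℤ → V}
    {B : LinearMap.BilinForm K V}
    (hB : ∀ x y : ℕ, x ≤ P.d → y ≤ Q.d → B (m x) (m' y) = 0) (i j : ℤ) :
    B (P.transform m i) (Q.transform m' j) = 0 := by
  simp only [transform, map_sum, LinearMap.sum_apply, map_smul, LinearMap.smul_apply]
  refine sum_eq_zero fun y hy => ?_
  rw [sum_eq_zero fun x hx => by rw [hB _ _ (by grind) (by grind), smul_zero], smul_zero]

/-- Pairing with the dual family q isolates each coefficient whose column index lies in range.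
Columns out of range are zero, so their coefficients are unconstrained, which is why uniqueness is
claimed only for targets inside the triangle. -/
theorem eq_zero_of_sum_mul_eq_zero {d : ℕ} {p : ℕ → ℤ → K} {q : ℕ → ℕ → K} {ν : K} (hν : ν ≠ 0)
    (hpq : ∀ i j : ℕ, i ≤ d → j ≤ d →
      ∑ x ∈ range (d + 1), q i x * p x j = if i = j then ν else 0)
    (hp : ∀ x i, i < 0 ∨ (d : ℤ) < i → p x i = 0) {s : Finset ℤ} {c : ℤ → K} {i : ℤ}
    (hs : ∀ x, x ≤ d → ∑ ε ∈ s, c ε * p x (i + ε) = 0) {ε : ℤ} (hε : ε ∈ s) (h0 : 0 ≤ i + ε)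
    (hd : i + ε ≤ d) : c ε = 0 := by
  obtain ⟨n, hn⟩ : ∃ n : ℕ, i + ε = n := ⟨(i + ε).toNat, by omega⟩
  have hnd : n ≤ d := by omega
  have h1 : ∑ x ∈ range (d + 1), q n x * ∑ ε ∈ s, c ε * p x (i + ε) = 0 :=
    sum_eq_zero fun x hx => by rw [hs x (by grind), mul_zero]
  have h2 : ∑ x ∈ range (d + 1), q n x * ∑ ε ∈ s, c ε * p x (i + ε) =
      ∑ ε' ∈ s, c ε' * ∑ x ∈ range (d + 1), q n x * p x (i + ε') := by
    simp only [mul_sum]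
    rw [sum_comm]
    exact sum_congr rfl fun _ _ => sum_congr rfl fun _ _ => by ring
  rw [h2, sum_eq_single_of_mem ε hε] at h1
  · rw [hn, hpq n n hnd hnd, if_pos rfl] at h1
    exact (mul_eq_zero.1 h1).resolve_right hν
  · intro ε' _ hne
    by_cases hout : i + ε' < 0 ∨ (d : ℤ) < i + ε'
    · rw [sum_eq_zero fun x _ => by rw [hp x _ hout, mul_zero], mul_zero]
    · obtain ⟨l, hl⟩ : ∃ l : ℕ, i + ε' = l := ⟨(i + ε').toNat, by omega⟩
      rw [hl, hpq n l hnd (by omega), if_neg (by omega), mul_zero]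

end ParameterArray

/-! ### Triangular systems of arrays -/

/-- Families of parameter arrays `Φ_j` and `Ψ_x` of diameters `N - j` and `N - x` with common
eigenvalues `t` and common dual eigenvalues `θ*`, respectively. -/
structure IsTriangular {K : Type*} [Field K] (N : ℕ) (t θs : ℕ → K)
    (Φ Ψ : ℕ → ParameterArray K) : Prop where
  Φ_d : ∀ j, (Φ j).d = N - j
  Ψ_d : ∀ x, (Ψ x).d = N - x
  Φ_θ : ∀ j, (Φ j).θ = t
  Ψ_θs : ∀ x, (Ψ x).θs = θs
  Φ_reg : ∀ j ≤ N, (Φ j).IsBiregular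
  Ψ_reg : ∀ x ≤ N, (Ψ x).IsBiregular

namespace IsTriangular

open Finset

variable {K : Type*} [Field K] {N : ℕ} {t θs : ℕ → K} {Φ Ψ : ℕ → ParameterArray K}

theorem t_inj (h : IsTriangular N t θs Φ Ψ) {x y : ℕ} (hx : x ≤ N) (hy : y ≤ N)
    (hxy : t x = t y) : x = y := by
  have h1 := (h.Φ_reg 0 (Nat.zero_le _)).θ_inj x y
  rw [h.Φ_θ, h.Φ_d] at h1
  exact h1 hx hy hxy

theorem θs_inj (h : IsTriangular N t θs Φ Ψ) {i j : ℕ} (hi : i ≤ N) (hj : j ≤ N)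
    (hij : θs i = θs j) : i = j := by
  have h1 := (h.Ψ_reg 0 (Nat.zero_le _)).reg.θs_inj i j
  rw [h.Ψ_θs, h.Ψ_d] at h1
  exact h1 hi hj hij

theorem coeffsAgree₁ (h : IsTriangular N t θs Φ Ψ) {C C' : ℤ → ℤ → ℕ → ℕ → K}
    (hC : SatisfiesCons1 N Φ Ψ C) (hC' : SatisfiesCons1 N Φ Ψ C') : CoeffsAgree N C' C := by
  have key : ∀ {l : ℕ}, l ≤ N → ∀ {s : Finset ℤ} {c : ℤ → K} {i : ℤ},
      (∀ x : ℕ, x ≤ N - l → ∑ ε ∈ s, c ε * (Φ l).p x (i + ε) = 0) →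
      ∀ {ε : ℤ}, ε ∈ s → 0 ≤ i + ε → i + ε ≤ (N - l : ℕ) → c ε = 0 := by
    intro l hl s c i hs ε hε h0 hd
    have hreg := h.Φ_reg l hl
    refine ParameterArray.eq_zero_of_sum_mul_eq_zero (d := N - l) (p := fun x i => (Φ l).p x i)
      (q := fun i x => (Φ l).star.p i x) hreg.ν_ne ?_ ?_ hs hε h0 hd
    · intro i j hi hj
      rw [← h.Φ_d] at *
      exact hreg.sum_star_p_mul_p hi hj
    · intro x i hi
      rw [← h.Φ_d] at hi
      exact (Φ l).p_eq_zero_right hi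
  rintro i j hij ⟨ε, ε'⟩ he h0 h1 h2
  simp only [A2, mem_insert, mem_singleton, Prod.mk.injEq] at he
  dsimp only at h0 h1 h2 ⊢
  rw [← sub_eq_zero]
  have hcases : ε' = 1 ∧ ε ∈ ({-1, 0} : Finset ℤ) ∨ ε' = 0 ∧ ε ∈ ({-1, 0, 1} : Finset ℤ) ∨
      ε' = -1 ∧ ε ∈ ({0, 1} : Finset ℤ) := by
    simp only [mem_insert, mem_singleton]; omega
  rcases hcases with ⟨rfl, hε⟩ | ⟨rfl, hε⟩ | ⟨rfl, hε⟩
  · refine key (l := j + 1) (by omega) (c := fun ε => C' ε 1 i j - C ε 1 i j) (i := i) ?_ hε h0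
      (by omega)
    intro x hx
    simp only [sub_mul, sum_sub_distrib]
    rw [← hC.plus i j x hij (by omega), ← hC'.plus i j x hij (by omega), sub_self]
  · refine key (l := j) (by omega) (c := fun ε => C' ε 0 i j - C ε 0 i j) (i := i) ?_ hε h0
      (by omega)
    intro x hx
    simp only [sub_mul, sum_sub_distrib]
    rw [← hC.zero i j x hij (by omega), ← hC'.zero i j x hij (by omega), sub_self]
  · refine key (l := j - 1) (by omega) (c := fun ε => C' ε (-1) i j - C ε (-1) i j) (i := i) ?_ hε
      h0 (by omega)
    intro x hx
    simp only [sub_mul, sum_sub_distrib]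
    rw [← hC.minus i j x hij (by omega) (by omega), ← hC'.minus i j x hij (by omega) (by omega),
      sub_self]

theorem coeffsAgree₂ (h : IsTriangular N t θs Φ Ψ) {D D' : ℤ → ℤ → ℕ → ℕ → K}
    (hD : SatisfiesCons2 N Φ Ψ D) (hD' : SatisfiesCons2 N Φ Ψ D') : CoeffsAgree N D' D := by
  -- The factor r absorbs the nonzero ratios of ν in requirement (2).
  have key : ∀ {l : ℕ}, l ≤ N → ∀ {s : Finset ℤ} {c : ℤ → K} {i : ℤ} {r : K}, r ≠ 0 →
      (∀ j : ℕ, j ≤ N - l → r * ∑ ε ∈ s, c ε * (Ψ l).star.p j (i + ε) = 0) →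
      ∀ {ε : ℤ}, ε ∈ s → 0 ≤ i + ε → i + ε ≤ (N - l : ℕ) → c ε = 0 := by
    intro l hl s c i r hr hs ε hε h0 hd
    have hreg := h.Ψ_reg l hl
    refine ParameterArray.eq_zero_of_sum_mul_eq_zero (d := N - l)
      (p := fun x i => (Ψ l).star.p x i) (q := fun i x => (Ψ l).p i x) hreg.ν_ne ?_ ?_
      (fun j hj => (mul_eq_zero.1 (hs j hj)).resolve_left hr) hε h0 hd
    · intro i j hi hj
      rw [← h.Ψ_d] at *
      exact hreg.sum_p_mul_star_p hi hj
    · intro x i hi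
      rw [← h.Ψ_d] at hi
      exact (Ψ l).star.p_eq_zero_right hi
  have hν : ∀ x y, x ≤ N → y ≤ N → (Ψ x).ν / (Ψ y).ν ≠ 0 := fun x y hx hy =>
    div_ne_zero (h.Ψ_reg x hx).ν_ne (h.Ψ_reg y hy).ν_ne
  rintro x y hxy ⟨ε', ε⟩ he h0 h1 h2
  simp only [A2, mem_insert, mem_singleton, Prod.mk.injEq] at he
  dsimp only at h0 h1 h2 ⊢
  rw [← sub_eq_zero]
  have hcases : ε' = 1 ∧ ε ∈ ({-1, 0} : Finset ℤ) ∨ ε' = 0 ∧ ε ∈ ({-1, 0, 1} : Finset ℤ) ∨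
      ε' = -1 ∧ ε ∈ ({0, 1} : Finset ℤ) := by
    simp only [mem_insert, mem_singleton]; omega
  rcases hcases with ⟨rfl, hε⟩ | ⟨rfl, hε⟩ | ⟨rfl, hε⟩
  · refine key (l := x + 1) (by omega) (c := fun ε => D' 1 ε x y - D 1 ε x y) (i := y)
      (hν x (x + 1) (by omega) (by omega)) ?_ hε h1 (by omega)
    intro j hj
    simp only [sub_mul, sum_sub_distrib, mul_sub]
    rw [← hD.plus x y j hxy (by omega), ← hD'.plus x y j hxy (by omega), sub_self]
  · refine key (l := x) (by omega) (c := fun ε => D' 0 ε x y - D 0 ε x y) (i := y)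
      one_ne_zero ?_ hε h1 (by omega)
    intro j hj
    simp only [sub_mul, sum_sub_distrib, one_mul]
    rw [← hD.zero x y j hxy (by omega), ← hD'.zero x y j hxy (by omega), sub_self]
  · refine key (l := x - 1) (by omega) (c := fun ε => D' (-1) ε x y - D (-1) ε x y) (i := y)
      (hν x (x - 1) (by omega) (by omega)) ?_ hε h1 (by omega)
    intro j hj
    simp only [sub_mul, sum_sub_distrib, mul_sub]
    rw [← hD.minus x y j hxy (by omega) (by omega), ← hD'.minus x y j hxy (by omega) (by omega),
      sub_self]

end IsTriangular

/-! ### Three families of vectors indexed by the triangle -/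

section Triangle

variable {N : ℕ} {V : Type*}

instance (N : ℕ) : Finite (TriDom N) :=
  Finite.of_injective (β := Fin (N + 1) × Fin (N + 1))
    (fun l => (⟨l.1.1, by have := l.2; omega⟩, ⟨l.1.2, by have := l.2; omega⟩)) fun l m h => by
      simp only [Prod.mk.injEq, Fin.mk.injEq] at h
      exact Subtype.ext (Prod.ext h.1 h.2)

/-- The family `m` vanishes outside of the triangle `𝒟`. -/
def VanishesOff [Zero V] (N : ℕ) (m : ℤ → ℤ → V) : Prop :=
  ∀ x y : ℤ, x < 0 ∨ y < 0 ∨ N < x + y → m x y = 0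

theorem vanishesOff_vecAt [Zero V] (b : TriDom N → V) : VanishesOff N (vecAt b) :=
  fun x y h => dif_neg (by omega)

theorem vecAt_natCast [Zero V] (b : TriDom N → V) (l : TriDom N) : vecAt b l.1.1 l.1.2 = b l := by
  have := l.2
  rw [vecAt, dif_pos (by omega)]
  rfl

theorem VanishesOff.vecAt_eq [Zero V] {m : ℤ → ℤ → V} (hm : VanishesOff N m) {b : TriDom N → V}
    (hb : ∀ l, b l = m l.1.1 l.1.2) : vecAt b = m := by
  ext x y
  rw [vecAt]
  split_ifs with h
  · rw [hb]
    congr 1 <;> simp only <;> omega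
  · rw [hm x y (by omega)]

theorem sum_A2 {M : Type*} [AddCommMonoid M] (f : ℤ × ℤ → M) : ∑ e ∈ A2, f e =
    (f (0, -1) + f (1, -1)) + (f (-1, 0) + f (0, 0) + f (1, 0)) + (f (-1, 1) + f (0, 1)) := by
  rw [A2, Finset.sum_insert (by decide), Finset.sum_insert (by decide),
    Finset.sum_insert (by decide), Finset.sum_insert (by decide), Finset.sum_insert (by decide),
    Finset.sum_insert (by decide), Finset.sum_singleton]
  abel

theorem sum_A2' {M : Type*} [AddCommMonoid M] (f : ℤ × ℤ → M) : ∑ e ∈ A2, f e =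
    (f (-1, 0) + f (-1, 1)) + (f (0, -1) + f (0, 0) + f (0, 1)) + (f (1, -1) + f (1, 0)) := by
  rw [sum_A2]
  abel

end Triangle

open Finset

/-! ### The three families v, w, vs and the operators on them -/

section TriangularModel

variable {K : Type*} [Field K] {V : Type*} [AddCommGroup V] [Module K V]
  {N : ℕ} {t θs : ℕ → K} {Φ Ψ : ℕ → ParameterArray K}

/-- Families `v`, `w`, `vs` related by the changes of basis of the arrays `Ψ_x` and `Φ_j`. -/
structure IsTriangularFamily (N : ℕ) (t θs : ℕ → K) (Φ Ψ : ℕ → ParameterArray K)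
    (v w vs : ℤ → ℤ → V) : Prop where
  tri : IsTriangular N t θs Φ Ψ
  off_v : VanishesOff N v
  off_w : VanishesOff N w
  off_vs : VanishesOff N vs
  w_eq : ∀ x : ℕ, x ≤ N → ∀ j : ℤ, w x j = (Ψ x).transform (v x) j
  vs_eq : ∀ j : ℕ, j ≤ N → ∀ i : ℤ, vs i j = (Φ j).transform (fun x => w x j) i

namespace IsTriangularFamily

variable {v w vs : ℤ → ℤ → V}

theorem v_zero (h : IsTriangularFamily N t θs Φ Ψ v w vs) {x : ℕ} (hx : x ≤ N) {y : ℤ}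
    (hy : y < 0 ∨ (Ψ x).d < y) : v x y = 0 := by
  rw [h.tri.Ψ_d] at hy
  exact h.off_v _ _ (by omega)

theorem w_zero (h : IsTriangularFamily N t θs Φ Ψ v w vs) {j : ℕ} (hj : j ≤ N) {x : ℤ}
    (hx : x < 0 ∨ (Φ j).d < x) : w x j = 0 := by
  rw [h.tri.Φ_d] at hx
  exact h.off_w _ _ (by omega)

/-- The range of summation does not depend on n, so expansions for different n can be added term by
term; the extra coefficients are zero. The separate integer j admits indices written as j + 1 or j +
−1. -/
theorem vs_eq_sum (h : IsTriangularFamily N t θs Φ Ψ v w vs) {n : ℕ} (hn : n ≤ N) {j : ℤ}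
    (hj : j = n) (i : ℤ) : vs i j = ∑ x ∈ range (N + 1), (Φ n).p x i • w x j := by
  subst hj
  rw [h.vs_eq n hn, ParameterArray.transform, h.tri.Φ_d]
  refine sum_subset (by grind) fun x _ hx => ?_
  rw [ParameterArray.p_eq_zero_left, zero_smul]
  rw [h.tri.Φ_d]
  simp only [mem_range] at hx
  omega

theorem v_eq_sum (h : IsTriangularFamily N t θs Φ Ψ v w vs) {n : ℕ} (hn : n ≤ N) {x : ℤ}
    (hx : x = n) (y : ℤ) :
    v x y = (Ψ n).ν⁻¹ • ∑ j ∈ range (N + 1), (Ψ n).star.p j y • w x j := by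
  subst hx
  rw [(h.tri.Ψ_reg n hn).eq_smul_star_transform (fun y hy => h.v_zero hn hy),
    ParameterArray.transform, show (Ψ n).star.d = N - n from h.tri.Ψ_d n]
  simp only [← h.w_eq n hn]
  congr 1
  refine sum_subset (by grind) fun j _ hj => ?_
  rw [ParameterArray.p_eq_zero_left, zero_smul]
  rw [show (Ψ n).star.d = N - n from h.tri.Ψ_d n]
  simp only [mem_range] at hj
  omega

theorem w_eq_sum (h : IsTriangularFamily N t θs Φ Ψ v w vs) {j : ℕ} (hj : j ≤ N) (x : ℤ) :
    w x j = (Φ j).ν⁻¹ • ∑ i ∈ range (N + 1), (Φ j).star.p i x • vs i j := by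
  rw [(h.tri.Φ_reg j hj).eq_smul_star_transform (m := fun x => w x j)
    (fun x hx => h.w_zero hj hx),
    ParameterArray.transform, show (Φ j).star.d = N - j from h.tri.Φ_d j]
  simp only [← h.vs_eq j hj]
  congr 1
  refine sum_subset (by grind) fun i _ hi => ?_
  rw [ParameterArray.p_eq_zero_left, zero_smul]
  rw [show (Φ j).star.d = N - j from h.tri.Φ_d j]
  simp only [mem_range] at hi
  omega

theorem mem_span_range {m : ℤ → ℤ → V} (hm : VanishesOff N m) (x y : ℤ) :
    m x y ∈ Submodule.span K (Set.range fun l : TriDom N => m l.1.1 l.1.2) := by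
  by_cases hxy : x < 0 ∨ y < 0 ∨ N < x + y
  · rw [hm x y hxy]
    exact Submodule.zero_mem _
  · refine Submodule.subset_span ⟨⟨(x.toNat, y.toNat), by dsimp only; omega⟩, ?_⟩
    change m (x.toNat : ℤ) (y.toNat : ℤ) = m x y
    rw [Int.toNat_of_nonneg (by omega), Int.toNat_of_nonneg (by omega)]

theorem exists_bases (h : IsTriangularFamily N t θs Φ Ψ v w vs)
    (bv : Module.Basis (TriDom N) K V) (hbv : ∀ l, bv l = v l.1.1 l.1.2) :
    ∃ bw bvs : Module.Basis (TriDom N) K V,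
      (∀ l, bw l = w l.1.1 l.1.2) ∧ ∀ l, bvs l = vs l.1.1 l.1.2 := by
  obtain ⟨bw, hbw⟩ := exists_basis_of_top_le_span bv
    (m := fun l : TriDom N => w l.1.1 l.1.2) (by
      rw [← bv.span_eq, Submodule.span_le]
      rintro _ ⟨l, rfl⟩
      have := l.2
      rw [hbv, h.v_eq_sum (show l.1.1 ≤ N by omega) rfl]
      exact Submodule.smul_mem _ _ (Submodule.sum_mem _ fun j _ => Submodule.smul_mem _ _
        (mem_span_range h.off_w _ _)))
  obtain ⟨bvs, hbvs⟩ := exists_basis_of_top_le_span bv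
    (m := fun l : TriDom N => vs l.1.1 l.1.2) (by
      rw [← bw.span_eq, Submodule.span_le]
      rintro _ ⟨l, rfl⟩
      have := l.2
      rw [hbw, h.w_eq_sum (show l.1.2 ≤ N by omega)]
      exact Submodule.smul_mem _ _ (Submodule.sum_mem _ fun j _ => Submodule.smul_mem _ _
        (mem_span_range h.off_vs _ _)))
  exact ⟨bw, bvs, hbw, hbvs⟩

/-- If `F` satisfies the condition relating `F` and `G`, the form with orthogonal basis `v_{x,y}` of
norms `F(x, y)` also has `vs_{i,j}` as an orthogonal basis. -/
theorem bilin_vs (h : IsTriangularFamily N t θs Φ Ψ v w vs) {F G : ℕ → ℕ → K}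
    (hFG : SatisfiesFG N Φ Ψ F G) {B : LinearMap.BilinForm K V}
    (hB : ∀ x y x' y' : ℕ, x + y ≤ N → x' + y' ≤ N →
      B (v x y) (v x' y') = if x = x' ∧ y = y' then F x y else 0) :
    ∀ i j i' j' : ℕ, i + j ≤ N → i' + j' ≤ N →
      B (vs i j) (vs i' j') = if i = i' ∧ j = j' then G 0 j * (Φ j).k i else 0 := by
  -- The right side of (3) does not involve y. Comparing y with 0 at i = j = 0 shows that, for fixed
  -- x, F is proportional to k(Ψ_x*), as `bilin_transform` needs.
  have hF : ∀ x y : ℕ, x + y ≤ N → F x y = F x 0 * (Ψ x).star.k y := by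
    intro x y hxy
    have hΨ := h.tri.Ψ_reg x (by omega)
    have hΦ := h.tri.Φ_reg 0 (by omega)
    have hky := hΨ.star.k_ne (i := y) (by
      rw [show (Ψ x).star.d = N - x from h.tri.Ψ_d x]; omega)
    have hkx := hΦ.star.k_ne (i := x) (by
      rw [show (Φ 0).star.d = N - 0 from h.tri.Φ_d 0]; omega)
    have h1 := hFG.2 x y 0 0 hxy (by omega) (by omega)
    have h2 := hFG.2 x 0 0 0 (by omega) (by omega) (by omega)
    rw [← h2, hΦ.reg.k_zero, hΨ.reg.k_zero, hΨ.star.k_zero] at h1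
    field_simp at h1
    linear_combination h1
  -- After the first transform the norm of w_{x,j} is F(x,0) k_j(Ψ_x) ν(Ψ_x). Requirement (3) with i
  -- = y = 0 rewrites it as a multiple of k_x(Φ_j*), the shape needed for the second transform.
  have hw : ∀ x x' j j' : ℕ, x + j ≤ N → x' + j' ≤ N →
      B (w x j) (w x' j') = if x = x' ∧ j = j' then G 0 j / (Φ j).ν * (Φ j).star.k x else 0 := by
    intro x x' j j' hxj hxj'
    rw [h.w_eq x (by omega), h.w_eq x' (by omega)]
    by_cases hx : x = x'
    · subst hx
      have hΨ := h.tri.Ψ_reg x (by omega)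
      rw [hΨ.bilin_transform (κ := F x 0) ?_ (by rw [h.tri.Ψ_d]; omega)
        (by rw [h.tri.Ψ_d]; omega)]
      · simp only [true_and]
        split_ifs with hj
        · have hΦ := h.tri.Φ_reg j (by omega)
          have h1 := hFG.2 x 0 0 j (by omega) (by omega) hxj
          have hkx := hΦ.star.k_ne (i := x) (by
            rw [show (Φ j).star.d = N - j from h.tri.Φ_d j]; omega)
          have hν := hΨ.ν_ne
          have hν' := hΦ.ν_ne
          rw [hΦ.reg.k_zero, hΨ.star.k_zero] at h1
          field_simp at h1 ⊢
          linear_combination h1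
        · rfl
      · intro y y' hy hy'
        rw [h.tri.Ψ_d] at hy hy'
        rw [hB x y x y' (by omega) (by omega), hF x y (by omega)]
        simp
    · rw [ParameterArray.bilin_transform_eq_zero, if_neg (by tauto)]
      intro y y' hy hy'
      rw [h.tri.Ψ_d] at hy hy'
      rw [hB x y x' y' (by omega) (by omega), if_neg (by tauto)]
  intro i j i' j' hij hij'
  rw [h.vs_eq j (by omega), h.vs_eq j' (by omega)]
  by_cases hj : j = j'
  · subst hj
    have hΦ := h.tri.Φ_reg j (by omega)
    rw [hΦ.bilin_transform (κ := G 0 j / (Φ j).ν) ?_ (by rw [h.tri.Φ_d]; omega)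
      (by rw [h.tri.Φ_d]; omega)]
    · have hν := hΦ.ν_ne
      simp only [and_true]
      split_ifs
      · field_simp
      · rfl
    · intro x x' hx hx'
      rw [h.tri.Φ_d] at hx hx'
      rw [hw x x' j j (by omega) (by omega)]
      simp
  · rw [ParameterArray.bilin_transform_eq_zero, if_neg (by tauto)]
    intro x x' hx hx'
    rw [h.tri.Φ_d] at hx hx'
    rw [hw x x' j j' (by omega) (by omega), if_neg (by tauto)]

theorem G_ne (h : IsTriangularFamily N t θs Φ Ψ v w vs) {F G : ℕ → ℕ → K}
    (hFG : SatisfiesFG N Φ Ψ F G) {j : ℕ} (hj : j ≤ N) : G 0 j ≠ 0 := by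
  have h1 := hFG.2 0 0 0 j (by omega) (by omega) (by omega)
  have hΦ := h.tri.Φ_reg j hj
  have hΨ := h.tri.Ψ_reg 0 (by omega)
  intro hz
  rw [hz, zero_div, hΦ.reg.k_zero, hΦ.star.k_zero, hΨ.star.k_zero] at h1
  refine mul_ne_zero (hΨ.reg.k_ne (i := j) ?_) (hFG.1 0 0 (by omega)) (by simpa using h1)
  rw [h.tri.Ψ_d]
  omega

end IsTriangularFamily

/-- Operators `X`, `Y` diagonal on the family `v` and `X*`, `Y*` diagonal on the family `vs`. -/
structure IsTriangularModel (N : ℕ) (t θs : ℕ → K) (Φ Ψ : ℕ → ParameterArray K)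
    (v w vs : ℤ → ℤ → V) (X Y Xs Ys : Module.End K V) : Prop
    extends IsTriangularFamily N t θs Φ Ψ v w vs where
  X_v : ∀ x y : ℕ, x + y ≤ N → X (v x y) = t x • v x y
  Y_v : ∀ x y : ℕ, x + y ≤ N → Y (v x y) = (Ψ x).θ y • v x y
  Xs_vs : ∀ i j : ℕ, i + j ≤ N → Xs (vs i j) = (Φ j).θs i • vs i j
  Ys_vs : ∀ i j : ℕ, i + j ≤ N → Ys (vs i j) = θs j • vs i j

namespace IsTriangularModel

variable {v w vs : ℤ → ℤ → V} {X Y Xs Ys : Module.End K V}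

theorem X_w (h : IsTriangularModel N t θs Φ Ψ v w vs X Y Xs Ys) {x : ℕ} (hx : x ≤ N) (j : ℤ) :
    X (w x j) = t x • w x j := by
  rw [h.w_eq x hx, ParameterArray.transform, map_sum, smul_sum]
  refine sum_congr rfl fun y hy => ?_
  rw [h.tri.Ψ_d] at hy
  rw [map_smul, h.X_v x y (by grind), smul_comm]

theorem Ys_w (h : IsTriangularModel N t θs Φ Ψ v w vs X Y Xs Ys) {j : ℕ} (hj : j ≤ N) (x : ℤ) :
    Ys (w x j) = θs j • w x j := by
  refine (h.tri.Φ_reg j hj).apply_eq_smul_of_transform (m := fun x => w x j)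
    (fun x hx => h.w_zero hj hx) ?_ x
  intro i hi
  rw [h.tri.Φ_d] at hi
  rw [← h.vs_eq j hj, h.Ys_vs i j (by omega)]

theorem Y_w (h : IsTriangularModel N t θs Φ Ψ v w vs X Y Xs Ys) {x j : ℕ} (hxj : x + j ≤ N) :
    Y (w x j) = (Ψ x).b (j - 1) • w x (j - 1) + (Ψ x).a j • w x j
      + (Ψ x).c (j + 1) • w x (j + 1) := by
  have hx : x ≤ N := by omega
  simp only [h.w_eq x hx]
  refine (h.tri.Ψ_reg x hx).reg.apply_transform ?_ (by rw [h.tri.Ψ_d]; omega)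
  intro y hy
  rw [h.tri.Ψ_d] at hy
  exact h.Y_v x y (by omega)

theorem Xs_w (h : IsTriangularModel N t θs Φ Ψ v w vs X Y Xs Ys) {x j : ℕ} (hxj : x + j ≤ N) :
    Xs (w x j) = (Φ j).star.b (x - 1) • w (x - 1) j + (Φ j).star.a x • w x j
      + (Φ j).star.c (x + 1) • w (x + 1) j := by
  have hj : j ≤ N := by omega
  refine (h.tri.Φ_reg j hj).apply_of_transform (m := fun x => w x j)
    (fun x hx => h.w_zero hj hx) ?_ (by rw [h.tri.Φ_d]; omega)
  intro i hi
  rw [h.tri.Φ_d] at hi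
  rw [← h.vs_eq j hj, h.Xs_vs i j (by omega)]

theorem X_vs (h : IsTriangularModel N t θs Φ Ψ v w vs X Y Xs Ys) {i j : ℕ} (hij : i + j ≤ N) :
    X (vs i j) = (Φ j).b (i - 1) • vs (i - 1) j + (Φ j).a i • vs i j
      + (Φ j).c (i + 1) • vs (i + 1) j := by
  have hj : j ≤ N := by omega
  simp only [h.vs_eq j hj]
  refine (h.tri.Φ_reg j hj).reg.apply_transform ?_ (by rw [h.tri.Φ_d]; omega)
  intro x hx
  rw [h.tri.Φ_d] at hx
  rw [h.tri.Φ_θ]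
  exact h.X_w (by omega) j

theorem Ys_v (h : IsTriangularModel N t θs Φ Ψ v w vs X Y Xs Ys) {x y : ℕ} (hxy : x + y ≤ N) :
    Ys (v x y) = (Ψ x).star.b (y - 1) • v x (y - 1) + (Ψ x).star.a y • v x y
      + (Ψ x).star.c (y + 1) • v x (y + 1) := by
  have hx : x ≤ N := by omega
  refine (h.tri.Ψ_reg x hx).apply_of_transform (m := v x)
    (fun y hy => h.v_zero hx hy) ?_ (by rw [h.tri.Ψ_d]; omega)
  intro j hj
  rw [h.tri.Ψ_d] at hj
  rw [← h.w_eq x hx, h.tri.Ψ_θs, h.Ys_w (by omega)]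

/-- Expanding vs_{i,j} in the w_{x,j} and applying Y gives three sums, at levels j − 1, j and j + 1,
with coefficients b, a, c of Ψ_x times p_{xi}(Φ_j). Requirement (1) rewrites each as a combination
of columns of p at that level, hence as a combination of vs. -/
theorem Y_vs (h : IsTriangularModel N t θs Φ Ψ v w vs X Y Xs Ys) {C : ℤ → ℤ → ℕ → ℕ → K}
    (hC : SatisfiesCons1 N Φ Ψ C) {i j : ℕ} (hij : i + j ≤ N) :
    Y (vs i j) = ∑ e ∈ A2, C e.1 e.2 i j • vs (i + e.1) (j + e.2) := by
  have hminus : C 0 (-1) i j • vs (i + 0) (j + -1) + C 1 (-1) i j • vs (i + 1) (j + -1) =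
      ∑ x ∈ range (N + 1), ((Φ j).p x i * (Ψ x).b (j - 1)) • w x (j + -1) := by
    by_cases hj : 1 ≤ j
    · simp only [h.vs_eq_sum (show j - 1 ≤ N by omega) (show (j : ℤ) + -1 = (j - 1 : ℕ) by omega),
        smul_sum, ← sum_add_distrib]
      refine sum_congr rfl fun x _ => ?_
      by_cases hx : x + (j - 1) ≤ N
      · have h1 := hC.minus i j x hij hj hx
        rw [sum_pair (by decide)] at h1
        rw [mul_comm ((Φ j).p x i), h1]
        module
      · rw [h.off_w x (j + -1) (by omega)]
        simp
    · have h0 : ∀ x : ℤ, w x ((j : ℤ) + -1) = 0 := fun x => h.off_w _ _ (by omega)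
      have h1 : ∀ i : ℤ, vs i ((j : ℤ) + -1) = 0 := fun i => h.off_vs _ _ (by omega)
      simp only [h0, h1, smul_zero, sum_const_zero, add_zero]
  have hzero : C (-1) 0 i j • vs (i + -1) (j + 0) + C 0 0 i j • vs (i + 0) (j + 0)
      + C 1 0 i j • vs (i + 1) (j + 0) =
      ∑ x ∈ range (N + 1), ((Φ j).p x i * (Ψ x).a j) • w x (j + 0) := by
    simp only [h.vs_eq_sum (show j ≤ N by omega) (show (j : ℤ) + 0 = (j : ℕ) by omega),
        smul_sum, ← sum_add_distrib]
    refine sum_congr rfl fun x _ => ?_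
    by_cases hx : x + j ≤ N
    · have h1 := hC.zero i j x hij hx
      rw [sum_insert (by decide), sum_pair (by decide)] at h1
      rw [mul_comm ((Φ j).p x i), h1]
      module
    · rw [h.off_w x (j + 0) (by omega)]
      simp
  have hplus : C (-1) 1 i j • vs (i + -1) (j + 1) + C 0 1 i j • vs (i + 0) (j + 1) =
      ∑ x ∈ range (N + 1), ((Φ j).p x i * (Ψ x).c (j + 1)) • w x (j + 1) := by
    by_cases hj : j + 1 ≤ N
    · simp only [h.vs_eq_sum hj (show (j : ℤ) + 1 = (j + 1 : ℕ) by omega),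
        smul_sum, ← sum_add_distrib]
      refine sum_congr rfl fun x _ => ?_
      by_cases hx : x + (j + 1) ≤ N
      · have h1 := hC.plus i j x hij hx
        rw [sum_pair (by decide)] at h1
        rw [mul_comm ((Φ j).p x i), h1]
        module
      · rw [h.off_w x (j + 1) (by omega)]
        simp
    · have h0 : ∀ x : ℤ, w x ((j : ℤ) + 1) = 0 := fun x => h.off_w _ _ (by omega)
      have h1 : ∀ i : ℤ, vs i ((j : ℤ) + 1) = 0 := fun i => h.off_vs _ _ (by omega)
      simp only [h0, h1, smul_zero, sum_const_zero, add_zero]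
  rw [sum_A2, hminus, hzero, hplus, h.vs_eq_sum (show j ≤ N by omega) rfl, map_sum,
    ← sum_add_distrib, ← sum_add_distrib]
  refine sum_congr rfl fun x _ => ?_
  rw [map_smul]
  by_cases hx : x + j ≤ N
  · rw [h.Y_w hx, add_zero, ← sub_eq_add_neg]
    module
  · rw [ParameterArray.p_eq_zero_left _ (by rw [h.tri.Φ_d]; omega)]
    simp

/-- The mirror image of `Y_vs`, with the inverse expansion of v in w. That expansion carries the
factor 1/ν(Ψ_x), and the ratios of ν in requirement (2) replace it by 1/ν(Ψ_{x±1}), as needed for v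
at x ± 1. -/
theorem Xs_v (h : IsTriangularModel N t θs Φ Ψ v w vs X Y Xs Ys) {D : ℤ → ℤ → ℕ → ℕ → K}
    (hD : SatisfiesCons2 N Φ Ψ D) {x y : ℕ} (hxy : x + y ≤ N) :
    Xs (v x y) = ∑ e ∈ A2, D e.1 e.2 x y • v (x + e.1) (y + e.2) := by
  have hν : ∀ n, n ≤ N → (Ψ n).ν ≠ 0 := fun n hn => (h.tri.Ψ_reg n hn).ν_ne
  have hνx := hν x (by omega)
  have hminus : D (-1) 0 x y • v (x + -1) (y + 0) + D (-1) 1 x y • v (x + -1) (y + 1) =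
      ∑ j ∈ range (N + 1),
        ((Ψ x).ν⁻¹ * ((Ψ x).star.p j y * (Φ j).star.b (x - 1))) • w (x + -1) j := by
    by_cases hx : 1 ≤ x
    · simp only [h.v_eq_sum (show x - 1 ≤ N by omega) (show (x : ℤ) + -1 = (x - 1 : ℕ) by omega),
        smul_sum, ← sum_add_distrib]
      refine sum_congr rfl fun j _ => ?_
      by_cases hj : (x - 1) + j ≤ N
      · have h1 := hD.minus x y j hxy hx hj
        have h2 := hν (x - 1) (by omega)
        rw [sum_pair (by decide)] at h1
        rw [mul_comm ((Ψ x).star.p j y), h1, div_eq_mul_inv]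
        simp only [← mul_assoc, inv_mul_cancel₀ hνx, one_mul]
        module
      · rw [h.off_w (x + -1) j (by omega)]
        simp
    · have h0 : ∀ j : ℤ, w ((x : ℤ) + -1) j = 0 := fun j => h.off_w _ _ (by omega)
      have h1 : ∀ y : ℤ, v ((x : ℤ) + -1) y = 0 := fun y => h.off_v _ _ (by omega)
      simp only [h0, h1, smul_zero, sum_const_zero, add_zero]
  have hzero : D 0 (-1) x y • v (x + 0) (y + -1) + D 0 0 x y • v (x + 0) (y + 0)
      + D 0 1 x y • v (x + 0) (y + 1) =
      ∑ j ∈ range (N + 1),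
        ((Ψ x).ν⁻¹ * ((Ψ x).star.p j y * (Φ j).star.a x)) • w (x + 0) j := by
    simp only [h.v_eq_sum (show x ≤ N by omega) (show (x : ℤ) + 0 = (x : ℕ) by omega),
        smul_sum, ← sum_add_distrib]
    refine sum_congr rfl fun j _ => ?_
    by_cases hj : x + j ≤ N
    · have h1 := hD.zero x y j hxy hj
      rw [sum_insert (by decide), sum_pair (by decide)] at h1
      rw [mul_comm ((Ψ x).star.p j y), h1]
      module
    · rw [h.off_w (x + 0) j (by omega)]
      simp
  have hplus : D 1 (-1) x y • v (x + 1) (y + -1) + D 1 0 x y • v (x + 1) (y + 0) =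
      ∑ j ∈ range (N + 1),
        ((Ψ x).ν⁻¹ * ((Ψ x).star.p j y * (Φ j).star.c (x + 1))) • w (x + 1) j := by
    by_cases hx : x + 1 ≤ N
    · simp only [h.v_eq_sum hx (show (x : ℤ) + 1 = (x + 1 : ℕ) by omega),
        smul_sum, ← sum_add_distrib]
      refine sum_congr rfl fun j _ => ?_
      by_cases hj : (x + 1) + j ≤ N
      · have h1 := hD.plus x y j hxy hj
        have h2 := hν (x + 1) hx
        rw [sum_pair (by decide)] at h1
        rw [mul_comm ((Ψ x).star.p j y), h1, div_eq_mul_inv]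
        simp only [← mul_assoc, inv_mul_cancel₀ hνx, one_mul]
        module
      · rw [h.off_w (x + 1) j (by omega)]
        simp
    · have h0 : ∀ j : ℤ, w ((x : ℤ) + 1) j = 0 := fun j => h.off_w _ _ (by omega)
      have h1 : ∀ y : ℤ, v ((x : ℤ) + 1) y = 0 := fun y => h.off_v _ _ (by omega)
      simp only [h0, h1, smul_zero, sum_const_zero, add_zero]
  rw [sum_A2', hminus, hzero, hplus, h.v_eq_sum (show x ≤ N by omega) rfl, map_smul, map_sum,
    ← sum_add_distrib, ← sum_add_distrib, smul_sum]
  refine sum_congr rfl fun j _ => ?_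
  rw [map_smul]
  by_cases hj : x + j ≤ N
  · rw [h.Xs_w hj, add_zero, ← sub_eq_add_neg]
    module
  · rw [ParameterArray.p_eq_zero_left _ (by
      rw [show (Ψ x).star.d = N - x from h.tri.Ψ_d x]; omega)]
    simp

end IsTriangularModel

end TriangularModel

/-! ### Coordinates, adjacency and eigenspaces for bases indexed by the triangle -/

section TriangleBasis

variable {K : Type*} [Field K] {V : Type*} [AddCommGroup V] [Module K V] {N : ℕ}
  {m : ℤ → ℤ → V} {b : Module.Basis (TriDom N) K V}

theorem VanishesOff.eq_zero_or_eq (hm : VanishesOff N m) (hb : ∀ l, b l = m l.1.1 l.1.2)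
    (x y : ℤ) : (m x y = 0 ∧ ∀ l : TriDom N, ¬ (x = l.1.1 ∧ y = l.1.2)) ∨
      ∃ l : TriDom N, x = l.1.1 ∧ y = l.1.2 ∧ m x y = b l := by
  by_cases hxy : x < 0 ∨ y < 0 ∨ N < x + y
  · exact Or.inl ⟨hm x y hxy, fun l => by have := l.2; omega⟩
  · have h1 : ((x.toNat : ℕ) : ℤ) = x := Int.toNat_of_nonneg (by omega)
    have h2 : ((y.toNat : ℕ) : ℤ) = y := Int.toNat_of_nonneg (by omega)
    refine Or.inr ⟨⟨(x.toNat, y.toNat), by dsimp only; omega⟩, h1.symm, h2.symm, ?_⟩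
    rw [hb]
    simp only [h1, h2]

theorem VanishesOff.repr_apply (hm : VanishesOff N m) (hb : ∀ l, b l = m l.1.1 l.1.2)
    (x y : ℤ) (l : TriDom N) :
    b.repr (m x y) l = if x = l.1.1 ∧ y = l.1.2 then 1 else 0 := by
  rcases hm.eq_zero_or_eq hb x y with ⟨h0, h1⟩ | ⟨k, hx, hy, hk⟩
  · rw [h0, if_neg (h1 l)]
    simp
  · rw [hk, Module.Basis.repr_self, Finsupp.single_apply]
    congr 1
    rw [hx, hy, Subtype.ext_iff, Prod.ext_iff, Nat.cast_inj, Nat.cast_inj]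

theorem VanishesOff.bilin_apply (hm : VanishesOff N m) (hb : ∀ l, b l = m l.1.1 l.1.2)
    {B : LinearMap.BilinForm K V} {F : TriDom N → K}
    (hB : ∀ l k, B (b l) (b k) = if l = k then F l else 0) (x y : ℤ) (l : TriDom N) :
    B (b l) (m x y) = if x = l.1.1 ∧ y = l.1.2 then F l else 0 := by
  rcases hm.eq_zero_or_eq hb x y with ⟨h0, h1⟩ | ⟨k, hx, hy, hk⟩
  · rw [h0, if_neg (h1 l), map_zero]
  · rw [hk, hB]
    congr 1
    rw [hx, hy, Subtype.ext_iff, Prod.ext_iff, Nat.cast_inj, Nat.cast_inj]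
    exact propext ⟨fun e => ⟨e.1.symm, e.2.symm⟩, fun e => ⟨e.1.symm, e.2.symm⟩⟩

theorem VanishesOff.mem_iSup_adj (hm : VanishesOff N m) (hb : ∀ l, b l = m l.1.1 l.1.2)
    (l : TriDom N) {e : ℤ × ℤ} (he : e ∈ A2) :
    m (l.1.1 + e.1) (l.1.2 + e.2) ∈ ⨆ (k : TriDom N) (_ : A2Adj k l), Submodule.span K {b k} := by
  rcases hm.eq_zero_or_eq hb (l.1.1 + e.1) (l.1.2 + e.2) with ⟨h0, -⟩ | ⟨k, hx, hy, hk⟩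
  · rw [h0]
    exact Submodule.zero_mem _
  · rw [hk]
    refine Submodule.mem_iSup_of_mem k (Submodule.mem_iSup_of_mem ?_
      (Submodule.mem_span_singleton_self _))
    rw [A2Adj, ← hx, ← hy, add_sub_cancel_left, add_sub_cancel_left]
    exact he

/-- Only S is given by an expansion over all of A_2; T has a shorter one and enters through
membership. The lemma serves (X*, Y*) on v and (Y, X) on vs. -/
theorem VanishesOff.map_le_iSup_adj (hm : VanishesOff N m) (hb : ∀ l, b l = m l.1.1 l.1.2)
    {S T : Module.End K V} {D : ℤ → ℤ → ℕ → ℕ → K}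
    (hS : ∀ x y : ℕ, x + y ≤ N →
      S (m x y) = ∑ e ∈ A2, D e.1 e.2 x y • m (x + e.1) (y + e.2))
    (hT : ∀ l : TriDom N, T (b l) ∈ ⨆ (k : TriDom N) (_ : A2Adj k l), Submodule.span K {b k})
    {R : Module.End K V} (hR : R ∈ Submodule.span K {S, T}) (l : TriDom N) :
    (Submodule.span K {b l}).map R ≤
      ⨆ (k : TriDom N) (_ : A2Adj k l), Submodule.span K {b k} := by
  obtain ⟨r, s, rfl⟩ := Submodule.mem_span_pair.1 hR
  rw [Submodule.map_span_le]
  rintro _ rfl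
  rw [LinearMap.add_apply, LinearMap.smul_apply, LinearMap.smul_apply]
  refine Submodule.add_mem _ (Submodule.smul_mem _ _ ?_) (Submodule.smul_mem _ _ (hT l))
  rw [hb, hS _ _ l.2]
  exact Submodule.sum_mem _ fun e he => Submodule.smul_mem _ _ (hm.mem_iSup_adj hb l he)

theorem span_range_eq_of_forall {ι : Type*} {b : Module.Basis ι K V} {S : Set ι} {n : ℕ}
    {f : Fin n → V} {g : Fin n → ι} (hf : ∀ i, f i = b (g i)) (hg : Set.range g = S) :
    Submodule.span K (Set.range f) = Submodule.span K (b '' S) := by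
  rw [← hg, ← Set.range_comp]
  congr 2
  exact funext hf

theorem apply_mem_eigenspace_of_commute {S T : Module.End K V} (h : Commute S T) {μ : K} {u : V}
    (hu : u ∈ Module.End.eigenspace T μ) : S u ∈ Module.End.eigenspace T μ := by
  rw [Module.End.mem_eigenspace_iff] at hu ⊢
  have h1 := LinearMap.congr_fun h u
  simp only [Module.End.mul_apply] at h1
  rw [← h1, hu, map_smul]

end TriangleBasis

/-! ### The model is a factorized A_2-Leonard pair with the given arrays -/

section FactorizedPair

variable {K : Type*} [Field K] {V : Type*} [AddCommGroup V] [Module K V]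
  {N : ℕ} {t θs : ℕ → K} {Φ Ψ : ℕ → ParameterArray K}

namespace IsTriangularModel

variable {v w vs : ℤ → ℤ → V} {X Y Xs Ys : Module.End K V}
  {bv bw bvs : Module.Basis (TriDom N) K V}

section Eigen

theorem eigen_X (h : IsTriangularModel N t θs Φ Ψ v w vs X Y Xs Ys)
    (hbv : ∀ l, bv l = v l.1.1 l.1.2) (l : TriDom N) : X (bv l) = t l.1.1 • bv l := by
  rw [hbv, h.X_v _ _ l.2]

theorem eigen_Y (h : IsTriangularModel N t θs Φ Ψ v w vs X Y Xs Ys)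
    (hbv : ∀ l, bv l = v l.1.1 l.1.2) (l : TriDom N) :
    Y (bv l) = (Ψ l.1.1).θ l.1.2 • bv l := by
  rw [hbv, h.Y_v _ _ l.2]

theorem eigen_Xs (h : IsTriangularModel N t θs Φ Ψ v w vs X Y Xs Ys)
    (hbvs : ∀ l, bvs l = vs l.1.1 l.1.2) (l : TriDom N) :
    Xs (bvs l) = (Φ l.1.2).θs l.1.1 • bvs l := by
  rw [hbvs, h.Xs_vs _ _ l.2]

theorem eigen_Ys (h : IsTriangularModel N t θs Φ Ψ v w vs X Y Xs Ys)
    (hbvs : ∀ l, bvs l = vs l.1.1 l.1.2) (l : TriDom N) :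
    Ys (bvs l) = θs l.1.2 • bvs l := by
  rw [hbvs, h.Ys_vs _ _ l.2]

theorem eigen_X_w (h : IsTriangularModel N t θs Φ Ψ v w vs X Y Xs Ys)
    (hbw : ∀ l, bw l = w l.1.1 l.1.2) (l : TriDom N) : X (bw l) = t l.1.1 • bw l := by
  have := l.2
  rw [hbw, h.X_w (by omega)]

theorem eigen_Ys_w (h : IsTriangularModel N t θs Φ Ψ v w vs X Y Xs Ys)
    (hbw : ∀ l, bw l = w l.1.1 l.1.2) (l : TriDom N) : Ys (bw l) = θs l.1.2 • bw l := by
  have := l.2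
  rw [hbw, h.Ys_w (by omega)]

end Eigen

theorem _root_.IsTriangular.inj_v (h : IsTriangular N t θs Φ Ψ) (l m : TriDom N)
    (h1 : t l.1.1 = t m.1.1) (h2 : (Ψ l.1.1).θ l.1.2 = (Ψ m.1.1).θ m.1.2) : l = m := by
  have hl := l.2
  have hm := m.2
  have e := h.t_inj (by omega) (by omega) h1
  rw [← e] at h2
  refine Subtype.ext (Prod.ext e ((h.Ψ_reg l.1.1 (by omega)).θ_inj _ _ ?_ ?_ h2)) <;>
  · rw [h.Ψ_d]; omega

theorem _root_.IsTriangular.inj_vs (h : IsTriangular N t θs Φ Ψ) (l m : TriDom N)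
    (h1 : (Φ l.1.2).θs l.1.1 = (Φ m.1.2).θs m.1.1) (h2 : θs l.1.2 = θs m.1.2) : l = m := by
  have hl := l.2
  have hm := m.2
  have e := h.θs_inj (by omega) (by omega) h2
  rw [← e] at h1
  refine Subtype.ext (Prod.ext ((h.Φ_reg l.1.2 (by omega)).reg.θs_inj _ _ ?_ ?_ h1) e) <;>
  · rw [h.Φ_d]; omega

theorem _root_.IsTriangular.inj_w (h : IsTriangular N t θs Φ Ψ) (l m : TriDom N)
    (h1 : t l.1.1 = t m.1.1) (h2 : θs l.1.2 = θs m.1.2) : l = m := by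
  have hl := l.2
  have hm := m.2
  exact Subtype.ext (Prod.ext (h.t_inj (by omega) (by omega) h1)
    (h.θs_inj (by omega) (by omega) h2))

/-- X and Y* have w as a joint eigenbasis with distinct joint eigenvalues, so W contains every
w_{x,j} that occurs in one of its elements. On w, Y and X* reach vertical and horizontal neighbours
with nonzero coefficients b and c. Hence one w_{x,j} in W leads to w_{0,0}, and from there to the
whole triangle. -/
theorem eq_bot_or_eq_top (h : IsTriangularModel N t θs Φ Ψ v w vs X Y Xs Ys)
    (hbw : ∀ l, bw l = w l.1.1 l.1.2) {W : Submodule K V} (hX : ∀ u ∈ W, X u ∈ W)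
    (hY : ∀ u ∈ W, Y u ∈ W) (hXs : ∀ u ∈ W, Xs u ∈ W) (hYs : ∀ u ∈ W, Ys u ∈ W) :
    W = ⊥ ∨ W = ⊤ := by
  refine or_iff_not_imp_left.2 fun hW => ?_
  have hmem : ∀ {u : V}, u ∈ W → ∀ {x j : ℕ} (hxj : x + j ≤ N),
      bw.repr u ⟨(x, j), hxj⟩ ≠ 0 → w x j ∈ W := fun {u} hu x j hxj hne => by
    have h1 := basis_mem_of_invariant (h.eigen_X_w hbw) (h.eigen_Ys_w hbw) h.tri.inj_w hX hYs hu hne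
    rwa [hbw] at h1
  have up_j : ∀ {x j : ℕ}, x + (j + 1) ≤ N → w x j ∈ W → w x (j + 1 : ℕ) ∈ W := by
    intro x j hxj hw
    have hr : ∀ a c : ℤ, bw.repr (w a c) ⟨(x, j + 1), hxj⟩ =
        if a = (x : ℤ) ∧ c = ((j + 1 : ℕ) : ℤ) then 1 else 0 :=
      fun a c => h.off_w.repr_apply hbw a c _
    refine hmem (hY _ hw) hxj ?_
    rw [h.Y_w (by omega), map_add, map_add, map_smul, map_smul, map_smul]
    simp only [Finsupp.add_apply, Finsupp.smul_apply, hr, smul_eq_mul]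
    have h1 := (h.tri.Ψ_reg x (by omega)).reg.c_ne (i := j) (by rw [h.tri.Ψ_d]; omega)
    rw [if_neg (by omega), if_neg (by omega), if_pos (by simp)]
    simpa using h1
  have down_j : ∀ {x j : ℕ}, x + (j + 1) ≤ N → w x (j + 1 : ℕ) ∈ W → w x j ∈ W := by
    intro x j hxj hw
    have hr : ∀ a c : ℤ, bw.repr (w a c) ⟨(x, j), by dsimp only; omega⟩ =
        if a = (x : ℤ) ∧ c = (j : ℤ) then 1 else 0 :=
      fun a c => h.off_w.repr_apply hbw a c _
    refine hmem (hY _ hw) (show x + j ≤ N by omega) ?_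
    rw [h.Y_w hxj, map_add, map_add, map_smul, map_smul, map_smul]
    simp only [Finsupp.add_apply, Finsupp.smul_apply, hr, smul_eq_mul]
    have h1 := (h.tri.Ψ_reg x (by omega)).reg.b_ne (i := j) (by rw [h.tri.Ψ_d]; omega)
    rw [if_pos (by simp), if_neg (by omega), if_neg (by omega)]
    simpa using h1
  have up_x : ∀ {x j : ℕ}, (x + 1) + j ≤ N → w x j ∈ W → w (x + 1 : ℕ) j ∈ W := by
    intro x j hxj hw
    have hr : ∀ a c : ℤ, bw.repr (w a c) ⟨(x + 1, j), hxj⟩ =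
        if a = ((x + 1 : ℕ) : ℤ) ∧ c = (j : ℤ) then 1 else 0 :=
      fun a c => h.off_w.repr_apply hbw a c _
    refine hmem (hXs _ hw) hxj ?_
    rw [h.Xs_w (by omega), map_add, map_add, map_smul, map_smul, map_smul]
    simp only [Finsupp.add_apply, Finsupp.smul_apply, hr, smul_eq_mul]
    have h1 := (h.tri.Φ_reg j (by omega)).star.c_ne (i := x)
      (by rw [show (Φ j).star.d = N - j from h.tri.Φ_d j]; omega)
    rw [if_neg (by omega), if_neg (by omega), if_pos (by simp)]
    simpa using h1
  have down_x : ∀ {x j : ℕ}, (x + 1) + j ≤ N → w (x + 1 : ℕ) j ∈ W → w x j ∈ W := by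
    intro x j hxj hw
    have hr : ∀ a c : ℤ, bw.repr (w a c) ⟨(x, j), by dsimp only; omega⟩ =
        if a = (x : ℤ) ∧ c = (j : ℤ) then 1 else 0 :=
      fun a c => h.off_w.repr_apply hbw a c _
    refine hmem (hXs _ hw) (show x + j ≤ N by omega) ?_
    rw [h.Xs_w hxj, map_add, map_add, map_smul, map_smul, map_smul]
    simp only [Finsupp.add_apply, Finsupp.smul_apply, hr, smul_eq_mul]
    have h1 := (h.tri.Φ_reg j (by omega)).star.b_ne (i := x)
      (by rw [show (Φ j).star.d = N - j from h.tri.Φ_d j]; omega)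
    rw [if_pos (by simp), if_neg (by omega), if_neg (by omega)]
    simpa using h1
  obtain ⟨u, hu, hu0⟩ := Submodule.exists_mem_ne_zero_of_ne_bot hW
  obtain ⟨⟨⟨x, j⟩, hxj⟩, hl⟩ := exists_repr_ne_zero bw hu0
  have h0 := hmem hu hxj hl
  dsimp only at hxj
  have h00 : w (0 : ℕ) (0 : ℕ) ∈ W := by
    have h1 : ∀ j x : ℕ, x + j ≤ N → w x j ∈ W → w x (0 : ℕ) ∈ W := by
      intro j x
      induction j with
      | zero => exact fun _ h => h
      | succ j ih => exact fun hxj h => ih (by omega) (down_j hxj h)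
    have h2 : ∀ x : ℕ, x ≤ N → w x (0 : ℕ) ∈ W → w (0 : ℕ) (0 : ℕ) ∈ W := by
      intro x
      induction x with
      | zero => exact fun _ h => h
      | succ x ih => exact fun hx h => ih (by omega) (down_x (by omega) h)
    exact h2 x (by omega) (h1 j x hxj h0)
  have hx0 : ∀ x : ℕ, x ≤ N → w x (0 : ℕ) ∈ W := by
    intro x
    induction x with
    | zero => exact fun _ => h00
    | succ x ih => exact fun hx => up_x (by omega) (ih (by omega))
  have hall : ∀ j x : ℕ, x + j ≤ N → w x j ∈ W := by
    intro j x
    induction j with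
    | zero => exact fun hx => hx0 x hx
    | succ j ih => exact fun hx => up_j hx (ih (by omega))
  rw [eq_top_iff, ← bw.span_eq, Submodule.span_le]
  rintro _ ⟨l, rfl⟩
  rw [hbw]
  exact hall _ _ l.2

theorem isA2LeonardPair (h : IsTriangularModel N t θs Φ Ψ v w vs X Y Xs Ys) (hN : 0 < N)
    (hbv : ∀ l, bv l = v l.1.1 l.1.2) (hbw : ∀ l, bw l = w l.1.1 l.1.2)
    (hbvs : ∀ l, bvs l = vs l.1.1 l.1.2) {C D : ℤ → ℤ → ℕ → ℕ → K}
    (hC : SatisfiesCons1 N Φ Ψ C) (hD : SatisfiesCons2 N Φ Ψ D)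
    {B : LinearMap.BilinForm K V} (hsymm : B.IsSymm) (hnondeg : B.Nondegenerate)
    {F G : TriDom N → K} (hB : ∀ l m, B (bv l) (bv m) = if l = m then F l else 0)
    (hBs : ∀ l m, B (bvs l) (bvs m) = if l = m then G l else 0) :
    IsA2LeonardPair N (Submodule.span K {X, Y}) (Submodule.span K {Xs, Ys})
      (fun l => Submodule.span K {bv l}) (fun l => Submodule.span K {bvs l}) B := by
  have inj_span : ∀ b : Module.Basis (TriDom N) K V,
      Function.Injective fun l => Submodule.span K {b l} := by
    intro b l m hlm
    have h1 : b l ∈ Submodule.span K {b m} := by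
      rw [← show Submodule.span K {b l} = Submodule.span K {b m} from hlm]
      exact Submodule.mem_span_singleton_self _
    obtain ⟨r, hr⟩ := Submodule.mem_span_singleton.1 h1
    by_contra hne
    have h2 := congrArg (fun u => b.repr u l) hr
    simp [Ne.symm hne] at h2
  have orth : ∀ {b : Module.Basis (TriDom N) K V} {F : TriDom N → K},
      (∀ l m, B (b l) (b m) = if l = m then F l else 0) → ∀ l m, l ≠ m →
      ∀ v ∈ Submodule.span K {b l}, ∀ w ∈ Submodule.span K {b m}, B v w = 0 := by
    intro b F hb l m hlm v hv w hw
    obtain ⟨r, rfl⟩ := Submodule.mem_span_singleton.1 hv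
    obtain ⟨s, rfl⟩ := Submodule.mem_span_singleton.1 hw
    simp [hb, hlm]
  have hX := h.eigen_X hbv
  have hY := h.eigen_Y hbv
  have hXs := h.eigen_Xs hbvs
  have hYs := h.eigen_Ys hbvs
  exact
  -- The points (0,0), (0,1), (1,0) lie in the triangle because N ≥ 1; the first two share the
  -- eigenvalue t_0 of X.
  { finrank_H := finrank_span_pair hX hY (i := ⟨(0, 0), Nat.zero_le _⟩)
      (j := ⟨(0, 1), by dsimp only; omega⟩) (k := ⟨(1, 0), by dsimp only; omega⟩) rfl
      (fun e => by
        simpa using congrArg Subtype.val (h.tri.inj_v ⟨(0, 0), Nat.zero_le _⟩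
          ⟨(0, 1), by dsimp only; omega⟩ rfl e))
      (fun e => absurd (h.tri.t_inj (Nat.zero_le _) hN e) (by simp))
    diag_H := fun T hT => by
      obtain ⟨γ, hγ⟩ := eigen_of_mem_span_pair hT hX hY
      exact isDiagonalizableEnd_of_eigen hγ
    comm_H := fun S hS T hT => by
      obtain ⟨γ, hγ⟩ := eigen_of_mem_span_pair hS hX hY
      obtain ⟨γ', hγ'⟩ := eigen_of_mem_span_pair hT hX hY
      exact commute_of_eigen hγ hγ'
    finrank_Hs := by
      -- Here Y* is the operator with a common eigenvalue at two of the points, (0,0) and (1,0), so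
      -- it has to come first.
      rw [Set.pair_comm]
      exact finrank_span_pair hYs hXs (i := ⟨(0, 0), Nat.zero_le _⟩)
        (j := ⟨(1, 0), by dsimp only; omega⟩) (k := ⟨(0, 1), by dsimp only; omega⟩) rfl
        (fun e => by
          simpa using congrArg Subtype.val (h.tri.inj_vs ⟨(0, 0), Nat.zero_le _⟩
            ⟨(1, 0), by dsimp only; omega⟩ e rfl))
        (fun e => absurd (h.tri.θs_inj (Nat.zero_le _) hN e) (by simp))
    diag_Hs := fun T hT => by
      obtain ⟨γ, hγ⟩ := eigen_of_mem_span_pair hT hXs hYs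
      exact isDiagonalizableEnd_of_eigen hγ
    comm_Hs := fun S hS T hT => by
      obtain ⟨γ, hγ⟩ := eigen_of_mem_span_pair hS hXs hYs
      obtain ⟨γ', hγ'⟩ := eigen_of_mem_span_pair hT hXs hYs
      exact commute_of_eigen hγ hγ'
    bij_E := ⟨inj_span bv, range_span_eq_commonEigenspaces hX hY h.tri.inj_v⟩
    adj_E := fun T hT l => by
      refine h.off_v.map_le_iSup_adj hbv (fun x y hxy => h.Xs_v hD hxy) (fun l => ?_) hT l
      rw [hbv, h.Ys_v l.2]
      have e1 := h.off_v.mem_iSup_adj hbv l (e := (0, -1)) (by decide)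
      have e2 := h.off_v.mem_iSup_adj hbv l (e := (0, 0)) (by decide)
      have e3 := h.off_v.mem_iSup_adj hbv l (e := (0, 1)) (by decide)
      simp only [add_zero, ← sub_eq_add_neg] at e1 e2 e3
      exact Submodule.add_mem _ (Submodule.add_mem _ (Submodule.smul_mem _ _ e1)
        (Submodule.smul_mem _ _ e2)) (Submodule.smul_mem _ _ e3)
    bij_Es := ⟨inj_span bvs, range_span_eq_commonEigenspaces hXs hYs h.tri.inj_vs⟩
    adj_Es := fun T hT l => by
      rw [Set.pair_comm] at hT
      refine h.off_vs.map_le_iSup_adj hbvs (fun x y hxy => h.Y_vs hC hxy) (fun l => ?_) hT l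
      rw [hbvs, h.X_vs l.2]
      have e1 := h.off_vs.mem_iSup_adj hbvs l (e := (-1, 0)) (by decide)
      have e2 := h.off_vs.mem_iSup_adj hbvs l (e := (0, 0)) (by decide)
      have e3 := h.off_vs.mem_iSup_adj hbvs l (e := (1, 0)) (by decide)
      simp only [add_zero, ← sub_eq_add_neg] at e1 e2 e3
      exact Submodule.add_mem _ (Submodule.add_mem _ (Submodule.smul_mem _ _ e1)
        (Submodule.smul_mem _ _ e2)) (Submodule.smul_mem _ _ e3)
    irreducible := fun W hW hWs => by
      have hmap : ∀ {T : Module.End K V} {H : Submodule K (Module.End K V)}, T ∈ H →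
          (∀ T ∈ H, W.map T ≤ W) → ∀ u ∈ W, T u ∈ W :=
        fun hT hH u hu => hH _ hT (Submodule.mem_map_of_mem hu)
      exact h.eq_bot_or_eq_top hbw
        (hmap (Submodule.subset_span (by simp)) hW) (hmap (Submodule.subset_span (by simp)) hW)
        (hmap (Submodule.subset_span (by simp)) hWs) (hmap (Submodule.subset_span (by simp)) hWs)
    finrank_E := fun l => finrank_span_singleton (bv.ne_zero l)
    finrank_Es := fun l => finrank_span_singleton (bvs.ne_zero l)
    symm := hsymm
    nondeg := hnondeg
    orth_E := orth hB
    orth_Es := orth hBs }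

theorem isFactorizedA2LeonardPair (h : IsTriangularModel N t θs Φ Ψ v w vs X Y Xs Ys) (hN : 0 < N)
    (hbv : ∀ l, bv l = v l.1.1 l.1.2) (hbw : ∀ l, bw l = w l.1.1 l.1.2)
    (hbvs : ∀ l, bvs l = vs l.1.1 l.1.2) {C D : ℤ → ℤ → ℕ → ℕ → K}
    (hC : SatisfiesCons1 N Φ Ψ C) (hD : SatisfiesCons2 N Φ Ψ D)
    {B : LinearMap.BilinForm K V} (hsymm : B.IsSymm) (hnondeg : B.Nondegenerate)
    {F G : TriDom N → K} (hF : ∀ l, F l ≠ 0) (hG : ∀ l, G l ≠ 0)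
    (hB : ∀ l m, B (bv l) (bv m) = if l = m then F l else 0)
    (hBs : ∀ l m, B (bvs l) (bvs m) = if l = m then G l else 0) :
    IsFactorizedA2LeonardPair N X Y Xs Ys
      (fun l => Submodule.span K {bv l}) (fun l => Submodule.span K {bvs l}) B where
  isA2LeonardPair := h.isA2LeonardPair hN hbv hbw hbvs hC hD hsymm hnondeg hB hBs
  eigenvalues_X := by
    refine ⟨t, fun x x' hx hx' e => h.tri.t_inj hx hx' e, fun l u hu => ?_⟩
    obtain ⟨r, rfl⟩ := Submodule.mem_span_singleton.1 hu
    rw [map_smul, h.eigen_X hbv, smul_comm]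
  eigenvalues_Ys := by
    refine ⟨θs, fun x x' hx hx' e => h.tri.θs_inj hx hx' e, fun l u hu => ?_⟩
    obtain ⟨r, rfl⟩ := Submodule.mem_span_singleton.1 hu
    rw [map_smul, h.eigen_Ys hbvs, smul_comm]
  comm_X_Ys := commute_of_eigen (h.eigen_X_w hbw) (h.eigen_Ys_w hbw)
  common_X_Ys := fun μ η hne =>
    finrank_eigenspace_inf_eigenspace (h.eigen_X_w hbw) (h.eigen_Ys_w hbw) h.tri.inj_w hne
  irred_X := by
    intro l m h1 h2
    have hl := l.2
    have hm := m.2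
    have hreg := (h.tri.Φ_reg l.1.2 (by omega)).reg
    have hd : l.1.1 < (Φ l.1.2).d := by rw [h.tri.Φ_d]; omega
    refine ⟨⟨bvs m, Submodule.mem_span_singleton_self _, bvs l,
      Submodule.mem_span_singleton_self _, ?_⟩, ⟨bvs l, Submodule.mem_span_singleton_self _, bvs m,
      Submodule.mem_span_singleton_self _, ?_⟩⟩
    · rw [hbvs l, h.X_vs hl, map_add, map_add, map_smul, map_smul, map_smul,
        h.off_vs.bilin_apply hbvs hBs, h.off_vs.bilin_apply hbvs hBs,
        h.off_vs.bilin_apply hbvs hBs, if_neg (by omega), if_neg (by omega), if_pos (by omega)]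
      simpa using ⟨hreg.c_ne hd, hG m⟩
    · rw [hbvs m, h.X_vs hm, map_add, map_add, map_smul, map_smul, map_smul,
        h.off_vs.bilin_apply hbvs hBs, h.off_vs.bilin_apply hbvs hBs,
        h.off_vs.bilin_apply hbvs hBs, if_pos (by omega), if_neg (by omega), if_neg (by omega),
        h1, h2]
      simpa using ⟨hreg.b_ne hd, hG l⟩
  irred_Ys := by
    intro l m h1 h2
    have hl := l.2
    have hm := m.2
    have hreg := (h.tri.Ψ_reg l.1.1 (by omega)).star
    have hd : l.1.2 < (Ψ l.1.1).star.d := by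
      rw [show (Ψ l.1.1).star.d = N - l.1.1 from h.tri.Ψ_d _]; omega
    refine ⟨⟨bv m, Submodule.mem_span_singleton_self _, bv l,
      Submodule.mem_span_singleton_self _, ?_⟩, ⟨bv l, Submodule.mem_span_singleton_self _, bv m,
      Submodule.mem_span_singleton_self _, ?_⟩⟩
    · rw [hbv l, h.Ys_v hl, map_add, map_add, map_smul, map_smul, map_smul,
        h.off_v.bilin_apply hbv hB, h.off_v.bilin_apply hbv hB,
        h.off_v.bilin_apply hbv hB, if_neg (by omega), if_neg (by omega), if_pos (by omega)]
      simpa using ⟨hreg.c_ne hd, hF m⟩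
    · rw [hbv m, h.Ys_v hm, map_add, map_add, map_smul, map_smul, map_smul,
        h.off_v.bilin_apply hbv hB, h.off_v.bilin_apply hbv hB,
        h.off_v.bilin_apply hbv hB, if_pos (by omega), if_neg (by omega), if_neg (by omega),
        h1, h2]
      simpa using ⟨hreg.b_ne hd, hF l⟩

/-- The θ*_j-eigenspace of Y* is spanned by the w_{x,j}, on which X is diagonal and X* has the
normalised tridiagonal form of Φ_j*. The t_x-eigenspace of X is spanned by the v_{x,y}, with Y and
Y* in the same roles for Ψ_x. -/
theorem areAssociatedArrays (h : IsTriangularModel N t θs Φ Ψ v w vs X Y Xs Ys)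
    (hΦ : ∀ j ≤ N, (Φ j).IsParameterArray) (hΨ : ∀ x ≤ N, (Ψ x).IsParameterArray)
    (hbv : ∀ l, bv l = v l.1.1 l.1.2) (hbw : ∀ l, bw l = w l.1.1 l.1.2)
    (hbvs : ∀ l, bvs l = vs l.1.1 l.1.2) :
    AreAssociatedArrays N t θs Φ Ψ X Y Xs Ys := by
  have hXYs := commute_of_eigen (h.eigen_X_w hbw) (h.eigen_Ys_w hbw)
  refine ⟨fun j hj => ?_, fun x hx => ?_⟩
  · have hlt : ∀ i : Fin ((Φ j).d + 1), (i : ℕ) + j ≤ N := fun i => by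
      have h1 := i.2
      have h2 := h.tri.Φ_d j
      omega
    let g : Fin ((Φ j).d + 1) → TriDom N := fun i => ⟨(i, j), hlt i⟩
    have hwg : ∀ i : Fin ((Φ j).d + 1), w (i : ℕ) j = bw (g i) := fun i => (hbw (g i)).symm
    refine ⟨fun u hu => apply_mem_eigenspace_of_commute hXYs hu,
      fun u hu => apply_mem_eigenspace_of_commute
        (commute_of_eigen (h.eigen_Xs hbvs) (h.eigen_Ys hbvs)) hu, ?_⟩
    refine (hΦ j hj).hasParameterArray_restrict (m := fun x => w x j) ?_ ?_ (h.w_zero hj (by omega))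
      (h.w_zero hj (by omega)) ?_ ?_ _ _
    · rw [show (fun i : Fin ((Φ j).d + 1) => w (i : ℕ) j) = bw ∘ g from funext hwg]
      refine bw.linearIndependent.comp g fun i i' e => ?_
      simpa [g, Fin.ext_iff] using e
    · rw [eigenspace_eq_span_of_eigen (h.eigen_Ys_w hbw)]
      refine span_range_eq_of_forall hwg (Set.ext fun l => ⟨?_, fun hl => ?_⟩)
      · rintro ⟨i, rfl⟩
        rfl
      · have := l.2
        have h1 := h.tri.θs_inj (by omega) hj hl
        have h2 := h.tri.Φ_d j
        exact ⟨⟨l.1.1, by omega⟩, Subtype.ext (Prod.ext rfl h1.symm)⟩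
    · intro x hx
      rw [h.tri.Φ_d] at hx
      rw [h.tri.Φ_θ]
      exact h.X_w (by omega) j
    · intro x hx
      rw [h.tri.Φ_d] at hx
      exact h.Xs_w (by omega)
  · have hlt : ∀ i : Fin ((Ψ x).d + 1), x + (i : ℕ) ≤ N := fun i => by
      have h1 := i.2
      have h2 := h.tri.Ψ_d x
      omega
    let g : Fin ((Ψ x).d + 1) → TriDom N := fun i => ⟨(x, i), hlt i⟩
    have hvg : ∀ i : Fin ((Ψ x).d + 1), v x (i : ℕ) = bv (g i) := fun i => (hbv (g i)).symm
    refine ⟨fun u hu => apply_mem_eigenspace_of_commute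
        (commute_of_eigen (h.eigen_Y hbv) (h.eigen_X hbv)) hu,
      fun u hu => apply_mem_eigenspace_of_commute hXYs.symm hu, ?_⟩
    refine (hΨ x hx).hasParameterArray_restrict (m := v x) ?_ ?_ (h.v_zero hx (by omega))
      (h.v_zero hx (by omega)) ?_ ?_ _ _
    · rw [show (fun i : Fin ((Ψ x).d + 1) => v x (i : ℕ)) = bv ∘ g from funext hvg]
      refine bv.linearIndependent.comp g fun i i' e => ?_
      simpa [g, Fin.ext_iff] using e
    · rw [eigenspace_eq_span_of_eigen (h.eigen_X hbv)]
      refine span_range_eq_of_forall hvg (Set.ext fun l => ⟨?_, fun hl => ?_⟩)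
      · rintro ⟨i, rfl⟩
        rfl
      · have := l.2
        have h1 := h.tri.t_inj (by omega) hx hl
        have h2 := h.tri.Ψ_d x
        exact ⟨⟨l.1.2, by omega⟩, Subtype.ext (Prod.ext h1.symm rfl)⟩
    · intro y hy
      rw [h.tri.Ψ_d] at hy
      exact h.Y_v x y (by omega)
    · intro y hy
      rw [h.tri.Ψ_d] at hy
      exact h.Ys_v (by omega)

end IsTriangularModel

/-- The families obtained from a basis `b` by the changes of basis of the arrays. -/
theorem IsTriangular.exists_family (h : IsTriangular N t θs Φ Ψ) (b : TriDom N → V) :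
    ∃ w vs : ℤ → ℤ → V, IsTriangularFamily N t θs Φ Ψ (vecAt b) w vs := by
  let w : ℤ → ℤ → V := fun x j => (Ψ x.toNat).transform (vecAt b x) j
  have hw : VanishesOff N w := by
    intro x j hxj
    -- For x < 0 the truncation selects Ψ_0, and for x > N the diameter truncates to 0, so the sum
    -- is not empty; its terms vanish because the vectors of b do.
    by_cases hx : 0 ≤ x ∧ x ≤ N
    · exact ParameterArray.transform_eq_zero _ _ (by rw [h.Ψ_d]; omega)
    · refine sum_eq_zero fun y _ => ?_
      rw [vanishesOff_vecAt b x y (by omega), smul_zero]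
  refine ⟨w, fun i j => (Φ j.toNat).transform (fun x => w x j) i, h, vanishesOff_vecAt b, hw, ?_,
    fun x _ j => rfl, fun j _ i => rfl⟩
  intro i j hij
  by_cases hj : 0 ≤ j ∧ j ≤ N
  · exact ParameterArray.transform_eq_zero _ _ (by rw [h.Φ_d]; omega)
  · refine sum_eq_zero fun x _ => ?_
    rw [show (fun x => w x j) (x : ℤ) = 0 from hw x j (by omega), smul_zero]

theorem IsTriangularFamily.exists_model {v w vs : ℤ → ℤ → V}
    (h : IsTriangularFamily N t θs Φ Ψ v w vs) {bv bvs : Module.Basis (TriDom N) K V}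
    (hbv : ∀ l, bv l = v l.1.1 l.1.2) (hbvs : ∀ l, bvs l = vs l.1.1 l.1.2) :
    ∃ X Y Xs Ys : Module.End K V, IsTriangularModel N t θs Φ Ψ v w vs X Y Xs Ys := by
  have key : ∀ {b : Module.Basis (TriDom N) K V} {m : ℤ → ℤ → V}, (∀ l, b l = m l.1.1 l.1.2) →
      ∀ (γ : ℕ → ℕ → K) (x y : ℕ), x + y ≤ N →
        b.constr K (fun l => γ l.1.1 l.1.2 • b l) (m x y) = γ x y • m x y := by
    intro b m hb γ x y hxy
    rw [← hb ⟨(x, y), hxy⟩, Module.Basis.constr_basis]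
  exact ⟨_, _, _, _, ⟨h, key hbv fun x _ => t x, key hbv fun x y => (Ψ x).θ y,
    key hbvs fun i j => (Φ j).θs i, key hbvs fun _ j => θs j⟩⟩

end FactorizedPair

/-! ### Assembly of the theorem -/

theorem theorem1 {K : Type u} [Field K] [CharZero K] (N : ℕ) (hN : 0 < N)
    (t : ℕ → K) (ts f g : ℕ → ℕ → K) (θ : ℕ → ℕ → K) (θs : ℕ → K) (varphi phi : ℕ → ℕ → K)
    (Φ Ψ : ℕ → ParameterArray K)
    (hΦ : ∀ j, Φ j = ⟨N - j, t, fun x => ts x j, fun x => f x j, fun x => g x j⟩)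
    (hΨ : ∀ x, Ψ x = ⟨N - x, fun j => θ j x, θs, fun j => varphi j x, fun j => phi j x⟩)
    (hΦpa : ∀ j ≤ N, (Φ j).IsParameterArray)
    (hΨpa : ∀ x ≤ N, (Ψ x).IsParameterArray)
    (hcomp : AreCompatible N Φ Ψ) :
    ∃ C D : ℤ → ℤ → ℕ → ℕ → K,
      SatisfiesCons1 N Φ Ψ C ∧ (∀ C', SatisfiesCons1 N Φ Ψ C' → CoeffsAgree N C' C) ∧
      SatisfiesCons2 N Φ Ψ D ∧ (∀ D', SatisfiesCons2 N Φ Ψ D' → CoeffsAgree N D' D) ∧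
      ∃ (V : Type u) (_ : AddCommGroup V) (_ : Module K V) (X Y Xs Ys : Module.End K V)
        (E Es : TriDom N → Submodule K V) (B : LinearMap.BilinForm K V)
        (v vs : Module.Basis (TriDom N) K V),
        IsFactorizedA2LeonardPair N X Y Xs Ys E Es B ∧
        AreAssociatedArrays N t θs Φ Ψ X Y Xs Ys ∧
        (∀ l, E l = Submodule.span K {v l}) ∧
        (∀ l, Es l = Submodule.span K {vs l}) ∧
        -- the actions on the vectors `V_{x,y}`
        (∀ x y : ℕ, x + y ≤ N →
          X (vecAt v x y) = t x • vecAt v x y ∧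
          Y (vecAt v x y) = θ y x • vecAt v x y ∧
          Xs (vecAt v x y) = ∑ e ∈ A2, D e.1 e.2 x y • vecAt v (x + e.1) (y + e.2) ∧
          Ys (vecAt v x y) = (Ψ x).star.b (y - 1) • vecAt v x (y - 1)
            + (Ψ x).star.a y • vecAt v x y
            + (Ψ x).star.c (y + 1) • vecAt v x (y + 1)) ∧
        -- the actions on the vectors `V*_{i,j}`
        (∀ i j : ℕ, i + j ≤ N →
          X (vecAt vs i j) = (Φ j).b (i - 1) • vecAt vs (i - 1) j
            + (Φ j).a i • vecAt vs i j
            + (Φ j).c (i + 1) • vecAt vs (i + 1) j ∧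
          Y (vecAt vs i j) = ∑ e ∈ A2, C e.1 e.2 i j • vecAt vs (i + e.1) (j + e.2) ∧
          Xs (vecAt vs i j) = ts i j • vecAt vs i j ∧
          Ys (vecAt vs i j) = θs j • vecAt vs i j) ∧
        -- the change of basis
        (∀ i j : ℕ, i + j ≤ N →
          vecAt vs i j = ∑ x ∈ Finset.range (N - j + 1), ∑ y ∈ Finset.range (N - x + 1),
            ((Φ j).p x i * (Ψ x).p y j) • vecAt v x y) := by
  have htri : IsTriangular N t θs Φ Ψ :=
    { Φ_d := fun j => by rw [hΦ]
      Ψ_d := fun x => by rw [hΨ]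
      Φ_θ := fun j => by rw [hΦ]
      Ψ_θs := fun x => by rw [hΨ]
      Φ_reg := fun j hj => (hΦpa j hj).isBiregular
      Ψ_reg := fun x hx => (hΨpa x hx).isBiregular }
  obtain ⟨⟨C, hC⟩, ⟨D, hD⟩, F, G, hFG⟩ := hcomp
  refine ⟨C, D, hC, fun C' hC' => htri.coeffsAgree₁ hC hC', hD,
    fun D' hD' => htri.coeffsAgree₂ hD hD', ?_⟩
  -- Any basis indexed by the triangle would serve: the operators are defined by their eigenvalues,
  -- and no further property of v is used.
  have bv : Module.Basis (TriDom N) K (TriDom N → K) := Pi.basisFun K (TriDom N)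
  have hbv : ∀ l, bv l = vecAt bv l.1.1 l.1.2 := fun l => (vecAt_natCast bv l).symm
  obtain ⟨w, vs, hfam⟩ := htri.exists_family bv
  obtain ⟨bw, bvs, hbw, hbvs⟩ := hfam.exists_bases bv hbv
  obtain ⟨X, Y, Xs, Ys, hmod⟩ := hfam.exists_model hbv hbvs
  -- The form is made orthogonal on v with norms F, nondegenerate since F vanishes nowhere; the
  -- orthogonality of vs is what requirement (3) supplies.
  obtain ⟨B, hB, hsymm, hnondeg⟩ :=
    exists_diagonal_bilinForm bv (fun l => F l.1.1 l.1.2) fun l => hFG.1 _ _ l.2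
  have hBs : ∀ l m, B (bvs l) (bvs m) =
      if l = m then (fun l : TriDom N => G 0 l.1.2 * (Φ l.1.2).k l.1.1) l else 0 := by
    intro l m
    rw [hbvs, hbvs, hfam.bilin_vs hFG ?_ _ _ _ _ l.2 m.2]
    · simp only [Subtype.ext_iff, Prod.ext_iff]
    intro x y x' y' hxy hxy'
    rw [← hbv ⟨(x, y), hxy⟩, ← hbv ⟨(x', y'), hxy'⟩, hB]
    simp only [Subtype.ext_iff, Prod.ext_iff]
  have hG : ∀ l : TriDom N, G 0 l.1.2 * (Φ l.1.2).k l.1.1 ≠ 0 := by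
    intro l
    have hl := l.2
    have hj : l.1.2 ≤ N := by omega
    refine mul_ne_zero (hfam.G_ne hFG hj) ((htri.Φ_reg _ hj).reg.k_ne ?_)
    rw [htri.Φ_d]
    omega
  refine ⟨TriDom N → K, inferInstance, inferInstance, X, Y, Xs, Ys, _, _, B, bv, bvs,
    hmod.isFactorizedA2LeonardPair hN hbv hbw hbvs hC hD hsymm hnondeg (fun l => hFG.1 _ _ l.2) hG
      hB hBs,
    hmod.areAssociatedArrays hΦpa hΨpa hbv hbw hbvs, fun _ => rfl, fun _ => rfl, ?_, ?_, ?_⟩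
  · intro x y hxy
    refine ⟨hmod.X_v x y hxy, ?_, hmod.Xs_v hD hxy, hmod.Ys_v hxy⟩
    rw [hmod.Y_v x y hxy, hΨ]
  · intro i j hij
    rw [hfam.off_vs.vecAt_eq hbvs]
    refine ⟨hmod.X_vs hij, hmod.Y_vs hC hij, ?_, hmod.Ys_vs i j hij⟩
    rw [hmod.Xs_vs i j hij, hΦ]
  · intro i j hij
    rw [hfam.off_vs.vecAt_eq hbvs, hfam.vs_eq j (by omega), ParameterArray.transform, htri.Φ_d]
    refine sum_congr rfl fun x hx => ?_
    have hx' := mem_range.1 hx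
    rw [hfam.w_eq x (by omega), ParameterArray.transform, htri.Ψ_d, smul_sum]
    exact sum_congr rfl fun y _ => smul_smul _ _ _
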